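/- **Setting.** Let $(\Omega,\mathcal F,\mathbb P)$ be a probability space, $\mathbb T:\Omega\to\Omega$ a bijective bimeasurable transformation preserving $\mathbb P$, and $\epsilon_0\in\mathbb L^2(\Omega)$ a real random variable with $\mathbb E(\epsilon_0)=0$; put $\epsilon_i=\epsilon_0\circ\mathbb T^i$ for $i\in\mathbb Z$. Let $\mathcal F_0\subseteq\mathcal F$ be a $\sigma$-algebra with $\mathcal F_0\subseteq\mathbb T^{-1}(\mathcal F_0)$, and $\mathcal F_i=\mathbb T^{-i}(\mathcal F_0)$. Assume that every event of $\mathcal F_{-\infty}=\bigcap_{i\in\mathbb Z}\mathcal F_i$ has probability $0$ or $1$, and that $\epsilon_0$ is measurable with respect to $\mathcal F_\infty=\sigma\big(\bigcup_{i\in\mathbb Z}\mathcal F_i\big)$. With $P_0(Z)=\mathbb E(Z\mid\mathcal F_0)-\mathbb E(Z\mid\mathcal F_{-1})$, assume Hannan's condition $$\text{(C1)}\qquad \sum_{i\in\mathbb Z}\|P_0(\epsilon_i)\|_{\mathbb L^2}<\infty .$$ Let $(x_{i,j})_{i\ge 1,\,1\le j\le p}$ be real numbers, $X=X_n=(x_{i,j})_{1\le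 i\le n,1\le j\le p}$, and $d_j(n)=\big(\sum_{i=1}^n x_{i,j}^2\big)^{1/2}$. Assume that for all $j,l\in\{1,\dots,p\}$ and all integers $k\ge 0$: - (C2) $d_j(n)\to\infty$ as $n\to\infty$; - (C3) $\sup_{1\le i\le n}|x_{i,j}|/d_j(n)\to 0$ as $n\to\infty$; - (C4) the limit $\rho_{j,l}(k)=\lim_{n\to\infty}\sum_{m=1}^{n-k}\dfrac{x_{m,j}\,x_{m+k,l}}{d_j(n)\,d_l(n)}$ exists; - (C5) the matrix $R(0)=[\rho_{j,l}(0)]_{j,l}$ is positive definite. For $\beta\in\mathbb R^p$ let $Y_i=\sum_{j=1}^p x_{i,j}\beta_j+\epsilon_i$ ($i\ge1$), let $\hat\beta=(X^tX)^{-1}X^tY$ be the least squares estimator based on $Y=(Y_1,\dots,Y_n)^t$ (well defined for all large $n$), and let $\hat\epsilon_i=Y_i-\sum_{j=1}^p x_{i,j}\hat\beta_j$, $1\le i\le n$, be the residuals. Let $K(u)=1$ for $|u|\le1$, $K(u)=2-|u|$ for $1\le|u|\le2$, $K(u)=0$ for $|u|>2$, and $$f_n^*(\lambda)=\frac1{2\pi}\sum_{|k|\le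 n-1}K\Big(\frac{|k|}{c_n}\Big)\hat\gamma_k^*\,e^{ik\lambda},\qquad \hat\gamma_k^*=\frac1n\sum_{j=1}^{n-|k|}\hat\epsilon_j\hat\epsilon_{j+|k|}.$$ **Theorem.** Let $(c_n)$ be a sequence of positive integers such that $c_n\to\infty$ and $$c_n\,\mathbb E\Big(|\epsilon_0|^2\Big(1\wedge\frac{c_n}{n}|\epsilon_0|^2\Big)\Big)\longrightarrow 0\qquad(n\to\infty).$$ Then the process $(\epsilon_i)$ has a continuous spectral density, that is, there is a (necessarily unique) continuous function $f:[-\pi,\pi]\to[0,\infty)$ with $\mathrm{Cov}(\epsilon_m,\epsilon_{m+k})=\int_{-\pi}^{\pi}e^{ik\lambda}f(\lambda)\,d\lambda$ for all $m,k\in\mathbb Z$, and $$\sup_{\lambda\in[-\pi,\pi]}\big\|f_n^*(\lambda)-f(\lambda)\big\|_{\mathbb L^1}\longrightarrow 0\qquad(n\to\infty).$$ -/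

import Mathlib

open MeasureTheory ProbabilityTheory Filter Topology

noncomputable section

namespace HannanRegression

/-- The stationary process `ε i = ε₀ ∘ T ^ i`, `i ∈ ℤ`. -/
def process {Ω : Type*} (T : Equiv.Perm Ω) (ε₀ : Ω → ℝ) (i : ℤ) : Ω → ℝ :=
  fun ω => ε₀ ((T ^ i) ω)

/-- `ℱ i = T⁻ⁱ(ℱ₀)`: the sets `(T ^ i) ⁻¹' A` with `A ∈ ℱ₀`. -/
@[reducible] def filt {Ω : Type*} (F₀ : MeasurableSpace Ω) (T : Equiv.Perm Ω) (i : ℤ) : MeasurableSpace Ω :=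
  F₀.comap (fun ω => (T ^ i) ω)

/-- The projection `P_j(Z) = E(Z | ℱ j) - E(Z | ℱ (j - 1))`. -/
def proj {Ω : Type*} (F : ℤ → MeasurableSpace Ω) [MeasurableSpace Ω] (μ : Measure Ω)
    (j : ℤ) (Z : Ω → ℝ) : Ω → ℝ :=
  μ[Z | F j] - μ[Z | F (j - 1)]

/-- `f` is a spectral density on `[-π, π]` of the (second order stationary) process `ε`:
a nonnegative integrable function with
`Cov(ε_m, ε_{m+k}) = ∫_{-π}^{π} e^{ikλ} f(λ) dλ` for all `m, k ∈ ℤ`. -/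
structure IsSpectralDensity {Ω : Type*} [MeasurableSpace Ω] (μ : Measure Ω) (ε : ℤ → Ω → ℝ)
    (f : ℝ → ℝ) : Prop where
  nonneg : ∀ t ∈ Set.Icc (-Real.pi) Real.pi, 0 ≤ f t
  integrable : IntegrableOn f (Set.Icc (-Real.pi) Real.pi)
  fourier : ∀ m k : ℤ, ((covariance (ε m) (ε (m + k)) μ : ℝ) : ℂ) =
    ∫ t in (-Real.pi)..Real.pi, Complex.exp (Complex.I * (k : ℂ) * (t : ℂ)) * (f t : ℂ)

/-- The `n × p` design matrix. The design is a doubly indexed family `x i j` whose rows are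
numbered `i = 1, 2, …`; the value `x 0 j` is never used. -/
def designMatrix {p : ℕ} (x : ℕ → Fin p → ℝ) (n : ℕ) : Matrix (Fin n) (Fin p) ℝ :=
  Matrix.of fun i j => x (i.val + 1) j

/-- `d_j(n)`, the Euclidean norm of the `j`-th column of the `n × p` design matrix. -/
def colNorm {p : ℕ} (x : ℕ → Fin p → ℝ) (j : Fin p) (n : ℕ) : ℝ :=
  Real.sqrt (∑ i ∈ Finset.Icc 1 n, x i j ^ 2)

/-- The responses `Y_i = ∑_j x_{i,j} β_j + ε_i`. -/
def response {Ω : Type*} {p : ℕ} (x : ℕ → Fin p → ℝ) (β : Fin p → ℝ) (ε : ℤ → Ω → ℝ)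
    (i : ℕ) (ω : Ω) : ℝ :=
  ∑ j, x i j * β j + ε (i : ℤ) ω

/-- The least squares estimator `(XᵗX)⁻¹ Xᵗ Y` based on the responses `Y 1, …, Y n`. -/
def leastSquares {Ω : Type*} {p : ℕ} (x : ℕ → Fin p → ℝ) (Y : ℕ → Ω → ℝ)
    (n : ℕ) (ω : Ω) : Fin p → ℝ :=
  (((designMatrix x n).transpose * designMatrix x n)⁻¹ * (designMatrix x n).transpose).mulVec
    (fun i : Fin n => Y (i.val + 1) ω)

/-- The residual of observation `i` in the regression on the first `n` observations. -/
def residual {Ω : Type*} {p : ℕ} (x : ℕ → Fin p → ℝ) (Y : ℕ → Ω → ℝ)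
    (n i : ℕ) (ω : Ω) : ℝ :=
  Y i ω - ∑ j, x i j * leastSquares x Y n ω j

/-- The flat-top kernel. -/
def kernel (u : ℝ) : ℝ :=
  if |u| ≤ 1 then 1 else if |u| ≤ 2 then 2 - |u| else 0

/-- The empirical autocovariance at lag `k`, `|k| ≤ n - 1`, of the residuals. -/
def residualAutocov {Ω : Type*} {p : ℕ} (x : ℕ → Fin p → ℝ) (Y : ℕ → Ω → ℝ)
    (n : ℕ) (k : ℤ) (ω : Ω) : ℝ :=
  (1 / (n : ℝ)) * ∑ j ∈ Finset.Icc 1 (n - k.natAbs),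
    residual x Y n j ω * residual x Y n (j + k.natAbs) ω

/-- The kernel estimator of the spectral density built on the residuals, with bandwidth `c`. -/
def spectralEstimator {Ω : Type*} {p : ℕ} (x : ℕ → Fin p → ℝ) (Y : ℕ → Ω → ℝ)
    (c n : ℕ) (t : ℝ) (ω : Ω) : ℂ :=
  (1 / (2 * (Real.pi : ℂ))) * ∑ k ∈ Finset.Icc (-((n : ℤ) - 1)) ((n : ℤ) - 1),
    (kernel (|(k : ℝ)| / (c : ℝ)) : ℂ) * (residualAutocov x Y n k ω : ℂ) *
      Complex.exp (Complex.I * (k : ℂ) * (t : ℂ))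

end HannanRegression

end

/-!
The empirical autocovariances of the residuals turn the estimator into `1 / (2πn)` times a quadratic
form `∑ w (j - i) ε̂ i ε̂ j` with the lag window `w k = K (|k| / c) cos (k t)`.

The flat-top kernel is `2 · Bartlett (2c) - Bartlett c`, and a Bartlett form is an average of sums
of squares. Hence the form at two sequences differs by at most a multiple of a nonnegative form of
their difference, which is itself at most `12 c` times the sum of squares. The residuals are
`ε - Hε` with `H` the hat matrix, and `E |Hε|² ≤ tr H · ∑ |γ k| = p ∑ |γ k|`, so replacing residuals
by errors costs `O(c)`, which is `o(n)`.

By Hannan's condition `ε₀` is the sum over `l` of the innovations `P₀ (ε (-l))` shifted by `T ^ l`,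
the sum of their norms being finite; this also gives `∑ |γ k| < ∞`. The same domination, now in
expectation, lets one replace `ε₀` by finitely many bounded innovations. For these the quadratic
form concentrates in `L²` around its mean, by orthogonality of martingale differences, as soon as
`c = o(n)`. The mean is `2πn f` up to `o(n)` by dominated convergence.
-/

noncomputable section

namespace HannanRegression

open scoped Real

/-! ### Toeplitz quadratic forms and lag windows -/

section ToeplitzForms

/-- The quadratic form with Toeplitz coefficients `a (j - i)`, `1 ≤ i, j ≤ n`: the unnormalised
lag-window estimator built on `u 1, …, u n`. -/
def quadForm (a : ℤ → ℝ) (n : ℕ) (u : ℕ → ℝ) : ℝ :=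
  ∑ i ∈ Finset.Icc 1 n, ∑ j ∈ Finset.Icc 1 n, a ((j : ℤ) - i) * (u i * u j)

variable {a : ℤ → ℝ}

lemma quadForm_smul (r : ℝ) (a : ℤ → ℝ) (n : ℕ) (u : ℕ → ℝ) :
    quadForm (r • a) n u = r * quadForm a n u := by
  simp only [quadForm, Finset.mul_sum, Pi.smul_apply, smul_eq_mul, mul_assoc]

lemma quadForm_add (a b : ℤ → ℝ) (n : ℕ) (u : ℕ → ℝ) :
    quadForm (a + b) n u = quadForm a n u + quadForm b n u := by
  simp only [quadForm, Pi.add_apply, add_mul, Finset.sum_add_distrib]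

lemma quadForm_sub (a b : ℤ → ℝ) (n : ℕ) (u : ℕ → ℝ) :
    quadForm (a - b) n u = quadForm a n u - quadForm b n u := by
  simp only [quadForm, Pi.sub_apply, sub_mul, Finset.sum_sub_distrib]

lemma quadForm_eq_zero_of_odd (ha : ∀ k, a (-k) = -a k) (n : ℕ) (u : ℕ → ℝ) :
    quadForm a n u = 0 := by
  refine self_eq_neg.1 ?_
  conv_lhs => rw [quadForm, Finset.sum_comm]
  simp only [quadForm, ← Finset.sum_neg_distrib]
  refine Finset.sum_congr rfl fun i _ => Finset.sum_congr rfl fun j _ => ?_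
  rw [← neg_sub (j : ℤ) i, ha]
  ring

lemma quadForm_add_smul (a : ℤ → ℝ) (n : ℕ) (u v : ℕ → ℝ) (s : ℝ) :
    quadForm a n (v + s • u) = quadForm a n v +
      s * (∑ i ∈ Finset.Icc 1 n, ∑ j ∈ Finset.Icc 1 n,
        a ((j : ℤ) - i) * (v i * u j + u i * v j)) + s ^ 2 * quadForm a n u := by
  simp only [quadForm, Finset.mul_sum, ← Finset.sum_add_distrib, Pi.add_apply, Pi.smul_apply,
    smul_eq_mul]
  exact Finset.sum_congr rfl fun i _ => Finset.sum_congr rfl fun j _ => by ring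

/-- A form of the Cauchy-Schwarz inequality, obtained by expanding the form at
`v ± η⁻¹ • (u - v)`. -/
lemma abs_quadForm_sub_le (ha : ∀ w, 0 ≤ quadForm a n w) (u v : ℕ → ℝ) {η : ℝ} (hη : 0 < η) :
    |quadForm a n u - quadForm a n v| ≤
      (1 + 1 / η) * quadForm a n (u - v) + η * quadForm a n v := by
  have hplus := mul_nonneg hη.le (ha (v + (1 / η) • (u - v)))
  have hminus := mul_nonneg hη.le (ha (v + (-(1 / η)) • (u - v)))
  have hu := quadForm_add_smul a n (u - v) v 1
  rw [one_smul, add_sub_cancel, one_pow, one_mul, one_mul] at hu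
  rw [quadForm_add_smul] at hplus hminus
  set cross := ∑ i ∈ Finset.Icc 1 n, ∑ j ∈ Finset.Icc 1 n,
    a ((j : ℤ) - i) * (v i * (u - v) j + (u - v) i * v j)
  have hη1 : η * (1 / η) = 1 := mul_one_div_cancel hη.ne'
  have hplus' : 0 ≤ η * quadForm a n v + cross + 1 / η * quadForm a n (u - v) := by
    linear_combination hplus + (cross + 1 / η * quadForm a n (u - v)) * hη1
  have hminus' : 0 ≤ η * quadForm a n v - cross + 1 / η * quadForm a n (u - v) := by
    linear_combination hminus + (1 / η * quadForm a n (u - v) - cross) * hη1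
  have hd := ha (u - v)
  rw [hu, abs_le]
  constructor <;> linarith

lemma card_near_le (L n i : ℕ) :
    ((Finset.Icc 1 n).filter fun j : ℕ => |(j : ℤ) - i| < L).card ≤ 2 * L := by
  have hsub : ((Finset.Icc 1 n).filter fun j : ℕ => |(j : ℤ) - i| < L) ⊆
      Finset.Ico (i - (L - 1)) (i + L) := by
    intro j hj
    rw [Finset.mem_filter, abs_lt] at hj
    rw [Finset.mem_Ico]
    omega
  refine (Finset.card_le_card hsub).trans ?_
  rw [Nat.card_Ico]
  omega

lemma quadForm_le_of_banded {M : ℝ} (haM : ∀ k, |a k| ≤ M) {L : ℕ}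
    (haL : ∀ k : ℤ, (L : ℤ) ≤ |k| → a k = 0) (n : ℕ) (u : ℕ → ℝ) :
    quadForm a n u ≤ 2 * L * M * ∑ i ∈ Finset.Icc 1 n, u i ^ 2 := by
  have hM : 0 ≤ M := (abs_nonneg _).trans (haM 0)
  have hterm : ∀ i j : ℕ, a ((j : ℤ) - i) * (u i * u j) ≤
      (if |(j : ℤ) - i| < L then M / 2 * u i ^ 2 else 0) +
      (if |(i : ℤ) - j| < L then M / 2 * u j ^ 2 else 0) := by
    intro i j
    rw [abs_sub_comm (i : ℤ) j]
    split_ifs with hij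
    · calc a ((j : ℤ) - i) * (u i * u j) ≤ |a ((j : ℤ) - i)| * |u i * u j| := by
            rw [← abs_mul]; exact le_abs_self _
        _ ≤ M * ((u i ^ 2 + u j ^ 2) / 2) := by
            gcongr
            · exact haM _
            · rw [abs_mul, ← sq_abs (u i), ← sq_abs (u j)]
              linarith [two_mul_le_add_sq |u i| |u j|]
        _ = M / 2 * u i ^ 2 + M / 2 * u j ^ 2 := by ring
    · rw [haL _ (not_lt.1 hij), zero_mul, add_zero]
  have hrow : ∀ i : ℕ, ∑ j ∈ Finset.Icc 1 n,
      (if |(j : ℤ) - i| < L then M / 2 * u i ^ 2 else 0) ≤ L * M * u i ^ 2 := by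
    intro i
    rw [← Finset.sum_filter, Finset.sum_const, nsmul_eq_mul]
    calc _ ≤ ((2 * L : ℕ) : ℝ) * (M / 2 * u i ^ 2) := by
          gcongr
          exact card_near_le L n i
      _ = L * M * u i ^ 2 := by push_cast; ring
  calc quadForm a n u ≤ _ :=
        Finset.sum_le_sum fun i _ => Finset.sum_le_sum fun j _ => hterm i j
    _ = ∑ i ∈ Finset.Icc 1 n, ∑ j ∈ Finset.Icc 1 n,
          (if |(j : ℤ) - i| < L then M / 2 * u i ^ 2 else 0) +
        ∑ i ∈ Finset.Icc 1 n, ∑ j ∈ Finset.Icc 1 n,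
          (if |(j : ℤ) - i| < L then M / 2 * u i ^ 2 else 0) := by
        simp_rw [Finset.sum_add_distrib]
        congr 1
        rw [Finset.sum_comm]
    _ ≤ ∑ i ∈ Finset.Icc 1 n, L * M * u i ^ 2 + ∑ i ∈ Finset.Icc 1 n, L * M * u i ^ 2 :=
        add_le_add (Finset.sum_le_sum fun i _ => hrow i) (Finset.sum_le_sum fun i _ => hrow i)
    _ = 2 * L * M * ∑ i ∈ Finset.Icc 1 n, u i ^ 2 := by rw [← Finset.mul_sum]; ring

lemma sum_diagonals {M : Type*} [NonUnitalNonAssocSemiring M] (n : ℕ) (a : ℤ → M)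
    (g : ℕ → ℕ → M) (hg : ∀ i j, g i j = g j i) :
    ∑ i ∈ Finset.Icc 1 n, ∑ j ∈ Finset.Icc 1 n, a ((j : ℤ) - i) * g i j =
      ∑ k ∈ Finset.Icc (-((n : ℤ) - 1)) ((n : ℤ) - 1),
        a k * ∑ j ∈ Finset.Icc 1 (n - k.natAbs), g j (j + k.natAbs) := by
  rw [← Finset.sum_product', ← Finset.sum_fiberwise_of_maps_to
    (t := Finset.Icc (-((n : ℤ) - 1)) ((n : ℤ) - 1)) (g := fun q : ℕ × ℕ => (q.2 : ℤ) - q.1)]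
  · refine Finset.sum_congr rfl fun k hk => ?_
    rw [Finset.mul_sum]
    symm
    refine Finset.sum_bij' (fun j _ => if 0 ≤ k then (j, j + k.natAbs) else (j + k.natAbs, j))
      (fun q _ => min q.1 q.2) ?_ ?_ ?_ ?_ ?_
    · intro j hj
      rw [Finset.mem_Icc] at hj hk
      simp only [Finset.mem_filter, Finset.mem_product, Finset.mem_Icc]
      split_ifs with h <;> simp only [] <;> omega
    · intro q hq
      simp only [Finset.mem_filter, Finset.mem_product, Finset.mem_Icc] at hq ⊢
      omega
    · intro j _
      split_ifs with h <;> simp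
    · intro q hq
      simp only [Finset.mem_filter, Finset.mem_product, Finset.mem_Icc] at hq
      split_ifs with h <;> ext <;> simp only [] <;> omega
    · intro j _
      split_ifs with h
      · have : (((j + k.natAbs : ℕ) : ℤ) - j) = k := by omega
        simp only [this]
      · have : ((j : ℤ) - ((j + k.natAbs : ℕ) : ℤ)) = k := by omega
        simp only [this, hg j]
  · intro q hq
    simp only [Finset.mem_product, Finset.mem_Icc] at hq ⊢
    omega

end ToeplitzForms

section LagWindows

/-- The triangular kernel with bandwidth `c`, at integer lags. -/
def triangle (c : ℕ) (k : ℤ) : ℝ := max 0 (1 - |(k : ℝ)| / c)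

/-- The Bartlett lag window at frequency `t`. It serves as a building block because the form with
these coefficients is a sum of squares, unlike that of the flat-top kernel. -/
def bartlett (c : ℕ) (t : ℝ) (k : ℤ) : ℝ := triangle c k * Real.cos (k * t)

/-- The lag window of the estimator. The sine part of `e ^ (ikt)` is omitted: it is odd in `k`, so
that it does not contribute. -/
def lagWindow (c : ℕ) (t : ℝ) (k : ℤ) : ℝ := kernel (|(k : ℝ)| / c) * Real.cos (k * t)

/-- The coefficients of the nonnegative form that controls the perturbations of the form with
coefficients `lagWindow c t = 2 • bartlett (2 * c) t - bartlett c t`. -/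
def dominatingWindow (c : ℕ) (t : ℝ) : ℤ → ℝ := (2 : ℝ) • bartlett (2 * c) t + bartlett c t

/-- The windowed trigonometric sums, over the window `(s - c, s]`, whose squares add up to the
Bartlett form (`φ` is `cos` or `sin`). -/
def windowSum (φ : ℝ → ℝ) (c n : ℕ) (t : ℝ) (u : ℕ → ℝ) (s : ℕ) : ℝ :=
  ∑ i ∈ Finset.Icc 1 n, (if i ≤ s ∧ s < i + c then (1 : ℝ) else 0) * φ (i * t) * u i

lemma triangle_nonneg (c : ℕ) (k : ℤ) : 0 ≤ triangle c k := le_max_left _ _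

lemma triangle_le_one (c : ℕ) (k : ℤ) : triangle c k ≤ 1 :=
  max_le zero_le_one (sub_le_self _ (by positivity))

lemma triangle_eq_zero {c : ℕ} (hc : 0 < c) {k : ℤ} (hk : (c : ℤ) ≤ |k|) : triangle c k = 0 := by
  have hk' : (c : ℝ) ≤ |(k : ℝ)| := by exact_mod_cast hk
  exact max_eq_left (sub_nonpos.2 ((one_le_div (by exact_mod_cast hc)).2 hk'))

lemma natCast_mul_triangle_sub {c : ℕ} (hc : 0 < c) (i j : ℕ) :
    c * triangle c ((j : ℤ) - i) = ((min i j + c - max i j : ℕ) : ℝ) := by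
  have hc' : (0 : ℝ) < c := by exact_mod_cast hc
  have hdist : |(j : ℝ) - i| = ((max i j : ℕ) : ℝ) - ((min i j : ℕ) : ℝ) := by
    push_cast
    rw [max_sub_min_eq_abs]
  unfold triangle
  rw [mul_max_of_nonneg _ _ hc'.le, mul_zero, mul_sub, mul_one, mul_div_cancel₀ _ hc'.ne',
    Int.cast_sub, Int.cast_natCast, Int.cast_natCast, hdist]
  rcases le_total (max i j) (min i j + c) with h | h
  · have h' : ((max i j : ℕ) : ℝ) ≤ (min i j : ℕ) + c := by exact_mod_cast h
    rw [Nat.cast_sub h, max_eq_right (by linarith), Nat.cast_add]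
    ring
  · have h' : ((min i j : ℕ) : ℝ) + c ≤ (max i j : ℕ) := by exact_mod_cast h
    rw [Nat.sub_eq_zero_of_le h, max_eq_left (by linarith), Nat.cast_zero]

lemma sum_window {n c : ℕ} (hc : 0 < c) {i j : ℕ} (hi : i ≤ n) (hj : j ≤ n) :
    ∑ s ∈ Finset.range (n + c), (if i ≤ s ∧ s < i + c then (1 : ℝ) else 0) *
      (if j ≤ s ∧ s < j + c then 1 else 0) = c * triangle c ((j : ℤ) - i) := by
  have hinter : ∀ s, (if i ≤ s ∧ s < i + c then (1 : ℝ) else 0) *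
      (if j ≤ s ∧ s < j + c then 1 else 0) =
      if s ∈ Finset.Ico (max i j) (min i j + c) then 1 else 0 := by
    intro s
    simp only [Finset.mem_Ico]
    split_ifs <;> first | omega | norm_num
  have hsub : Finset.Ico (max i j) (min i j + c) ⊆ Finset.range (n + c) := by
    intro s
    simp only [Finset.mem_Ico, Finset.mem_range]
    omega
  simp_rw [hinter]
  rw [Finset.sum_ite_mem, Finset.inter_eq_right.2 hsub, Finset.sum_const, Nat.card_Ico, nsmul_one,
    natCast_mul_triangle_sub hc]

lemma quadForm_bartlett {c : ℕ} (hc : 0 < c) (n : ℕ) (t : ℝ) (u : ℕ → ℝ) :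
    c * quadForm (bartlett c t) n u =
      ∑ s ∈ Finset.range (n + c),
        (windowSum Real.cos c n t u s ^ 2 + windowSum Real.sin c n t u s ^ 2) := by
  have hexpand : ∀ s, windowSum Real.cos c n t u s ^ 2 + windowSum Real.sin c n t u s ^ 2 =
      ∑ i ∈ Finset.Icc 1 n, ∑ j ∈ Finset.Icc 1 n,
        ((if i ≤ s ∧ s < i + c then (1 : ℝ) else 0) * (if j ≤ s ∧ s < j + c then 1 else 0)) *
        (Real.cos ((((j : ℤ) - i : ℤ) : ℝ) * t) * (u i * u j)) := by
    intro s
    simp only [windowSum, sq, Finset.sum_mul_sum, ← Finset.sum_add_distrib]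
    refine Finset.sum_congr rfl fun i _ => Finset.sum_congr rfl fun j _ => ?_
    push_cast
    rw [sub_mul, Real.cos_sub]
    ring
  simp_rw [hexpand]
  rw [Finset.sum_comm, quadForm, Finset.mul_sum]
  refine Finset.sum_congr rfl fun i hi => ?_
  rw [Finset.sum_comm, Finset.mul_sum]
  refine Finset.sum_congr rfl fun j hj => ?_
  rw [← Finset.sum_mul, sum_window hc (Finset.mem_Icc.1 hi).2 (Finset.mem_Icc.1 hj).2, bartlett]
  ring

lemma quadForm_bartlett_nonneg {c : ℕ} (hc : 0 < c) (n : ℕ) (t : ℝ) (u : ℕ → ℝ) :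
    0 ≤ quadForm (bartlett c t) n u := by
  have hc' : (0 : ℝ) < c := by exact_mod_cast hc
  refine nonneg_of_mul_nonneg_right ?_ hc'
  rw [quadForm_bartlett hc]
  positivity

lemma abs_kernel_le_one (u : ℝ) : |kernel u| ≤ 1 := by
  unfold kernel
  split_ifs with h1 h2
  · rw [abs_one]
  · rw [abs_le]
    constructor <;> linarith
  · rw [abs_zero]
    exact zero_le_one

lemma kernel_eq_zero {u : ℝ} (hu : 2 ≤ |u|) : kernel u = 0 := by
  unfold kernel
  split_ifs <;> linarith

lemma kernel_eq_triangle (c : ℕ) (k : ℤ) :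
    kernel (|(k : ℝ)| / c) = 2 * triangle (2 * c) k - triangle c k := by
  have h0 : 0 ≤ |(k : ℝ)| / c := by positivity
  have h2 : |(k : ℝ)| / ((2 * c : ℕ) : ℝ) = |(k : ℝ)| / c / 2 := by
    push_cast
    ring
  unfold kernel triangle
  rw [h2, abs_of_nonneg h0]
  generalize |(k : ℝ)| / (c : ℝ) = u at *
  split_ifs with h1 h3
  · rw [max_eq_right (by linarith), max_eq_right (by linarith)]; ring
  · rw [max_eq_right (by linarith), max_eq_left (by linarith)]; ring
  · rw [max_eq_left (by linarith), max_eq_left (by linarith)]; ring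

lemma lagWindow_eq_bartlett (c : ℕ) (t : ℝ) :
    lagWindow c t = (2 : ℝ) • bartlett (2 * c) t - bartlett c t := by
  ext k
  simp only [lagWindow, bartlett, kernel_eq_triangle, Pi.sub_apply, Pi.smul_apply, smul_eq_mul]
  ring

lemma abs_lagWindow_le_one (c : ℕ) (t : ℝ) (k : ℤ) : |lagWindow c t k| ≤ 1 := by
  rw [lagWindow, abs_mul]
  exact mul_le_one₀ (abs_kernel_le_one _) (abs_nonneg _) (Real.abs_cos_le_one _)

lemma lagWindow_eq_zero {c : ℕ} (hc : 0 < c) (t : ℝ) {k : ℤ} (hk : 2 * (c : ℤ) ≤ |k|) :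
    lagWindow c t k = 0 := by
  have hk' : 2 * (c : ℝ) ≤ |(k : ℝ)| := by exact_mod_cast hk
  rw [lagWindow, kernel_eq_zero, zero_mul]
  rwa [abs_of_nonneg (by positivity), le_div_iff₀ (by exact_mod_cast hc)]

lemma abs_dominatingWindow_le (c : ℕ) (t : ℝ) (k : ℤ) : |dominatingWindow c t k| ≤ 3 := by
  have hbound : ∀ c, |bartlett c t k| ≤ 1 := by
    intro c
    rw [bartlett, abs_mul, abs_of_nonneg (triangle_nonneg c k)]
    exact mul_le_one₀ (triangle_le_one c k) (abs_nonneg _) (Real.abs_cos_le_one _)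
  simp only [dominatingWindow, Pi.add_apply, Pi.smul_apply, smul_eq_mul]
  calc _ ≤ |2 * bartlett (2 * c) t k| + |bartlett c t k| := abs_add_le _ _
    _ ≤ 3 := by rw [abs_mul, abs_two]; linarith [hbound (2 * c), hbound c]

lemma dominatingWindow_eq_zero {c : ℕ} (hc : 0 < c) (t : ℝ) {k : ℤ} (hk : 2 * (c : ℤ) ≤ |k|) :
    dominatingWindow c t k = 0 := by
  simp only [dominatingWindow, bartlett, Pi.add_apply, Pi.smul_apply, smul_eq_mul,
    triangle_eq_zero (c := 2 * c) (by omega) (by exact_mod_cast hk),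
    triangle_eq_zero hc (by omega : (c : ℤ) ≤ |k|), zero_mul, mul_zero, add_zero]

lemma quadForm_dominatingWindow_le {c : ℕ} (hc : 0 < c) (t : ℝ) (n : ℕ) (u : ℕ → ℝ) :
    quadForm (dominatingWindow c t) n u ≤ 12 * c * ∑ i ∈ Finset.Icc 1 n, u i ^ 2 := by
  refine (quadForm_le_of_banded (abs_dominatingWindow_le c t) (L := 2 * c)
    (fun k hk => dominatingWindow_eq_zero hc t (by exact_mod_cast hk)) n u).trans_eq ?_
  push_cast
  ring

lemma abs_quadForm_lagWindow_sub_le {c : ℕ} (hc : 0 < c) (n : ℕ) (t : ℝ) (u v : ℕ → ℝ)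
    {η : ℝ} (hη : 0 < η) :
    |quadForm (lagWindow c t) n u - quadForm (lagWindow c t) n v| ≤
      (1 + 1 / η) * quadForm (dominatingWindow c t) n (u - v) +
        η * quadForm (dominatingWindow c t) n v := by
  have h2c := abs_le.1 (abs_quadForm_sub_le
    (quadForm_bartlett_nonneg (c := 2 * c) (by omega) n t) u v hη)
  have h1c := abs_le.1 (abs_quadForm_sub_le (quadForm_bartlett_nonneg hc n t) u v hη)
  simp only [lagWindow_eq_bartlett, dominatingWindow, quadForm_sub, quadForm_add, quadForm_smul]
  rw [abs_le]
  constructor <;> linarith [h2c.1, h2c.2, h1c.1, h1c.2]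

lemma spectralEstimator_eq {Ω : Type*} {p : ℕ} (x : ℕ → Fin p → ℝ) (Y : ℕ → Ω → ℝ)
    (c n : ℕ) (t : ℝ) (ω : Ω) :
    spectralEstimator x Y c n t ω =
      ((1 / (2 * π * n) * quadForm (lagWindow c t) n (residual x Y n · ω) : ℝ) : ℂ) := by
  set K : ℤ → ℝ := fun k => kernel (|(k : ℝ)| / c)
  set r : ℕ → ℝ := (residual x Y n · ω)
  have hcos := sum_diagonals n (lagWindow c t) (fun i j => r i * r j) fun i j => mul_comm _ _
  have hsin := sum_diagonals n (fun k => K k * Real.sin (k * t)) (fun i j => r i * r j)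
    fun i j => mul_comm _ _
  have hodd : quadForm (fun k => K k * Real.sin (k * t)) n r = 0 := by
    refine quadForm_eq_zero_of_odd (fun k => ?_) n r
    simp only [K, Int.cast_neg, abs_neg, neg_mul, Real.sin_neg, mul_neg]
  rw [quadForm] at hodd
  rw [hodd] at hsin
  have hterm : ∀ k : ℤ, (K k : ℂ) * (residualAutocov x Y n k ω : ℂ) *
      Complex.exp (Complex.I * (k : ℂ) * (t : ℂ)) =
      ((1 / n * (lagWindow c t k *
        ∑ j ∈ Finset.Icc 1 (n - k.natAbs), r j * r (j + k.natAbs)) : ℝ) : ℂ) +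
      ((1 / n * (K k * Real.sin (k * t) *
        ∑ j ∈ Finset.Icc 1 (n - k.natAbs), r j * r (j + k.natAbs)) : ℝ) : ℂ) * Complex.I := by
    intro k
    rw [mul_assoc Complex.I, mul_comm Complex.I, Complex.exp_mul_I, lagWindow, residualAutocov]
    push_cast
    ring
  rw [spectralEstimator, Finset.sum_congr rfl fun k _ => hterm k, Finset.sum_add_distrib,
    ← Finset.sum_mul, ← Complex.ofReal_sum, ← Complex.ofReal_sum, ← Finset.mul_sum,
    ← Finset.mul_sum, ← hcos, ← hsin, quadForm]
  push_cast
  ring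

end LagWindows


/-! ### The spectral density of a summable autocovariance -/

section SpectralDensity

/-- The spectral density `(2π)⁻¹ ∑ₖ γ(k) cos(kt)` attached to an even autocovariance `γ`. -/
def densityOf (γ : ℤ → ℝ) (t : ℝ) : ℝ := 1 / (2 * π) * ∑' k : ℤ, γ k * Real.cos (k * t)

/-- The mean of `quadForm a n u` when `u` is a centred stationary sequence with autocovariance
`γ`. -/
def meanForm (a : ℤ → ℝ) (n : ℕ) (γ : ℤ → ℝ) : ℝ :=
  ∑ i ∈ Finset.Icc 1 n, ∑ j ∈ Finset.Icc 1 n, a ((j : ℤ) - i) * γ ((j : ℤ) - i)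

/-- The factor by which the lag `k` of the autocovariance is multiplied in the mean of the
estimator: the kernel weight times the proportion `(n - |k|) / n` of pairs at distance `k`. -/
def damping (c n : ℕ) (k : ℤ) : ℝ :=
  if k ∈ Finset.Icc (-((n : ℤ) - 1)) ((n : ℤ) - 1) then
    kernel (|(k : ℝ)| / c) * (((n - k.natAbs : ℕ) : ℝ) / n) else 0

lemma abs_damping_le_one (c n : ℕ) (k : ℤ) : |damping c n k| ≤ 1 := by
  unfold damping
  split_ifs with h
  · rw [abs_mul, abs_of_nonneg (by positivity : (0 : ℝ) ≤ ((n - k.natAbs : ℕ) : ℝ) / n)]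
    refine mul_le_one₀ (abs_kernel_le_one _) (by positivity) (div_le_one_of_le₀ ?_ (by positivity))
    exact_mod_cast Nat.sub_le _ _
  · rw [abs_zero]
    exact zero_le_one

lemma abs_damping_sub_one_le (c n : ℕ) (k : ℤ) : |damping c n k - 1| ≤ 2 := by
  have h := abs_le.1 (abs_damping_le_one c n k)
  rw [abs_le]
  constructor <;> linarith

lemma tendsto_damping {c : ℕ → ℕ} (hc : Tendsto c atTop atTop) (k : ℤ) :
    Tendsto (fun n => damping (c n) n k) atTop (𝓝 1) := by
  have heq : ∀ᶠ n : ℕ in atTop, 1 - (k.natAbs : ℝ) / n = damping (c n) n k := by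
    filter_upwards [hc.eventually_ge_atTop k.natAbs, eventually_gt_atTop k.natAbs]
      with n hcn hkn
    have hcn' : |(k : ℝ)| ≤ c n := by
      rw [← Int.cast_abs, Int.abs_eq_natAbs]; exact_mod_cast hcn
    have hn : (n : ℝ) ≠ 0 := by
      have : n ≠ 0 := by omega
      exact_mod_cast this
    rw [damping, if_pos (by rw [Finset.mem_Icc]; omega), kernel, if_pos, Nat.cast_sub hkn.le]
    · field_simp
    · rw [abs_of_nonneg (by positivity)]
      exact div_le_one_of_le₀ hcn' (by positivity)
  refine Tendsto.congr' heq ?_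
  simpa using (tendsto_const_div_atTop_nhds_zero_nat (k.natAbs : ℝ)).const_sub 1

lemma meanForm_lagWindow {n : ℕ} (hn : 0 < n) (c : ℕ) (t : ℝ) (γ : ℤ → ℝ) :
    meanForm (lagWindow c t) n γ = n * ∑' k : ℤ, damping c n k * (γ k * Real.cos (k * t)) := by
  have hn' : (n : ℝ) ≠ 0 := by exact_mod_cast hn.ne'
  have h := sum_diagonals n (fun k => lagWindow c t k * γ k) (fun _ _ => 1) (fun _ _ => rfl)
  simp only [mul_one, Finset.sum_const, Nat.card_Icc, nsmul_eq_mul] at h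
  rw [meanForm, h, tsum_eq_sum (s := Finset.Icc (-((n : ℤ) - 1)) ((n : ℤ) - 1)), Finset.mul_sum]
  · refine Finset.sum_congr rfl fun k hk => ?_
    rw [damping, if_pos hk, lagWindow, Nat.add_sub_cancel]
    field_simp
  · intro k hk
    rw [damping, if_neg hk, zero_mul]

variable {γ : ℤ → ℝ}

lemma abs_mul_cos_le (x y : ℝ) : |x * Real.cos y| ≤ |x| := by
  rw [abs_mul]
  exact mul_le_of_le_one_right (abs_nonneg _) (Real.abs_cos_le_one _)

lemma summable_mul_cos (hγ : Summable fun k => |γ k|) (t : ℝ) :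
    Summable fun k : ℤ => γ k * Real.cos (k * t) :=
  .of_norm_bounded hγ fun _ => abs_mul_cos_le _ _

lemma continuous_densityOf (hγ : Summable fun k => |γ k|) : Continuous (densityOf γ) :=
  continuous_const.mul (continuous_tsum (fun k => by fun_prop) hγ fun _ _ => abs_mul_cos_le _ _)

lemma tendsto_tsum_abs_damping_sub_one (hγ : Summable fun k => |γ k|) {c : ℕ → ℕ}
    (hc : Tendsto c atTop atTop) :
    Tendsto (fun n => ∑' k : ℤ, |damping (c n) n k - 1| * |γ k|) atTop (𝓝 0) := by
  have h := tendsto_tsum_of_dominated_convergence (𝓕 := atTop)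
    (f := fun n k => |damping (c n) n k - 1| * |γ k|) (g := fun _ => 0)
    (bound := fun k => 2 * |γ k|) (hγ.mul_left 2) (fun k => ?_)
    (Eventually.of_forall fun n k => ?_)
  · simpa using h
  · simpa using ((tendsto_damping hc k).sub_const 1).abs.mul_const |γ k|
  · rw [Real.norm_eq_abs, abs_mul, abs_abs, abs_abs]
    exact mul_le_mul_of_nonneg_right (abs_damping_sub_one_le _ _ _) (abs_nonneg _)

lemma abs_meanForm_sub_le (hγ : Summable fun k => |γ k|) {n : ℕ} (hn : 0 < n) (c : ℕ) (t : ℝ) :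
    |meanForm (lagWindow c t) n γ - 2 * π * n * densityOf γ t| ≤
      n * ∑' k : ℤ, |damping c n k - 1| * |γ k| := by
  have hdamp : Summable fun k : ℤ => damping c n k * (γ k * Real.cos (k * t)) := by
    refine .of_norm_bounded hγ fun k => ?_
    rw [Real.norm_eq_abs, abs_mul]
    exact (mul_le_of_le_one_left (abs_nonneg _) (abs_damping_le_one c n k)).trans
      (abs_mul_cos_le _ _)
  have hbias : Summable fun k : ℤ => |damping c n k - 1| * |γ k| :=
    .of_nonneg_of_le (fun _ => by positivity)
      (fun k => mul_le_mul_of_nonneg_right (abs_damping_sub_one_le c n k) (abs_nonneg _))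
      (hγ.mul_left 2)
  have hdensity : 2 * π * n * densityOf γ t = n * ∑' k : ℤ, γ k * Real.cos (k * t) := by
    have := Real.pi_ne_zero
    rw [densityOf]
    generalize ∑' k : ℤ, γ k * Real.cos (k * t) = S
    field_simp
  rw [hdensity, meanForm_lagWindow hn, ← mul_sub, ← hdamp.tsum_sub (summable_mul_cos hγ t),
    abs_mul, Nat.abs_cast]
  refine mul_le_mul_of_nonneg_left ?_ (Nat.cast_nonneg n)
  rw [← Real.norm_eq_abs]
  refine tsum_of_norm_bounded hbias.hasSum fun k => ?_
  rw [← sub_one_mul, Real.norm_eq_abs, abs_mul]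
  exact mul_le_mul_of_nonneg_left (abs_mul_cos_le _ _) (abs_nonneg _)

-- With bandwidth `n` the flat-top kernel is `1` at all lags `|k| ≤ n - 1`.
lemma meanForm_lagWindow_self_nonneg
    (hpos : ∀ (n : ℕ) (b : ℕ → ℝ),
      0 ≤ ∑ i ∈ Finset.Icc 1 n, ∑ j ∈ Finset.Icc 1 n, b i * b j * γ ((j : ℤ) - i))
    (n : ℕ) (t : ℝ) : 0 ≤ meanForm (lagWindow n t) n γ := by
  have hsplit : meanForm (lagWindow n t) n γ =
      ∑ i ∈ Finset.Icc 1 n, ∑ j ∈ Finset.Icc 1 n,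
        Real.cos (i * t) * Real.cos (j * t) * γ ((j : ℤ) - i) +
      ∑ i ∈ Finset.Icc 1 n, ∑ j ∈ Finset.Icc 1 n,
        Real.sin (i * t) * Real.sin (j * t) * γ ((j : ℤ) - i) := by
    simp only [meanForm, ← Finset.sum_add_distrib]
    refine Finset.sum_congr rfl fun i hi => Finset.sum_congr rfl fun j hj => ?_
    rw [Finset.mem_Icc] at hi hj
    have hle : |(((j : ℤ) - i : ℤ) : ℝ)| ≤ n := by
      have : |(j : ℤ) - i| ≤ n := by rw [abs_le]; omega
      exact_mod_cast this
    rw [lagWindow, kernel, if_pos]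
    · push_cast
      rw [sub_mul, Real.cos_sub]
      ring
    · rw [abs_of_nonneg (by positivity)]
      exact div_le_one_of_le₀ hle (by positivity)
  rw [hsplit]
  exact add_nonneg (hpos n _) (hpos n _)

lemma densityOf_nonneg (hγ : Summable fun k => |γ k|)
    (hpos : ∀ (n : ℕ) (b : ℕ → ℝ),
      0 ≤ ∑ i ∈ Finset.Icc 1 n, ∑ j ∈ Finset.Icc 1 n, b i * b j * γ ((j : ℤ) - i)) (t : ℝ) :
    0 ≤ densityOf γ t := by
  have hbias : ∀ᶠ n : ℕ in atTop, -(2 * π * densityOf γ t) ≤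
      ∑' k : ℤ, |damping n n k - 1| * |γ k| := by
    filter_upwards [eventually_gt_atTop 0] with n hn
    have hn' : (0 : ℝ) < n := by exact_mod_cast hn
    have hmean := (abs_le.1 (abs_meanForm_sub_le hγ hn n t)).2
    have hnonneg := meanForm_lagWindow_self_nonneg hpos n t
    refine le_of_mul_le_mul_left ?_ hn'
    linarith
  have hlim := le_of_tendsto_of_tendsto tendsto_const_nhds
    (tendsto_tsum_abs_damping_sub_one hγ tendsto_id) hbias
  exact nonneg_of_mul_nonneg_right (neg_nonpos.1 hlim) Real.two_pi_pos

lemma integral_exp_int (k : ℤ) :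
    ∫ t in (-π)..π, Complex.exp (Complex.I * (k : ℂ) * (t : ℂ)) =
      if k = 0 then 2 * (π : ℂ) else 0 := by
  split_ifs with h
  · simp only [h, Int.cast_zero, mul_zero, zero_mul, Complex.exp_zero]
    rw [intervalIntegral.integral_const, Complex.real_smul]
    push_cast
    ring
  · have hk : Complex.I * (k : ℂ) ≠ 0 := mul_ne_zero Complex.I_ne_zero (by exact_mod_cast h)
    rw [integral_exp_mul_complex hk, div_eq_zero_iff, sub_eq_zero]
    left
    rw [Complex.exp_eq_exp_iff_exists_int]
    exact ⟨k, by push_cast; ring⟩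

lemma integral_exp_mul_cos (k m : ℤ) :
    ∫ t in (-π)..π, Complex.exp (Complex.I * (k : ℂ) * (t : ℂ)) * ((Real.cos (m * t) : ℝ) : ℂ) =
      (if m = -k then (π : ℂ) else 0) + if m = k then (π : ℂ) else 0 := by
  have h : ∀ t : ℝ, Complex.exp (Complex.I * (k : ℂ) * (t : ℂ)) * ((Real.cos (m * t) : ℝ) : ℂ) =
      1 / 2 * Complex.exp (Complex.I * ((k + m : ℤ) : ℂ) * (t : ℂ)) +
      1 / 2 * Complex.exp (Complex.I * ((k - m : ℤ) : ℂ) * (t : ℂ)) := by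
    intro t
    push_cast
    rw [Complex.cos]
    have hadd : Complex.I * (k + m : ℂ) * t = Complex.I * k * t + m * t * Complex.I := by ring
    have hsub : Complex.I * (k - m : ℂ) * t = Complex.I * k * t + -(m * t) * Complex.I := by ring
    rw [hadd, hsub, Complex.exp_add, Complex.exp_add]
    ring
  simp_rw [h]
  rw [intervalIntegral.integral_add, intervalIntegral.integral_const_mul,
    intervalIntegral.integral_const_mul, integral_exp_int, integral_exp_int]
  · have hadd : (k + m = 0) ↔ m = -k := by omega
    have hsub : (k - m = 0) ↔ m = k := by omega
    simp only [hadd, hsub]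
    split_ifs <;> ring
  · exact Continuous.intervalIntegrable (by fun_prop) _ _
  · exact Continuous.intervalIntegrable (by fun_prop) _ _

lemma hasSum_exp_mul_densityOf (hγ : Summable fun k => |γ k|) (z : ℂ) (t : ℝ) :
    HasSum (fun m : ℤ => (γ m / (2 * π) : ℂ) * (z * ((Real.cos (m * t) : ℝ) : ℂ)))
      (z * (densityOf γ t : ℂ)) := by
  have hreal := (summable_mul_cos hγ t).hasSum.mul_left (1 / (2 * π))
  have hcomplex : HasSum (fun m : ℤ => ((1 / (2 * π) * (γ m * Real.cos (m * t)) : ℝ) : ℂ))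
      (densityOf γ t : ℂ) := by exact_mod_cast hreal
  refine (hcomplex.mul_left z).congr_fun fun m => ?_
  push_cast
  ring

lemma norm_exp_mul_cos_le (r : ℝ) (k m : ℤ) (t : ℝ) :
    ‖(r / (2 * π) : ℂ) * (Complex.exp (Complex.I * (k : ℂ) * (t : ℂ)) *
      ((Real.cos (m * t) : ℝ) : ℂ))‖ ≤ |r| := by
  have hr : (r / (2 * π) : ℂ) = ((r / (2 * π) : ℝ) : ℂ) := by push_cast; ring
  rw [show Complex.I * (k : ℂ) * (t : ℂ) = ((t * k : ℝ) : ℂ) * Complex.I by push_cast; ring,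
    norm_mul, norm_mul, Complex.norm_exp_ofReal_mul_I, one_mul, hr, Complex.norm_real,
    Complex.norm_real, Real.norm_eq_abs, Real.norm_eq_abs, ← abs_mul]
  refine (abs_mul_cos_le _ _).trans ?_
  rw [abs_div, abs_of_pos Real.two_pi_pos]
  exact div_le_self (abs_nonneg _) (by linarith [Real.pi_gt_three])

lemma integral_exp_mul_densityOf (hγ : Summable fun k => |γ k|) (heven : ∀ k, γ (-k) = γ k)
    (k : ℤ) :
    ∫ t in (-π)..π, Complex.exp (Complex.I * (k : ℂ) * (t : ℂ)) * (densityOf γ t : ℂ) =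
      (γ k : ℂ) := by
  have hseries := intervalIntegral.hasSum_integral_of_dominated_convergence
    (μ := volume) (a := -π) (b := π)
    (F := fun (m : ℤ) (t : ℝ) => (γ m / (2 * π) : ℂ) *
      (Complex.exp (Complex.I * (k : ℂ) * (t : ℂ)) * ((Real.cos (m * t) : ℝ) : ℂ)))
    (fun m _ => |γ m|) (fun m => (by fun_prop : Continuous _).aestronglyMeasurable)
    (fun m => Eventually.of_forall fun t _ => norm_exp_mul_cos_le _ k m t)
    (Eventually.of_forall fun t _ => hγ) intervalIntegrable_const
    (Eventually.of_forall fun t _ => hasSum_exp_mul_densityOf hγ _ t)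
  refine hseries.unique ?_
  have hpi : (π : ℂ) ≠ 0 := by exact_mod_cast Real.pi_ne_zero
  have hterm : ∀ m : ℤ, ∫ t in (-π)..π, (γ m / (2 * π) : ℂ) *
      (Complex.exp (Complex.I * (k : ℂ) * (t : ℂ)) * ((Real.cos (m * t) : ℝ) : ℂ)) =
      (if m = -k then (γ k / 2 : ℂ) else 0) + if m = k then (γ k / 2 : ℂ) else 0 := by
    intro m
    rw [intervalIntegral.integral_const_mul, integral_exp_mul_cos, mul_add]
    congr 1
    · split_ifs with hm
      · rw [hm, heven]
        field_simp
      · exact mul_zero _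
    · split_ifs with hm
      · rw [hm]
        field_simp
      · exact mul_zero _
  simp_rw [hterm]
  simpa only [add_halves] using
    (hasSum_ite_eq (-k) (γ k / 2 : ℂ)).add (hasSum_ite_eq k (γ k / 2 : ℂ))

lemma fourierCoeffOn_neg_pi_pi (h : -π < π) (d : ℝ → ℂ) (k : ℤ) :
    fourierCoeffOn h d k = (1 / (2 * π) : ℝ) •
      ∫ t in (-π)..π, Complex.exp (Complex.I * ((-k : ℤ) : ℂ) * (t : ℂ)) * d t := by
  have hpi : (π : ℂ) ≠ 0 := by exact_mod_cast Real.pi_ne_zero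
  rw [fourierCoeffOn_eq_integral, sub_neg_eq_add, ← two_mul]
  congr 1
  refine intervalIntegral.integral_congr fun t _ => ?_
  simp only [smul_eq_mul]
  rw [fourier_coe_apply]
  congr 2
  push_cast
  field_simp

lemma eqOn_zero_of_integral_exp_mul_eq_zero {d : ℝ → ℂ} (hd : ContinuousOn d (Set.Icc (-π) π))
    (h : ∀ k : ℤ, ∫ t in (-π)..π, Complex.exp (Complex.I * (k : ℂ) * (t : ℂ)) * d t = 0) :
    Set.EqOn d 0 (Set.Icc (-π) π) := by
  have hlt : -π < π := by linarith [Real.pi_pos]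
  have hL2 : MemLp d 2 (volume.restrict (Set.Ioc (-π) π)) := by
    obtain ⟨C, hC⟩ := isCompact_Icc.exists_bound_of_continuousOn hd
    have hIcc : MemLp d 2 (volume.restrict (Set.Icc (-π) π)) :=
      MemLp.of_bound (hd.aestronglyMeasurable measurableSet_Icc) C
        ((ae_restrict_iff' measurableSet_Icc).2 (Eventually.of_forall hC))
    exact hIcc.mono_measure (Measure.restrict_mono Set.Ioc_subset_Icc_self le_rfl)
  have hcoeff : ∀ k : ℤ, fourierCoeffOn hlt d k = 0 := fun k => by
    rw [fourierCoeffOn_neg_pi_pi, h, smul_zero]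
  have hparseval := hasSum_sq_fourierCoeffOn hlt hL2
  simp only [hcoeff, norm_zero, ne_eq, OfNat.ofNat_ne_zero, not_false_eq_true, zero_pow]
    at hparseval
  have hnorm : ∫ t in (-π)..π, ‖d t‖ ^ 2 = 0 :=
    (smul_eq_zero.1 (hparseval.unique hasSum_zero)).resolve_left
      (inv_ne_zero (sub_pos.2 hlt).ne')
  rw [intervalIntegral.integral_of_le hlt.le, ← integral_Icc_eq_integral_Ioc,
    setIntegral_eq_zero_iff_of_nonneg_ae (Eventually.of_forall fun t => by positivity)
      (ContinuousOn.integrableOn_Icc (f := fun t => ‖d t‖ ^ 2) (hd.norm.pow 2))] at hnorm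
  refine Measure.eqOn_Icc_of_ae_eq volume hlt.ne ?_ hd continuousOn_const
  filter_upwards [hnorm] with t ht
  simpa using ht

lemma eqOn_of_integral_exp_mul_eq {f g : ℝ → ℂ}
    (hf : ContinuousOn f (Set.Icc (-π) π)) (hg : ContinuousOn g (Set.Icc (-π) π))
    (h : ∀ k : ℤ, ∫ t in (-π)..π, Complex.exp (Complex.I * (k : ℂ) * (t : ℂ)) * f t =
      ∫ t in (-π)..π, Complex.exp (Complex.I * (k : ℂ) * (t : ℂ)) * g t) :
    Set.EqOn f g (Set.Icc (-π) π) := by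
  have hint : ∀ φ : ℝ → ℂ, ContinuousOn φ (Set.Icc (-π) π) → ∀ k : ℤ, IntervalIntegrable
      (fun t : ℝ => Complex.exp (Complex.I * (k : ℂ) * (t : ℂ)) * φ t) volume (-π) π := by
    intro φ hφ k
    refine ContinuousOn.intervalIntegrable ?_
    rw [Set.uIcc_of_le (by linarith [Real.pi_pos])]
    exact (by fun_prop : Continuous _).continuousOn.mul hφ
  have hzero := eqOn_zero_of_integral_exp_mul_eq_zero (hf.sub hg) fun k => by
    simp only [Pi.sub_apply, mul_sub]
    rw [intervalIntegral.integral_sub (hint f hf k) (hint g hg k), h k, sub_self]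
  exact fun t ht => sub_eq_zero.1 (hzero ht)

end SpectralDensity

/-! ### Shifts and innovations -/

section Shift

variable {Ω : Type*} {F₀ : MeasurableSpace Ω}

lemma process_process (S : Equiv.Perm Ω) (Z : Ω → ℝ) (i j : ℤ) :
    process S (process S Z i) j = process S Z (i + j) := by
  ext ω
  simp only [process, zpow_add, Equiv.Perm.mul_apply]

lemma process_zero (S : Equiv.Perm Ω) (Z : Ω → ℝ) : process S Z 0 = Z := by
  ext ω
  simp only [process, zpow_zero, Equiv.Perm.one_apply]

lemma filt_zero (S : Equiv.Perm Ω) : filt F₀ S 0 = F₀ := by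
  simp only [filt, zpow_zero, Equiv.Perm.coe_one]
  exact MeasurableSpace.comap_id

lemma filt_comap (S : Equiv.Perm Ω) (i j : ℤ) :
    (filt F₀ S i).comap (fun ω => (S ^ j) ω) = filt F₀ S (i + j) := by
  rw [filt, MeasurableSpace.comap_comp, filt]
  congr 1
  ext ω
  simp only [zpow_add, Equiv.Perm.mul_apply, Function.comp]

lemma stronglyMeasurable_process (S : Equiv.Perm Ω) {Z : Ω → ℝ} {i : ℤ}
    (hZ : StronglyMeasurable[filt F₀ S i] Z) (j : ℤ) :
    StronglyMeasurable[filt F₀ S (i + j)] (process S Z j) := by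
  rw [← filt_comap]
  exact hZ.comp_measurable (comap_measurable _)

end Shift

/-- An innovation is a square integrable `ℱ₀`-measurable variable whose conditional expectation
given `ℱ₋₁` vanishes; its shifts are square integrable martingale differences. -/
structure IsInnovation {Ω : Type*} (F₀ : MeasurableSpace Ω) [MeasurableSpace Ω]
    (S : Equiv.Perm Ω) (μ : Measure Ω) (D : Ω → ℝ) : Prop where
  measurable : StronglyMeasurable[F₀] D
  memLp : MemLp D 2 μ
  condExp : μ[D | filt F₀ S (-1)] =ᵐ[μ] 0

section Stationary

variable {Ω : Type*} {F₀ : MeasurableSpace Ω} [mΩ : MeasurableSpace Ω]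
  {μ : Measure Ω} {T : Ω ≃ᵐ Ω}

lemma measurePreserving_zpow (hT : MeasurePreserving T μ μ) (i : ℤ) :
    MeasurePreserving (fun ω => (T.toEquiv ^ i) ω) μ μ := by
  obtain ⟨n, rfl | rfl⟩ := i.eq_nat_or_neg
  · simpa only [zpow_natCast, ← Equiv.Perm.iterate_eq_pow] using! hT.iterate n
  · simpa only [zpow_neg, zpow_natCast, ← inv_pow, ← Equiv.Perm.iterate_eq_pow]
      using! (hT.symm T).iterate n

lemma measurableEmbedding_zpow (hT : MeasurePreserving T μ μ) (i : ℤ) :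
    MeasurableEmbedding (fun ω => (T.toEquiv ^ i) ω) := by
  have hinv : Measurable fun ω => (T.toEquiv ^ i).symm ω := by
    simpa only [zpow_neg] using! (measurePreserving_zpow hT (-i)).measurable
  exact (MeasurableEquiv.mk (T.toEquiv ^ i) (measurePreserving_zpow hT i).measurable
    hinv).measurableEmbedding

lemma integral_process (hT : MeasurePreserving T μ μ) (Z : Ω → ℝ) (i : ℤ) :
    ∫ ω, process T.toEquiv Z i ω ∂μ = ∫ ω, Z ω ∂μ :=
  (measurePreserving_zpow hT i).integral_comp (measurableEmbedding_zpow hT i) Z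

lemma memLp_process (hT : MeasurePreserving T μ μ) {Z : Ω → ℝ} {q : ENNReal} (hZ : MemLp Z q μ)
    (i : ℤ) : MemLp (process T.toEquiv Z i) q μ :=
  hZ.comp_measurePreserving (measurePreserving_zpow hT i)

lemma integrable_process (hT : MeasurePreserving T μ μ) {Z : Ω → ℝ} (hZ : Integrable Z μ) (i : ℤ) :
    Integrable (process T.toEquiv Z i) μ :=
  (measurePreserving_zpow hT i).integrable_comp_of_integrable hZ

lemma ae_process (hT : MeasurePreserving T μ μ) {P : ℝ → Prop} {Z : Ω → ℝ}
    (hZ : ∀ᵐ ω ∂μ, P (Z ω)) (i : ℤ) : ∀ᵐ ω ∂μ, P (process T.toEquiv Z i ω) :=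
  (measurePreserving_zpow hT i).quasiMeasurePreserving.ae hZ

lemma filt_le (hT : MeasurePreserving T μ μ) (hF₀ : F₀ ≤ mΩ) (i : ℤ) :
    filt F₀ T.toEquiv i ≤ mΩ :=
  (MeasurableSpace.comap_mono hF₀).trans (measurePreserving_zpow hT i).measurable.comap_le

lemma filt_mono (hmono : F₀ ≤ F₀.comap T) : Monotone (filt F₀ T.toEquiv) := by
  refine monotone_int_of_le_succ fun i => ?_
  have h : F₀ ≤ filt F₀ T.toEquiv 1 := by rwa [filt, zpow_one]
  rw [add_comm, ← filt_comap]
  exact MeasurableSpace.comap_mono h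

lemma condExp_process [IsFiniteMeasure μ] (hT : MeasurePreserving T μ μ) (hF₀ : F₀ ≤ mΩ)
    {Z : Ω → ℝ} (hZ : Integrable Z μ) (i j : ℤ) :
    process T.toEquiv (μ[Z | filt F₀ T.toEquiv i]) j =ᵐ[μ]
      μ[process T.toEquiv Z j | filt F₀ T.toEquiv (i + j)] := by
  have hmp := measurePreserving_zpow hT j
  refine ae_eq_condExp_of_forall_setIntegral_eq (filt_le hT hF₀ _) (integrable_process hT hZ j)
    (fun s _ _ => (integrable_process hT integrable_condExp j).integrableOn) ?_
    (stronglyMeasurable_process _ stronglyMeasurable_condExp j).aestronglyMeasurable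
  intro s hs _
  rw [← filt_comap] at hs
  obtain ⟨s', hs', rfl⟩ := hs
  unfold process
  rw [hmp.setIntegral_preimage_emb (measurableEmbedding_zpow hT j) _ s',
    hmp.setIntegral_preimage_emb (measurableEmbedding_zpow hT j) Z s',
    setIntegral_condExp (filt_le hT hF₀ _) hZ hs']

namespace IsInnovation

variable {D E : Ω → ℝ}

lemma stronglyMeasurable_process (hD : IsInnovation F₀ T.toEquiv μ D) (i : ℤ) :
    StronglyMeasurable[filt F₀ T.toEquiv i] (process T.toEquiv D i) := by
  have h := HannanRegression.stronglyMeasurable_process (F₀ := F₀) T.toEquiv (i := 0)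
    (by rw [filt_zero]; exact hD.measurable) i
  rwa [zero_add] at h

lemma condExp_process [IsFiniteMeasure μ] (hT : MeasurePreserving T μ μ) (hF₀ : F₀ ≤ mΩ)
    (hD : IsInnovation F₀ T.toEquiv μ D) (i : ℤ) :
    μ[process T.toEquiv D i | filt F₀ T.toEquiv (i - 1)] =ᵐ[μ] 0 := by
  have h := HannanRegression.condExp_process hT hF₀ (hD.memLp.integrable one_le_two) (-1) i
  rw [neg_add_eq_sub] at h
  exact h.symm.trans (ae_process hT (P := (· = 0)) hD.condExp i)

lemma integral_mul_process [IsFiniteMeasure μ] (hT : MeasurePreserving T μ μ) (hF₀ : F₀ ≤ mΩ)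
    (hD : IsInnovation F₀ T.toEquiv μ D) {i : ℤ} {g : Ω → ℝ}
    (hg : StronglyMeasurable[filt F₀ T.toEquiv (i - 1)] g) (hg2 : MemLp g 2 μ) :
    ∫ ω, g ω * process T.toEquiv D i ω ∂μ = 0 := by
  have hDi := memLp_process hT hD.memLp i
  calc ∫ ω, g ω * process T.toEquiv D i ω ∂μ
      = ∫ ω, (μ[g * process T.toEquiv D i | filt F₀ T.toEquiv (i - 1)]) ω ∂μ :=
        (integral_condExp (filt_le hT hF₀ _)).symm
    _ = 0 := by
        refine integral_eq_zero_of_ae ?_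
        filter_upwards [condExp_mul_of_stronglyMeasurable_left hg (hg2.integrable_mul hDi)
          (hDi.integrable one_le_two), hD.condExp_process hT hF₀ i] with ω hpull hzero
        rw [hpull, Pi.mul_apply, hzero, Pi.zero_apply, mul_zero]

lemma orthogonal [IsFiniteMeasure μ] (hT : MeasurePreserving T μ μ) (hF₀ : F₀ ≤ mΩ)
    (hmono : F₀ ≤ F₀.comap T) (hD : IsInnovation F₀ T.toEquiv μ D)
    (hE : IsInnovation F₀ T.toEquiv μ E) {i j : ℤ} (hij : i ≠ j) :
    ∫ ω, process T.toEquiv D i ω * process T.toEquiv E j ω ∂μ = 0 := by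
  rcases lt_or_gt_of_ne hij with h | h
  · exact hE.integral_mul_process hT hF₀
      ((hD.stronglyMeasurable_process i).mono (filt_mono hmono (by lia)))
      (memLp_process hT hD.memLp i)
  · simp_rw [mul_comm (process T.toEquiv D i _)]
    exact hD.integral_mul_process hT hF₀
      ((hE.stronglyMeasurable_process j).mono (filt_mono hmono (by lia)))
      (memLp_process hT hE.memLp j)

end IsInnovation

end Stationary

/-! ### Conditioning on the remote past and on the remote future -/

section Tail

variable {Ω : Type*} [mΩ : MeasurableSpace Ω] {μ : Measure Ω} {G : ℕ → MeasurableSpace Ω}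

lemma exists_measurable_iInf_of_tendsto_ae (hanti : Antitone G) {g : ℕ → Ω → ℝ}
    (hg : ∀ n, Measurable[G n] (g n)) {W : Ω → ℝ}
    (hlim : ∀ᵐ ω ∂μ, Tendsto (fun n => g n ω) atTop (𝓝 (W ω))) :
    ∃ w : Ω → ℝ, Measurable[⨅ n, G n] w ∧ W =ᵐ[μ] w := by
  refine ⟨fun ω => limsup (fun n => g n ω) atTop, fun s hs => ?_, ?_⟩
  · rw [MeasurableSpace.measurableSet_iInf]
    intro n
    have hshift : (fun ω => limsup (fun k => g k ω) atTop) =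
        fun ω => limsup (fun k => g (k + n) ω) atTop := by
      ext ω
      exact (limsup_nat_add (fun k => g k ω) n).symm
    rw [hshift]
    exact Measurable.limsup (δ := Ω) (mδ := G n)
      (fun k => (hg (k + n)).mono (hanti (Nat.le_add_left n k)) le_rfl) hs
  · filter_upwards [hlim] with ω hω
    exact hω.limsup_eq.symm

variable [IsProbabilityMeasure μ]

lemma ae_eq_integral_of_measurable_trivial {m : MeasurableSpace Ω} (hm : m ≤ mΩ)
    (htriv : ∀ s : Set Ω, MeasurableSet[m] s → μ s = 0 ∨ μ s = 1) {w : Ω → ℝ}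
    (hwm : Measurable[m] w) (hw : Integrable w μ) : w =ᵐ[μ] fun _ => ∫ ω, w ω ∂μ := by
  have hindep : Indep m m μ := by
    rw [Indep_iff]
    intro s t hs _
    rcases htriv s hs with h | h
    · rw [h, zero_mul]
      exact measure_mono_null Set.inter_subset_left h
    · rw [h, one_mul, Set.inter_comm]
      exact measure_inter_conull ((prob_compl_eq_zero_iff (hm s hs)).2 h)
  have hcond := condExp_indep_eq hm hm hwm.stronglyMeasurable hindep
  rwa [condExp_of_stronglyMeasurable hm hwm.stronglyMeasurable hw] at hcond

lemma ae_eq_integral_of_tendsto_tail (hG : ∀ n, G n ≤ mΩ) (hanti : Antitone G)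
    (htriv : ∀ s : Set Ω, MeasurableSet[⨅ n, G n] s → μ s = 0 ∨ μ s = 1)
    {g : ℕ → Ω → ℝ} (hg : ∀ n, StronglyMeasurable[G n] (g n)) {W : Ω → ℝ} (hW : Integrable W μ)
    (hlim : Tendsto (fun n => eLpNorm (g n - W) 1 μ) atTop (𝓝 0)) :
    W =ᵐ[μ] fun _ => ∫ ω, W ω ∂μ := by
  have hmeas : TendstoInMeasure μ g atTop W :=
    tendstoInMeasure_of_tendsto_eLpNorm one_ne_zero
      (fun n => ((hg n).mono (hG n)).aestronglyMeasurable) hW.aestronglyMeasurable hlim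
  obtain ⟨ns, hns, hae⟩ := hmeas.exists_seq_tendsto_ae
  obtain ⟨w, hwm, hWw⟩ := exists_measurable_iInf_of_tendsto_ae hanti
    (fun n => ((hg (ns n)).mono (hanti (hns.id_le n))).measurable) hae
  have hconst := ae_eq_integral_of_measurable_trivial ((iInf_le _ 0).trans (hG 0)) htriv hwm
    (hW.congr hWw)
  rw [← integral_congr_ae hWw] at hconst
  exact hWw.trans hconst

lemma exists_tendsto_condExp_of_antitone (hG : ∀ n, G n ≤ mΩ) (hanti : Antitone G) {g : Ω → ℝ}
    (hg : MemLp g 2 μ) :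
    ∃ W : Ω → ℝ, MemLp W 2 μ ∧ Tendsto (fun n => eLpNorm (μ[g | G n] - W) 2 μ) atTop (𝓝 0) := by
  have : ∀ n, Fact (G n ≤ mΩ) := fun n => ⟨hG n⟩
  have hU : Monotone fun n => (lpMeas ℝ ℝ (G n) 2 μ)ᗮ := by
    intro a b hab
    refine Submodule.orthogonal_le fun f hf => ?_
    rw [mem_lpMeas_iff_aestronglyMeasurable] at hf ⊢
    exact hf.mono (hanti hab)
  have hproj := (Submodule.starProjection_tendsto_closure_iSup _ hU (hg.toLp g)).const_sub
    (hg.toLp g)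
  refine ⟨_, Lp.memLp _, ((Lp.tendsto_Lp_iff_tendsto_eLpNorm' _ _).1 hproj).congr fun n =>
    eLpNorm_congr_ae (EventuallyEq.sub ?_ EventuallyEq.rfl)⟩
  have hcompl : hg.toLp g - (lpMeas ℝ ℝ (G n) 2 μ)ᗮ.starProjection (hg.toLp g) =
      (condExpL2 ℝ ℝ (hG n) (hg.toLp g) : Lp ℝ 2 μ) := by
    rw [Submodule.starProjection_orthogonal_val, sub_sub_cancel]
    rfl
  rw [hcompl]
  exact hg.condExpL2_ae_eq_condExp (hG n)

lemma tendsto_condExp_of_antitone_of_trivial (hG : ∀ n, G n ≤ mΩ) (hanti : Antitone G)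
    (htriv : ∀ s : Set Ω, MeasurableSet[⨅ n, G n] s → μ s = 0 ∨ μ s = 1)
    {g : Ω → ℝ} (hg : MemLp g 2 μ) :
    Tendsto (fun n => eLpNorm (μ[g | G n] - fun _ => ∫ ω, g ω ∂μ) 1 μ) atTop (𝓝 0) := by
  obtain ⟨W, hW2, hlim2⟩ := exists_tendsto_condExp_of_antitone hG hanti hg
  have hW := hW2.integrable one_le_two
  have hlim : Tendsto (fun n => eLpNorm (μ[g | G n] - W) 1 μ) atTop (𝓝 0) :=
    tendsto_of_tendsto_of_tendsto_of_le_of_le tendsto_const_nhds hlim2 (fun _ => zero_le)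
      fun n => eLpNorm_le_eLpNorm_of_exponent_le one_le_two
        (integrable_condExp.sub hW).aestronglyMeasurable
  have hconst := ae_eq_integral_of_tendsto_tail hG hanti htriv
    (fun n => stronglyMeasurable_condExp) hW hlim
  have hmean : Tendsto (fun n => ∫ ω, (μ[g | G n]) ω ∂μ) atTop (𝓝 (∫ ω, W ω ∂μ)) :=
    tendsto_integral_of_L1' _ hW.aestronglyMeasurable
      (Eventually.of_forall fun n => integrable_condExp) hlim
  simp_rw [integral_condExp (hG _)] at hmean
  rw [tendsto_nhds_unique hmean tendsto_const_nhds] at hconst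
  exact hlim.congr fun n => eLpNorm_congr_ae (EventuallyEq.rfl.sub hconst)

end Tail

section PastAndFuture

variable {Ω : Type*} {F₀ : MeasurableSpace Ω} [mΩ : MeasurableSpace Ω]
  {μ : Measure Ω} [IsProbabilityMeasure μ] {T : Ω ≃ᵐ Ω}

lemma tendsto_condExp_past (hT : MeasurePreserving T μ μ)
    (hF₀ : F₀ ≤ mΩ) (hmono : F₀ ≤ F₀.comap T)
    (htail : ∀ s : Set Ω, MeasurableSet[⨅ i : ℤ, filt F₀ T.toEquiv i] s → μ s = 0 ∨ μ s = 1)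
    {g : Ω → ℝ} (hg : MemLp g 2 μ) :
    Tendsto (fun n : ℕ =>
      eLpNorm (μ[g | filt F₀ T.toEquiv (-(n : ℤ))] - fun _ => ∫ ω, g ω ∂μ) 1 μ) atTop (𝓝 0) := by
  have htail_nat : (⨅ n : ℕ, filt F₀ T.toEquiv (-(n : ℤ))) ≤ ⨅ i : ℤ, filt F₀ T.toEquiv i :=
    le_iInf fun i => (iInf_le _ i.natAbs).trans (filt_mono hmono (by lia))
  exact tendsto_condExp_of_antitone_of_trivial (fun n => filt_le hT hF₀ _)
    (fun a b hab => filt_mono hmono (by lia)) (fun s hs => htail s (htail_nat s hs)) hg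

lemma tendsto_condExp_future (hT : MeasurePreserving T μ μ)
    (hF₀ : F₀ ≤ mΩ) (hmono : F₀ ≤ F₀.comap T) {g : Ω → ℝ} (hg : Integrable g μ)
    (hmeas : Measurable[⨆ i : ℤ, filt F₀ T.toEquiv i] g) :
    Tendsto (fun n : ℕ => eLpNorm (μ[g | filt F₀ T.toEquiv (n : ℤ)] - g) 1 μ) atTop (𝓝 0) := by
  have hsup : (⨆ i : ℤ, filt F₀ T.toEquiv i) ≤ ⨆ n : ℕ, filt F₀ T.toEquiv (n : ℤ) :=
    iSup_le fun i => (filt_mono hmono Int.le_natAbs).trans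
      (le_iSup (fun n : ℕ => filt F₀ T.toEquiv (n : ℤ)) i.natAbs)
  exact Integrable.tendsto_eLpNorm_condExp
    (ℱ := ⟨fun n : ℕ => filt F₀ T.toEquiv (n : ℤ),
      fun a b hab => filt_mono hmono (by lia), fun n => filt_le hT hF₀ _⟩)
    hg (hmeas.mono hsup le_rfl).stronglyMeasurable

end PastAndFuture

/-! ### Moving averages of innovations -/

section Hilbert

variable {H : Type*} [NormedAddCommGroup H] [InnerProductSpace ℝ H]

lemma abs_inner_sum_shift_le {V : ℤ → H →ₗᵢ[ℝ] H} (hV : ∀ i j z, V i (V j z) = V (i + j) z)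
    {d : ℤ → H} (horth : ∀ l m i j, i ≠ j → inner ℝ (V i (d l)) (V j (d m)) = 0)
    (A : Finset ℤ) (k : ℤ) :
    |inner ℝ (∑ l ∈ A, V l (d l)) (V k (∑ l ∈ A, V l (d l)))| ≤
      ∑ l ∈ A, ∑ m ∈ A, if k = l - m then ‖d l‖ * ‖d m‖ else 0 := by
  simp_rw [map_sum, sum_inner, inner_sum]
  refine (Finset.abs_sum_le_sum_abs _ _).trans (Finset.sum_le_sum fun l _ => ?_)
  refine (Finset.abs_sum_le_sum_abs _ _).trans (Finset.sum_le_sum fun m _ => ?_)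
  rw [hV]
  split_ifs with h
  · refine (abs_real_inner_le_norm _ _).trans ?_
    rw [LinearIsometry.norm_map, LinearIsometry.norm_map]
  · rw [horth _ _ _ _ (by lia), abs_zero]

lemma sum_abs_inner_shift_le {V : ℤ → H →ₗᵢ[ℝ] H} (hV : ∀ i j z, V i (V j z) = V (i + j) z)
    {d : ℤ → H} (horth : ∀ l m i j, i ≠ j → inner ℝ (V i (d l)) (V j (d m)) = 0)
    (hd : Summable fun l => ‖d l‖) {z : H} (hz : HasSum (fun l => V l (d l)) z) (S : Finset ℤ) :
    ∑ k ∈ S, |inner ℝ z (V k z)| ≤ (∑' l, ‖d l‖) ^ 2 := by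
  have hlim : Tendsto (fun A : Finset ℤ => ∑ k ∈ S, |inner ℝ (∑ l ∈ A, V l (d l))
      (V k (∑ l ∈ A, V l (d l)))|) atTop (𝓝 (∑ k ∈ S, |inner ℝ z (V k z)|)) :=
    tendsto_finsetSum _ fun k _ =>
      (Tendsto.inner hz (((V k).continuous.tendsto z).comp hz)).abs
  refine le_of_tendsto hlim (Eventually.of_forall fun A => ?_)
  calc _ ≤ ∑ k ∈ S, ∑ l ∈ A, ∑ m ∈ A, (if k = l - m then ‖d l‖ * ‖d m‖ else 0) :=
        Finset.sum_le_sum fun k _ => abs_inner_sum_shift_le hV horth A k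
    _ = ∑ l ∈ A, ∑ m ∈ A, ∑ k ∈ S, (if k = l - m then ‖d l‖ * ‖d m‖ else 0) := by
        rw [Finset.sum_comm]
        exact Finset.sum_congr rfl fun l _ => Finset.sum_comm
    _ ≤ ∑ l ∈ A, ∑ m ∈ A, ‖d l‖ * ‖d m‖ := by
        refine Finset.sum_le_sum fun l _ => Finset.sum_le_sum fun m _ => ?_
        rw [Finset.sum_ite_eq']
        split_ifs
        · exact le_rfl
        · positivity
    _ = (∑ l ∈ A, ‖d l‖) ^ 2 := by rw [sq, Finset.sum_mul_sum]
    _ ≤ _ := by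
        gcongr
        exact hd.sum_le_tsum _ fun _ _ => norm_nonneg _

end Hilbert

lemma sum_Ioc_neg_sub {M : Type*} [AddCommGroup M] (a : ℤ → M) (N : ℕ) :
    ∑ l ∈ Finset.Ioc (-(N : ℤ)) N, (a l - a (l - 1)) = a N - a (-(N : ℤ)) := by
  induction N with
  | zero => simp only [Nat.cast_zero, neg_zero, Finset.Ioc_self, Finset.sum_empty, sub_self]
  | succ N ih =>
    have hsplit : Finset.Ioc (-((N + 1 : ℕ) : ℤ)) ((N + 1 : ℕ) : ℤ) =
        insert (-(N : ℤ)) (insert ((N : ℤ) + 1) (Finset.Ioc (-(N : ℤ)) N)) := by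
      ext k
      simp only [Finset.mem_insert, Finset.mem_Ioc]
      lia
    rw [hsplit, Finset.sum_insert, Finset.sum_insert, ih]
    · push_cast
      rw [add_sub_cancel_right, ← neg_add']
      abel
    · simp
    · simp only [Finset.mem_insert, Finset.mem_Ioc]
      lia

section Autocovariance

variable {Ω : Type*} {F₀ : MeasurableSpace Ω} [mΩ : MeasurableSpace Ω]
  {μ : Measure Ω} {T : Ω ≃ᵐ Ω}

/-- The autocovariance function `k ↦ E(Z · Z ∘ Sᵏ)` of the stationary process `(Z ∘ Sⁱ)`; no mean
is subtracted, the processes of interest being centred. -/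
def acov (S : Equiv.Perm Ω) (μ : Measure Ω) (Z : Ω → ℝ) (k : ℤ) : ℝ :=
  ∫ ω, Z ω * process S Z k ω ∂μ

/-- The Koopman isometry `Z ↦ Z ∘ Tⁱ` of `L²`. -/
def koopman (hT : MeasurePreserving T μ μ) (i : ℤ) : Lp ℝ 2 μ →ₗᵢ[ℝ] Lp ℝ 2 μ :=
  Lp.compMeasurePreservingₗᵢ ℝ (fun ω => (T.toEquiv ^ i) ω) (measurePreserving_zpow hT i)

lemma koopman_toLp (hT : MeasurePreserving T μ μ) {Z : Ω → ℝ} (hZ : MemLp Z 2 μ) (i : ℤ) :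
    koopman hT i (hZ.toLp Z) = (memLp_process hT hZ i).toLp (process T.toEquiv Z i) := rfl

lemma koopman_koopman (hT : MeasurePreserving T μ μ) (i j : ℤ) (z : Lp ℝ 2 μ) :
    koopman hT i (koopman hT j z) = koopman hT (i + j) z := by
  obtain ⟨Z, hZ, rfl⟩ : ∃ (Z : Ω → ℝ) (hZ : MemLp Z 2 μ), z = hZ.toLp Z :=
    ⟨z, Lp.memLp z, (Lp.toLp_coeFn z _).symm⟩
  rw [koopman_toLp, koopman_toLp, koopman_toLp]
  congr 1
  rw [process_process, add_comm]

lemma inner_toLp {Z W : Ω → ℝ} (hZ : MemLp Z 2 μ) (hW : MemLp W 2 μ) :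
    inner ℝ (hZ.toLp Z) (hW.toLp W) = ∫ ω, Z ω * W ω ∂μ := by
  rw [L2.inner_def]
  refine integral_congr_ae ?_
  filter_upwards [hZ.coeFn_toLp, hW.coeFn_toLp] with ω hZω hWω
  rw [hZω, hWω, RCLike.inner_apply, conj_trivial, mul_comm]

lemma integral_process_mul_process (hT : MeasurePreserving T μ μ) (Z W : Ω → ℝ) (i j : ℤ) :
    ∫ ω, process T.toEquiv Z i ω * process T.toEquiv W j ω ∂μ =
      ∫ ω, Z ω * process T.toEquiv W (j - i) ω ∂μ := by
  rw [← integral_process hT (fun ω => Z ω * process T.toEquiv W (j - i) ω) i]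
  refine integral_congr_ae (Eventually.of_forall fun ω => ?_)
  change _ = process T.toEquiv Z i ω * process T.toEquiv (process T.toEquiv W (j - i)) i ω
  rw [process_process, sub_add_cancel]

lemma integral_process_mul_self (hT : MeasurePreserving T μ μ) (Z : Ω → ℝ) (i j : ℤ) :
    ∫ ω, process T.toEquiv Z i ω * process T.toEquiv Z j ω ∂μ = acov T.toEquiv μ Z (j - i) :=
  integral_process_mul_process hT Z Z i j

lemma acov_neg (hT : MeasurePreserving T μ μ) (Z : Ω → ℝ) (k : ℤ) :
    acov T.toEquiv μ Z (-k) = acov T.toEquiv μ Z k := by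
  rw [← zero_sub, ← integral_process_mul_self hT, acov, process_zero]
  simp_rw [mul_comm]

/-- `Z` is the sum in `L²` of the shifted innovations `D l ∘ Tˡ`, the `L²` norms of the `D l` being
summable. -/
structure IsMovingAverage {Ω : Type*} (F₀ : MeasurableSpace Ω) [MeasurableSpace Ω]
    {μ : Measure Ω} {T : Ω ≃ᵐ Ω} (hT : MeasurePreserving T μ μ) (D : ℤ → Ω → ℝ) (Z : Ω → ℝ) :
    Prop where
  isInnovation : ∀ l, IsInnovation F₀ T.toEquiv μ (D l)
  memLp : MemLp Z 2 μ
  summable : Summable fun l => (eLpNorm (D l) 2 μ).toReal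
  hasSum : HasSum (fun l => koopman hT l ((isInnovation l).memLp.toLp (D l))) (memLp.toLp Z)

namespace IsMovingAverage

variable [IsFiniteMeasure μ] {hT : MeasurePreserving T μ μ} {D : ℤ → Ω → ℝ} {Z : Ω → ℝ}

lemma sum_abs_acov_le (h : IsMovingAverage F₀ hT D Z) (hF₀ : F₀ ≤ mΩ) (hmono : F₀ ≤ F₀.comap T)
    (S : Finset ℤ) :
    ∑ k ∈ S, |acov T.toEquiv μ Z k| ≤ (∑' l, (eLpNorm (D l) 2 μ).toReal) ^ 2 := by
  have hinner := sum_abs_inner_shift_le (koopman_koopman hT)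
    (d := fun l => (h.isInnovation l).memLp.toLp (D l)) ?_ ?_ h.hasSum S
  · simpa only [koopman_toLp, inner_toLp, Lp.norm_toLp, acov] using hinner
  · intro l m i j hij
    rw [koopman_toLp, koopman_toLp, inner_toLp]
    exact (h.isInnovation l).orthogonal hT hF₀ hmono (h.isInnovation m) hij
  · simpa only [Lp.norm_toLp] using h.summable

lemma summable_acov (h : IsMovingAverage F₀ hT D Z) (hF₀ : F₀ ≤ mΩ) (hmono : F₀ ≤ F₀.comap T) :
    Summable fun k => |acov T.toEquiv μ Z k| :=
  summable_of_sum_le (fun _ => abs_nonneg _) (h.sum_abs_acov_le hF₀ hmono)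

lemma tsum_abs_acov_le (h : IsMovingAverage F₀ hT D Z) (hF₀ : F₀ ≤ mΩ)
    (hmono : F₀ ≤ F₀.comap T) :
    ∑' k, |acov T.toEquiv μ Z k| ≤ (∑' l, (eLpNorm (D l) 2 μ).toReal) ^ 2 :=
  (h.summable_acov hF₀ hmono).tsum_le_of_sum_le (h.sum_abs_acov_le hF₀ hmono)

end IsMovingAverage

section Hannan

lemma memLp_proj (F : ℤ → MeasurableSpace Ω) {Z : Ω → ℝ} (hZ : MemLp Z 2 μ) (j : ℤ) :
    MemLp (proj F μ j Z) 2 μ :=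
  (hZ.condExp one_le_two).sub (hZ.condExp one_le_two)

lemma isInnovation_proj [IsFiniteMeasure μ] (hT : MeasurePreserving T μ μ) (hF₀ : F₀ ≤ mΩ)
    (hmono : F₀ ≤ F₀.comap T) {Z : Ω → ℝ} (hZ : MemLp Z 2 μ) :
    IsInnovation F₀ T.toEquiv μ (proj (filt F₀ T.toEquiv) μ 0 Z) where
  measurable := by
    have h : StronglyMeasurable[filt F₀ T.toEquiv 0] (proj (filt F₀ T.toEquiv) μ 0 Z) :=
      stronglyMeasurable_condExp.sub (stronglyMeasurable_condExp.mono (filt_mono hmono (by lia)))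
    rwa [filt_zero] at h
  memLp := memLp_proj _ hZ 0
  condExp := by
    have htower : ∀ i : ℤ, -1 ≤ i →
        μ[μ[Z | filt F₀ T.toEquiv i] | filt F₀ T.toEquiv (-1)] =ᵐ[μ]
          μ[Z | filt F₀ T.toEquiv (-1)] :=
      fun i hi => condExp_condExp_of_le (filt_mono hmono hi) (filt_le hT hF₀ _)
    refine (condExp_sub integrable_condExp integrable_condExp _).trans ?_
    filter_upwards [htower 0 (by lia), htower (0 - 1) (by lia)] with ω h₀ h₁
    rw [Pi.sub_apply, h₀, h₁, sub_self, Pi.zero_apply]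

lemma process_proj [IsFiniteMeasure μ] (hT : MeasurePreserving T μ μ) (hF₀ : F₀ ≤ mΩ) {Z : Ω → ℝ}
    (hZ : Integrable Z μ) (l : ℤ) :
    process T.toEquiv (proj (filt F₀ T.toEquiv) μ 0 (process T.toEquiv Z (-l))) l =ᵐ[μ]
      proj (filt F₀ T.toEquiv) μ l Z := by
  have hshift : ∀ i : ℤ, process T.toEquiv (μ[process T.toEquiv Z (-l) | filt F₀ T.toEquiv i]) l
      =ᵐ[μ] μ[Z | filt F₀ T.toEquiv (i + l)] := fun i => by
    have h := condExp_process hT hF₀ (integrable_process hT hZ (-l)) i l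
    rwa [process_process, neg_add_cancel, process_zero] at h
  have h₁ := hshift (0 - 1)
  have h₀ := hshift 0
  rw [zero_add] at h₀
  rw [sub_add_eq_add_sub, zero_add] at h₁
  exact h₀.sub h₁

lemma sum_koopman_proj_ae_eq [IsFiniteMeasure μ] (hT : MeasurePreserving T μ μ) (hF₀ : F₀ ≤ mΩ)
    {Z : Ω → ℝ} (hZ : MemLp Z 2 μ) (N : ℕ) :
    ((∑ l ∈ Finset.Ioc (-(N : ℤ)) N, koopman hT l
      ((memLp_proj (filt F₀ T.toEquiv) (memLp_process hT hZ (-l)) 0).toLp _) : Lp ℝ 2 μ) :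
        Ω → ℝ) =ᵐ[μ]
      μ[Z | filt F₀ T.toEquiv (N : ℤ)] - μ[Z | filt F₀ T.toEquiv (-(N : ℤ))] := by
  rw [← sum_Ioc_neg_sub (fun l => μ[Z | filt F₀ T.toEquiv l])]
  refine (Lp.coeFn_finsetSum _ _).trans ?_
  have hterm : ∀ l ∈ Finset.Ioc (-(N : ℤ)) N, ∀ᵐ ω ∂μ,
      (koopman hT l ((memLp_proj (filt F₀ T.toEquiv) (memLp_process hT hZ (-l)) 0).toLp _)) ω =
        (μ[Z | filt F₀ T.toEquiv l] - μ[Z | filt F₀ T.toEquiv (l - 1)]) ω := fun l _ => by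
    rw [koopman_toLp]
    exact (MemLp.coeFn_toLp _).trans (process_proj hT hF₀ (hZ.integrable one_le_two) l)
  filter_upwards [(Finset.eventually_all _).2 hterm] with ω hω
  rw [Finset.sum_apply, Finset.sum_apply]
  exact Finset.sum_congr rfl hω

lemma tendsto_condExp_future_sub_past [IsProbabilityMeasure μ] (hT : MeasurePreserving T μ μ)
    (hF₀ : F₀ ≤ mΩ) (hmono : F₀ ≤ F₀.comap T)
    (htail : ∀ s : Set Ω, MeasurableSet[⨅ i : ℤ, filt F₀ T.toEquiv i] s → μ s = 0 ∨ μ s = 1)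
    {Z : Ω → ℝ} (hZ : MemLp Z 2 μ) (hmean : ∫ ω, Z ω ∂μ = 0)
    (hmeas : Measurable[⨆ i : ℤ, filt F₀ T.toEquiv i] Z) :
    Tendsto (fun N : ℕ => eLpNorm ((μ[Z | filt F₀ T.toEquiv (N : ℤ)] -
      μ[Z | filt F₀ T.toEquiv (-(N : ℤ))]) - Z) 1 μ) atTop (𝓝 0) := by
  have hZ1 := hZ.integrable one_le_two
  have hpast := tendsto_condExp_past hT hF₀ hmono htail hZ
  have hfuture := tendsto_condExp_future hT hF₀ hmono hZ1 hmeas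
  have hbound := hfuture.add hpast
  rw [add_zero] at hbound
  refine tendsto_of_tendsto_of_tendsto_of_le_of_le tendsto_const_nhds hbound (fun _ => zero_le)
    fun N => ?_
  have hsplit : ∀ A B : Ω → ℝ, A - B - Z = (A - Z) - (B - fun _ => ∫ ω, Z ω ∂μ) := by
    intro A B
    ext ω
    simp only [Pi.sub_apply, hmean]
    ring
  simp only [hsplit]
  exact eLpNorm_sub_le (integrable_condExp.sub hZ1).aestronglyMeasurable
    (integrable_condExp.sub (integrable_const _)).aestronglyMeasurable le_rfl

lemma isMovingAverage_proj [IsProbabilityMeasure μ] (hT : MeasurePreserving T μ μ) (hF₀ : F₀ ≤ mΩ)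
    (hmono : F₀ ≤ F₀.comap T)
    (htail : ∀ s : Set Ω, MeasurableSet[⨅ i : ℤ, filt F₀ T.toEquiv i] s → μ s = 0 ∨ μ s = 1)
    {Z : Ω → ℝ} (hZ : MemLp Z 2 μ) (hmean : ∫ ω, Z ω ∂μ = 0)
    (hmeas : Measurable[⨆ i : ℤ, filt F₀ T.toEquiv i] Z)
    (hHannan : ∑' i : ℤ, eLpNorm (proj (filt F₀ T.toEquiv) μ 0 (process T.toEquiv Z i)) 2 μ < ⊤) :
    IsMovingAverage F₀ hT
      (fun l => proj (filt F₀ T.toEquiv) μ 0 (process T.toEquiv Z (-l))) Z := by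
  have hsummable : Summable fun l : ℤ =>
      (eLpNorm (proj (filt F₀ T.toEquiv) μ 0 (process T.toEquiv Z (-l))) 2 μ).toReal :=
    (ENNReal.summable_toReal hHannan.ne).comp_injective neg_injective
  refine ⟨fun l => isInnovation_proj hT hF₀ hmono (memLp_process hT hZ (-l)), hZ, hsummable, ?_⟩
  obtain ⟨W, hW⟩ : Summable fun l : ℤ => koopman hT l
      ((memLp_proj (filt F₀ T.toEquiv) (memLp_process hT hZ (-l)) 0).toLp _) :=
    .of_norm (by simpa only [LinearIsometry.norm_map, Lp.norm_toLp] using hsummable)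
  have hlimW : Tendsto (fun N : ℕ => eLpNorm ((μ[Z | filt F₀ T.toEquiv (N : ℤ)] -
      μ[Z | filt F₀ T.toEquiv (-(N : ℤ))]) - (W : Ω → ℝ)) 2 μ) atTop (𝓝 0) :=
    ((Lp.tendsto_Lp_iff_tendsto_eLpNorm' _ _).1 (hW.comp (Finset.tendsto_Ioc_neg (R := ℤ)))).congr
      fun N => eLpNorm_congr_ae ((sum_koopman_proj_ae_eq hT hF₀ hZ N).sub EventuallyEq.rfl)
  have hlimZ := tendsto_condExp_future_sub_past hT hF₀ hmono htail hZ hmean hmeas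
  have hmeasN : ∀ N : ℕ, AEStronglyMeasurable (μ[Z | filt F₀ T.toEquiv (N : ℤ)] -
      μ[Z | filt F₀ T.toEquiv (-(N : ℤ))]) μ :=
    fun N => (integrable_condExp.sub integrable_condExp).aestronglyMeasurable
  have hWZ : (W : Ω → ℝ) =ᵐ[μ] Z := tendstoInMeasure_ae_unique
    (tendstoInMeasure_of_tendsto_eLpNorm two_ne_zero hmeasN (Lp.aestronglyMeasurable W) hlimW)
    (tendstoInMeasure_of_tendsto_eLpNorm one_ne_zero hmeasN hZ.aestronglyMeasurable hlimZ)
  have hW_eq : W = hZ.toLp Z := Lp.ext (hWZ.trans hZ.coeFn_toLp.symm)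
  exact hW_eq ▸ hW

end Hannan

end Autocovariance

/-! ### Second moment bounds for bounded innovations -/

section SquareIntegrable

variable {Ω : Type*} [mΩ : MeasurableSpace Ω] {μ : Measure Ω}

lemma integral_abs_le_of_integral_sq_le [IsProbabilityMeasure μ] {R : Ω → ℝ} (hR : MemLp R 2 μ)
    {s : ℝ} (hs : 0 ≤ s) (h : ∫ ω, R ω ^ 2 ∂μ ≤ s ^ 2) : ∫ ω, |R ω| ∂μ ≤ s := by
  have hvar : 0 ≤ ∫ ω, (|R ω| - ∫ ω', |R ω'| ∂μ) ^ 2 ∂μ := integral_nonneg fun _ => sq_nonneg _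
  have habs : MemLp (fun ω => |R ω|) 2 μ := hR.abs
  rw [← variance_eq_integral habs.aestronglyMeasurable.aemeasurable,
    variance_eq_sub habs] at hvar
  simp only [Pi.pow_apply, sq_abs] at hvar
  exact abs_le_of_sq_le_sq' (by linarith) hs |>.2

lemma integral_sq_sum {ι : Type*} (I : Finset ι) {R : ι → Ω → ℝ}
    (hR : ∀ i ∈ I, MemLp (R i) 2 μ) :
    ∫ ω, (∑ i ∈ I, R i ω) ^ 2 ∂μ = ∑ i ∈ I, ∑ j ∈ I, ∫ ω, R i ω * R j ω ∂μ := by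
  simp_rw [sq, Finset.sum_mul_sum]
  have hint : ∀ i ∈ I, ∀ j ∈ I, Integrable (fun ω => R i ω * R j ω) μ :=
    fun i hi j hj => (hR i hi).integrable_mul (hR j hj)
  rw [integral_finsetSum _ fun i hi => integrable_finsetSum _ (hint i hi)]
  exact Finset.sum_congr rfl fun i hi => integral_finsetSum _ (hint i hi)

lemma integral_sq_sum_of_orthogonal {ι : Type*} (I : Finset ι) {R : ι → Ω → ℝ}
    (hR : ∀ i ∈ I, MemLp (R i) 2 μ)
    (horth : ∀ i ∈ I, ∀ j ∈ I, i ≠ j → ∫ ω, R i ω * R j ω ∂μ = 0) :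
    ∫ ω, (∑ i ∈ I, R i ω) ^ 2 ∂μ = ∑ i ∈ I, ∫ ω, R i ω ^ 2 ∂μ := by
  rw [integral_sq_sum I hR]
  refine Finset.sum_congr rfl fun i hi => ?_
  rw [Finset.sum_eq_single_of_mem i hi fun j hj hji => horth i hi j hj hji.symm]
  simp_rw [sq]

lemma integral_sq_add_add_le {f g h : Ω → ℝ} (hf : MemLp f 2 μ) (hg : MemLp g 2 μ)
    (hh : MemLp h 2 μ) :
    ∫ ω, (f ω + g ω + h ω) ^ 2 ∂μ ≤
      3 * (∫ ω, f ω ^ 2 ∂μ + ∫ ω, g ω ^ 2 ∂μ + ∫ ω, h ω ^ 2 ∂μ) := by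
  have hfg : Integrable (fun ω => f ω ^ 2 + g ω ^ 2) μ := hf.integrable_sq.add hg.integrable_sq
  rw [← integral_add hf.integrable_sq hg.integrable_sq, ← integral_add hfg hh.integrable_sq,
    ← integral_const_mul]
  refine integral_mono_of_nonneg (Eventually.of_forall fun _ => sq_nonneg _)
    ((hfg.add hh.integrable_sq).const_mul _) (Eventually.of_forall fun ω => ?_)
  dsimp only
  nlinarith only [sq_nonneg (f ω - g ω), sq_nonneg (g ω - h ω), sq_nonneg (h ω - f ω)]

lemma exists_ae_abs_le {f : Ω → ℝ} (hf : MemLp f ⊤ μ) : ∃ B : ℝ, ∀ᵐ ω ∂μ, |f ω| ≤ B := by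
  refine ⟨(eLpNorm f ⊤ μ).toReal, ?_⟩
  filter_upwards [ae_le_eLpNormEssSup (f := f) (μ := μ)] with ω h
  rw [← eLpNorm_exponent_top] at h
  have hreal := ENNReal.toReal_mono hf.eLpNorm_ne_top h
  rwa [toReal_enorm, Real.norm_eq_abs] at hreal

lemma integral_sq_mul_le {f g : Ω → ℝ} (hf : MemLp f 2 μ) {B : ℝ} (hg : ∀ᵐ ω ∂μ, |g ω| ≤ B) :
    ∫ ω, (f ω * g ω) ^ 2 ∂μ ≤ B ^ 2 * ∫ ω, f ω ^ 2 ∂μ := by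
  rw [← integral_const_mul]
  refine integral_mono_of_nonneg (Eventually.of_forall fun _ => sq_nonneg _)
    (hf.integrable_sq.const_mul _) ?_
  filter_upwards [hg] with ω h
  rw [mul_pow, mul_comm]
  exact mul_le_mul_of_nonneg_right (sq_le_sq' (abs_le.1 h).1 (abs_le.1 h).2) (sq_nonneg _)

end SquareIntegrable

lemma sum_sq_le_of_banded {b : ℕ → ℝ} (hb : ∀ i, |b i| ≤ 1) (n L j : ℕ)
    (hband : ∀ i : ℕ, (L : ℤ) ≤ |(i : ℤ) - j| → b i = 0) :
    ∑ i ∈ Finset.Icc 1 n, b i ^ 2 ≤ 2 * L := by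
  calc ∑ i ∈ Finset.Icc 1 n, b i ^ 2
      ≤ ∑ i ∈ Finset.Icc 1 n, (if |(i : ℤ) - j| < L then 1 else 0) := by
        refine Finset.sum_le_sum fun i _ => ?_
        split_ifs with h
        · exact (sq_le_one_iff_abs_le_one _).2 (hb i)
        · rw [hband i (not_lt.1 h), zero_pow two_ne_zero]
    _ ≤ 2 * L := by
        rw [Finset.sum_boole]
        exact_mod_cast card_near_le L n j

section BoundedInnovations

variable {Ω : Type*} {F₀ : MeasurableSpace Ω} [mΩ : MeasurableSpace Ω]
  {μ : Measure Ω} {T : Ω ≃ᵐ Ω}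

namespace IsInnovation

variable {X Y : Ω → ℝ}

lemma integral_sq_sum_process [IsFiniteMeasure μ] (hT : MeasurePreserving T μ μ)
    (hF₀ : F₀ ≤ mΩ) (hmono : F₀ ≤ F₀.comap T) (hX : IsInnovation F₀ T.toEquiv μ X)
    (I : Finset ℕ) (b : ℕ → ℝ) (l : ℤ) :
    ∫ ω, (∑ i ∈ I, b i * process T.toEquiv X (i + l) ω) ^ 2 ∂μ =
      (∑ i ∈ I, b i ^ 2) * ∫ ω, X ω ^ 2 ∂μ := by
  rw [integral_sq_sum_of_orthogonal I
    fun i _ => (memLp_process hT hX.memLp (i + l)).const_mul (b i), Finset.sum_mul]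
  · refine Finset.sum_congr rfl fun i _ => ?_
    simp_rw [mul_pow]
    rw [integral_const_mul, ← integral_process hT (fun ω => X ω ^ 2) (i + l)]
    rfl
  · intro i _ j _ hij
    simp_rw [mul_mul_mul_comm]
    rw [integral_const_mul, hX.orthogonal hT hF₀ hmono hX (by lia), mul_zero]

lemma integral_sq_sum_mul_process [IsFiniteMeasure μ] (hT : MeasurePreserving T μ μ)
    (hF₀ : F₀ ≤ mΩ) (hmono : F₀ ≤ F₀.comap T) (hY : IsInnovation F₀ T.toEquiv μ Y)
    (hYb : MemLp Y ⊤ μ) (I : Finset ℕ) (m : ℤ) {G : ℕ → Ω → ℝ}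
    (hG : ∀ j : ℕ, StronglyMeasurable[filt F₀ T.toEquiv (j + m - 1)] (G j))
    (hGb : ∀ j, MemLp (G j) ⊤ μ) :
    ∫ ω, (∑ j ∈ I, G j ω * process T.toEquiv Y (j + m) ω) ^ 2 ∂μ =
      ∑ j ∈ I, ∫ ω, (G j ω * process T.toEquiv Y (j + m) ω) ^ 2 ∂μ := by
  set R : ℕ → Ω → ℝ := fun j => G j * process T.toEquiv Y (j + m)
  have hR : ∀ j, MemLp (R j) ⊤ μ := fun j => (memLp_process hT hYb _).mul (hGb j)
  have hlt : ∀ j k : ℕ, j < k → ∫ ω, R j ω * R k ω ∂μ = 0 := by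
    intro j k hjk
    have hpast : StronglyMeasurable[filt F₀ T.toEquiv (k + m - 1)] (R j * G k) :=
      (((hG j).mono (filt_mono hmono (by lia))).mul
        ((hY.stronglyMeasurable_process _).mono (filt_mono hmono (by lia)))).mul (hG k)
    have hzero := hY.integral_mul_process hT hF₀ hpast
      (((hGb k).mul (hR j)).mono_exponent le_top)
    simpa only [R, Pi.mul_apply, mul_assoc] using hzero
  refine integral_sq_sum_of_orthogonal I (R := R) (fun j _ => (hR j).mono_exponent le_top)
    fun j _ k _ hjk => ?_
  rcases lt_or_gt_of_ne hjk with h | h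
  · exact hlt j k h
  · simpa only [mul_comm] using hlt k j h

lemma exists_integral_sq_strictLower_le [IsFiniteMeasure μ] (hT : MeasurePreserving T μ μ)
    (hF₀ : F₀ ≤ mΩ) (hmono : F₀ ≤ F₀.comap T) (hX : IsInnovation F₀ T.toEquiv μ X)
    (hY : IsInnovation F₀ T.toEquiv μ Y) (hXb : MemLp X ⊤ μ) (hYb : MemLp Y ⊤ μ) (l m : ℤ) :
    ∃ K : ℝ, 0 ≤ K ∧ ∀ (n L : ℕ) (b : ℕ → ℕ → ℝ), (∀ i j, |b i j| ≤ 1) →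
      (∀ i j : ℕ, (L : ℤ) ≤ |(i : ℤ) - j| → b i j = 0) →
      (∀ i j : ℕ, (j : ℤ) + m ≤ i + l → b i j = 0) →
      ∫ ω, (∑ j ∈ Finset.Icc 1 n, (∑ i ∈ Finset.Icc 1 n, b i j * process T.toEquiv X (i + l) ω) *
        process T.toEquiv Y (j + m) ω) ^ 2 ∂μ ≤ n * (K * L) := by
  obtain ⟨B, hB⟩ := exists_ae_abs_le hYb
  refine ⟨B ^ 2 * (2 * ∫ ω, X ω ^ 2 ∂μ), by positivity, fun n L b hb hband hlow => ?_⟩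
  set G : ℕ → Ω → ℝ := fun j ω => ∑ i ∈ Finset.Icc 1 n, b i j * process T.toEquiv X (i + l) ω
  have hGb : ∀ j, MemLp (G j) ⊤ μ := fun j =>
    memLp_finsetSum _ fun i _ => (memLp_process hT hXb _).const_mul _
  have hG : ∀ j : ℕ, StronglyMeasurable[filt F₀ T.toEquiv (j + m - 1)] (G j) := by
    refine fun j => Finset.stronglyMeasurable_fun_sum _ fun i _ => ?_
    rcases le_or_gt ((j : ℤ) + m) (i + l) with h | h
    · simp only [hlow i j h, zero_mul]
      exact stronglyMeasurable_const
    · exact ((hX.stronglyMeasurable_process _).mono (filt_mono hmono (by lia))).const_mul _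
  calc ∫ ω, (∑ j ∈ Finset.Icc 1 n, G j ω * process T.toEquiv Y (j + m) ω) ^ 2 ∂μ
      = ∑ j ∈ Finset.Icc 1 n, ∫ ω, (G j ω * process T.toEquiv Y (j + m) ω) ^ 2 ∂μ :=
        hY.integral_sq_sum_mul_process hT hF₀ hmono hYb _ m hG hGb
    _ ≤ ∑ j ∈ Finset.Icc 1 n, B ^ 2 * (2 * L * ∫ ω, X ω ^ 2 ∂μ) := by
        refine Finset.sum_le_sum fun j _ =>
          (integral_sq_mul_le ((hGb j).mono_exponent le_top)
            (ae_process hT (P := (|·| ≤ B)) hB (j + m))).trans ?_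
        rw [hX.integral_sq_sum_process hT hF₀ hmono]
        gcongr
        exact sum_sq_le_of_banded (hb · j) n L j (hband · j)
    _ = n * (B ^ 2 * (2 * ∫ ω, X ω ^ 2 ∂μ) * L) := by
        rw [Finset.sum_const, Nat.card_Icc, Nat.add_sub_cancel, nsmul_eq_mul]
        ring

end IsInnovation

lemma abs_acov_le_acov_zero (hT : MeasurePreserving T μ μ) {g : Ω → ℝ}
    (hg : MemLp g 2 μ) (k : ℤ) : |acov T.toEquiv μ g k| ≤ acov T.toEquiv μ g 0 := by
  have h := abs_real_inner_le_norm (hg.toLp g) (koopman hT k (hg.toLp g))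
  rwa [LinearIsometry.norm_map, ← real_inner_self_eq_norm_mul_norm, koopman_toLp, inner_toLp,
    inner_toLp, ← process_zero T.toEquiv g, process_process, zero_add] at h

lemma abs_acov_neg_le [IsFiniteMeasure μ] (hT : MeasurePreserving T μ μ) (hF₀ : F₀ ≤ mΩ)
    {g : Ω → ℝ} (hgm : StronglyMeasurable[F₀] g) (hg : MemLp g 2 μ) {B : ℝ}
    (hgB : ∀ᵐ ω ∂μ, |g ω| ≤ B) (k : ℤ) :
    |acov T.toEquiv μ g (-k)| ≤ (∫ ω, |(μ[g | filt F₀ T.toEquiv (-k)]) ω| ∂μ) * B := by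
  have hgk : StronglyMeasurable[filt F₀ T.toEquiv (-k)] (process T.toEquiv g (-k)) := by
    have h := stronglyMeasurable_process (F₀ := F₀) T.toEquiv (i := 0)
      (by rwa [filt_zero]) (-k)
    rwa [zero_add] at h
  have hgk2 : MemLp (process T.toEquiv g (-k)) 2 μ := memLp_process hT hg _
  calc |acov T.toEquiv μ g (-k)|
      = |∫ ω, (μ[g | filt F₀ T.toEquiv (-k)]) ω * process T.toEquiv g (-k) ω ∂μ| := by
        rw [acov, ← integral_condExp (filt_le hT hF₀ (-k))]
        exact congrArg _ (integral_congr_ae (condExp_mul_of_aestronglyMeasurable_right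
          hgk.aestronglyMeasurable (hg.integrable_mul hgk2) (hg.integrable one_le_two)))
    _ ≤ ∫ ω, |(μ[g | filt F₀ T.toEquiv (-k)]) ω| * B ∂μ := by
        refine abs_integral_le_integral_abs.trans (integral_mono_ae
          ((hg.condExp one_le_two).integrable_mul hgk2).abs (integrable_condExp.abs.mul_const _) ?_)
        filter_upwards [ae_process hT (P := (|·| ≤ B)) hgB (-k)] with ω h
        rw [abs_mul]
        exact mul_le_mul_of_nonneg_left h (abs_nonneg _)
    _ = _ := integral_mul_const _ _

section TrivialTail

variable [IsProbabilityMeasure μ] {g : Ω → ℝ}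

lemma tendsto_acov (hT : MeasurePreserving T μ μ) (hF₀ : F₀ ≤ mΩ) (hmono : F₀ ≤ F₀.comap T)
    (htail : ∀ s : Set Ω, MeasurableSet[⨅ i : ℤ, filt F₀ T.toEquiv i] s → μ s = 0 ∨ μ s = 1)
    (hgm : StronglyMeasurable[F₀] g) (hg : MemLp g ⊤ μ) (hmean : ∫ ω, g ω ∂μ = 0) :
    Tendsto (fun n : ℕ => acov T.toEquiv μ g n) atTop (𝓝 0) := by
  obtain ⟨B, hgB⟩ := exists_ae_abs_le hg
  have hg2 : MemLp g 2 μ := hg.mono_exponent le_top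
  have hpast : Tendsto (fun n : ℕ => ∫ ω, |(μ[g | filt F₀ T.toEquiv (-(n : ℤ))]) ω| ∂μ)
      atTop (𝓝 0) := by
    have h := (ENNReal.tendsto_toReal ENNReal.zero_ne_top).comp
      (tendsto_condExp_past hT hF₀ hmono htail hg2)
    refine h.congr fun n => ?_
    rw [Function.comp_apply, hmean, eLpNorm_one_eq_lintegral_enorm,
      ← integral_norm_eq_lintegral_enorm
        (integrable_condExp.sub (integrable_const _)).aestronglyMeasurable]
    simp only [Pi.sub_apply, sub_zero, Real.norm_eq_abs]
  refine squeeze_zero_norm (fun n => ?_) (by simpa only [zero_mul] using hpast.mul_const B)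
  rw [Real.norm_eq_abs, ← acov_neg hT]
  exact abs_acov_neg_le hT hF₀ hgm hg2 hgB n

lemma exists_abs_acov_le (hT : MeasurePreserving T μ μ) (hF₀ : F₀ ≤ mΩ) (hmono : F₀ ≤ F₀.comap T)
    (htail : ∀ s : Set Ω, MeasurableSet[⨅ i : ℤ, filt F₀ T.toEquiv i] s → μ s = 0 ∨ μ s = 1)
    (hgm : StronglyMeasurable[F₀] g) (hg : MemLp g ⊤ μ) (hmean : ∫ ω, g ω ∂μ = 0)
    {θ : ℝ} (hθ : 0 < θ) :
    ∃ K : ℕ, ∀ k : ℤ, (K : ℤ) ≤ |k| → |acov T.toEquiv μ g k| ≤ θ := by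
  have hlim := (tendsto_acov hT hF₀ hmono htail hgm hg hmean).abs
  rw [abs_zero] at hlim
  obtain ⟨K, hK⟩ := eventually_atTop.1 (hlim.eventually_le_const hθ)
  refine ⟨K, fun k hk => ?_⟩
  obtain ⟨n, rfl | rfl⟩ := k.eq_nat_or_neg
  · exact hK n (by simpa using hk)
  · rw [acov_neg hT]
    exact hK n (by simpa using hk)

lemma exists_integral_sq_weighted_le (hT : MeasurePreserving T μ μ)
    (hF₀ : F₀ ≤ mΩ) (hmono : F₀ ≤ F₀.comap T)
    (htail : ∀ s : Set Ω, MeasurableSet[⨅ i : ℤ, filt F₀ T.toEquiv i] s → μ s = 0 ∨ μ s = 1)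
    (hgm : StronglyMeasurable[F₀] g) (hg : MemLp g ⊤ μ) (hmean : ∫ ω, g ω ∂μ = 0)
    {θ : ℝ} (hθ : 0 < θ) :
    ∃ C : ℝ, 0 ≤ C ∧ ∀ (n : ℕ) (m : ℤ) (w : ℕ → ℝ), (∀ j, |w j| ≤ 1) →
      ∫ ω, (∑ j ∈ Finset.Icc 1 n, w j * process T.toEquiv g (j + m) ω) ^ 2 ∂μ ≤
        n * (C + θ * n) := by
  obtain ⟨K, hK⟩ := exists_abs_acov_le hT hF₀ hmono htail hgm hg hmean hθ
  have hg2 : MemLp g 2 μ := hg.mono_exponent le_top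
  have hvar : 0 ≤ acov T.toEquiv μ g 0 := (abs_nonneg _).trans (abs_acov_le_acov_zero hT hg2 0)
  refine ⟨2 * K * acov T.toEquiv μ g 0, by positivity, fun n m w hw => ?_⟩
  rw [integral_sq_sum _ fun j _ => (memLp_process hT hg2 _).const_mul _]
  have hterm : ∀ i j : ℕ, ∫ ω, w i * process T.toEquiv g (i + m) ω *
      (w j * process T.toEquiv g (j + m) ω) ∂μ ≤
      (if |(j : ℤ) - i| < K then acov T.toEquiv μ g 0 else 0) + θ := by
    intro i j
    have hww : |w i * w j| ≤ 1 := by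
      rw [abs_mul]
      exact mul_le_one₀ (hw i) (abs_nonneg _) (hw j)
    simp_rw [mul_mul_mul_comm]
    rw [integral_const_mul, integral_process_mul_self hT, add_sub_add_right_eq_sub]
    refine (le_abs_self _).trans ?_
    rw [abs_mul]
    refine (mul_le_of_le_one_left (abs_nonneg _) hww).trans ?_
    split_ifs with h
    · linarith [abs_acov_le_acov_zero hT hg2 ((j : ℤ) - i)]
    · rw [zero_add]
      exact hK _ (not_lt.1 h)
  calc _ ≤ ∑ i ∈ Finset.Icc 1 n, ∑ j ∈ Finset.Icc 1 n,
        ((if |(j : ℤ) - i| < K then acov T.toEquiv μ g 0 else 0) + θ) :=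
        Finset.sum_le_sum fun i _ => Finset.sum_le_sum fun j _ => hterm i j
    _ ≤ ∑ i ∈ Finset.Icc 1 n, (2 * K * acov T.toEquiv μ g 0 + θ * n) := by
        refine Finset.sum_le_sum fun i _ => ?_
        rw [Finset.sum_add_distrib, ← Finset.sum_filter, Finset.sum_const, Finset.sum_const,
          nsmul_eq_mul, nsmul_eq_mul, Nat.card_Icc, Nat.add_sub_cancel, mul_comm θ]
        gcongr
        exact_mod_cast card_near_le K n i
    _ = _ := by rw [Finset.sum_const, Nat.card_Icc, nsmul_eq_mul, Nat.add_sub_cancel]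

end TrivialTail

end BoundedInnovations

/-! ### Concentration of banded quadratic forms -/

section CentredForm

variable {Ω : Type*} [mΩ : MeasurableSpace Ω] {μ : Measure Ω}

/-- The centred bilinear form with Toeplitz coefficients `a (j - i)`, `1 ≤ i, j ≤ n`, in the random
variables `U i` and `V j`. -/
def centredForm (μ : Measure Ω) (a : ℤ → ℝ) (n : ℕ) (U V : ℕ → Ω → ℝ) (ω : Ω) : ℝ :=
  ∑ i ∈ Finset.Icc 1 n, ∑ j ∈ Finset.Icc 1 n,
    a ((j : ℤ) - i) * (U i ω * V j ω - ∫ ω', U i ω' * V j ω' ∂μ)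

lemma memLp_centredForm [IsFiniteMeasure μ] (a : ℤ → ℝ) (n : ℕ) {U V : ℕ → Ω → ℝ}
    (hU : ∀ i, MemLp (U i) ⊤ μ) (hV : ∀ j, MemLp (V j) ⊤ μ) :
    MemLp (centredForm μ a n U V) ⊤ μ :=
  memLp_finsetSum _ fun i _ => memLp_finsetSum _ fun j _ =>
    (((hV j).mul (hU i)).sub (memLp_const _)).const_mul _

lemma centredForm_sum [IsFiniteMeasure μ] {ι : Type*} (A : Finset ι) (a : ℤ → ℝ) (n : ℕ)
    {U : ι → ℕ → Ω → ℝ} (hU : ∀ l i, MemLp (U l i) 2 μ) (ω : Ω) :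
    centredForm μ a n (fun i => ∑ l ∈ A, U l i) (fun i => ∑ l ∈ A, U l i) ω =
      ∑ q ∈ A ×ˢ A, centredForm μ a n (U q.1) (U q.2) ω := by
  have hint : ∀ i j l m, Integrable (fun ω => U l i ω * U m j ω) μ :=
    fun i j l m => (hU l i).integrable_mul (hU m j)
  have hmean : ∀ i j, ∫ ω, (∑ l ∈ A, U l i ω) * (∑ m ∈ A, U m j ω) ∂μ =
      ∑ q ∈ A ×ˢ A, ∫ ω, U q.1 i ω * U q.2 j ω ∂μ := by
    intro i j
    simp_rw [Finset.sum_mul_sum, ← Finset.sum_product']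
    exact integral_finsetSum _ fun q _ => hint i j q.1 q.2
  simp only [centredForm, Finset.sum_apply, hmean]
  rw [Finset.sum_comm (s := A ×ˢ A)]
  refine Finset.sum_congr rfl fun i _ => ?_
  rw [Finset.sum_comm (s := A ×ˢ A)]
  refine Finset.sum_congr rfl fun j _ => ?_
  rw [Finset.sum_mul_sum, ← Finset.sum_product', ← Finset.sum_sub_distrib, Finset.mul_sum]

end CentredForm

lemma abs_sum_diagonal_le_one {a : ℤ → ℝ} (ha : ∀ k, |a k| ≤ 1) (I : Finset ℕ) (l m : ℤ) (j : ℕ) :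
    |∑ i ∈ I, if (i : ℤ) + l = j + m then a ((j : ℤ) - i) else 0| ≤ 1 := by
  by_cases h : ∃ i ∈ I, (i : ℤ) + l = j + m
  · obtain ⟨i, hi, hij⟩ := h
    rw [Finset.sum_eq_single_of_mem i hi fun k _ hk => if_neg (by lia), if_pos hij]
    exact ha _
  · rw [Finset.sum_eq_zero fun i hi => if_neg fun hij => h ⟨i, hi, hij⟩, abs_zero]
    exact zero_le_one

section Concentration

variable {Ω : Type*} {F₀ : MeasurableSpace Ω} [mΩ : MeasurableSpace Ω]
  {μ : Measure Ω} {T : Ω ≃ᵐ Ω}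

lemma quadForm_sub_meanForm (hT : MeasurePreserving T μ μ) (a : ℤ → ℝ) (n : ℕ) (Z : Ω → ℝ)
    (ω : Ω) :
    quadForm a n (fun i => process T.toEquiv Z i ω) - meanForm a n (acov T.toEquiv μ Z) =
      centredForm μ a n (fun i => process T.toEquiv Z i) (fun i => process T.toEquiv Z i) ω := by
  simp only [quadForm, meanForm, centredForm, integral_process_mul_self hT, mul_sub,
    Finset.sum_sub_distrib]

lemma centredForm_process [IsFiniteMeasure μ] (hT : MeasurePreserving T μ μ)
    (hF₀ : F₀ ≤ mΩ) (hmono : F₀ ≤ F₀.comap T) {X Y : Ω → ℝ}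
    (hX : IsInnovation F₀ T.toEquiv μ X) (hY : IsInnovation F₀ T.toEquiv μ Y)
    (a : ℤ → ℝ) (n : ℕ) (l m : ℤ) (ω : Ω) :
    centredForm μ a n (fun i => process T.toEquiv X (i + l)) (fun j => process T.toEquiv Y (j + m))
        ω =
      ∑ j ∈ Finset.Icc 1 n, (∑ i ∈ Finset.Icc 1 n,
        (if (i : ℤ) + l < j + m then a ((j : ℤ) - i) else 0) * process T.toEquiv X (i + l) ω) *
          process T.toEquiv Y (j + m) ω +
      ∑ i ∈ Finset.Icc 1 n, (∑ j ∈ Finset.Icc 1 n,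
        (if (j : ℤ) + m < i + l then a ((j : ℤ) - i) else 0) * process T.toEquiv Y (j + m) ω) *
          process T.toEquiv X (i + l) ω +
      ∑ j ∈ Finset.Icc 1 n, (∑ i ∈ Finset.Icc 1 n,
        if (i : ℤ) + l = j + m then a ((j : ℤ) - i) else 0) *
          process T.toEquiv (fun ω => X ω * Y ω - ∫ ω', X ω' * Y ω' ∂μ) (j + m) ω := by
  have hmean : ∀ i j : ℕ,
      ∫ ω, process T.toEquiv X (i + l) ω * process T.toEquiv Y (j + m) ω ∂μ =
        if (i : ℤ) + l = j + m then ∫ ω, X ω * Y ω ∂μ else 0 := by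
    intro i j
    split_ifs with h
    · rw [h]
      exact integral_process hT (X * Y) _
    · exact hX.orthogonal hT hF₀ hmono hY h
  simp only [centredForm, hmean, Finset.sum_mul]
  rw [Finset.sum_comm, Finset.sum_comm (f := fun i j : ℕ =>
    (if (j : ℤ) + m < i + l then _ else _) * _ * _)]
  simp only [← Finset.sum_add_distrib]
  refine Finset.sum_congr rfl fun j _ => Finset.sum_congr rfl fun i _ => ?_
  rcases lt_trichotomy ((i : ℤ) + l) (j + m) with h | h | h
  · rw [if_neg h.ne, if_pos h, if_neg h.not_gt, if_neg h.ne]; ring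
  · rw [if_pos h, if_neg h.not_lt, if_neg h.not_gt, if_pos h, h]
    simp only [process]
    ring
  · rw [if_neg h.ne', if_neg h.not_gt, if_pos h, if_neg h.ne']; ring

lemma exists_integral_sq_centredForm_process_le [IsProbabilityMeasure μ]
    (hT : MeasurePreserving T μ μ) (hF₀ : F₀ ≤ mΩ) (hmono : F₀ ≤ F₀.comap T)
    (htail : ∀ s : Set Ω, MeasurableSet[⨅ i : ℤ, filt F₀ T.toEquiv i] s → μ s = 0 ∨ μ s = 1)
    {X Y : Ω → ℝ} (hX : IsInnovation F₀ T.toEquiv μ X) (hY : IsInnovation F₀ T.toEquiv μ Y)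
    (hXb : MemLp X ⊤ μ) (hYb : MemLp Y ⊤ μ) (l m : ℤ) {θ : ℝ} (hθ : 0 < θ) :
    ∃ C : ℝ, 0 ≤ C ∧ ∀ (n L : ℕ) (a : ℤ → ℝ), (∀ k, |a k| ≤ 1) → (∀ k, (L : ℤ) ≤ |k| → a k = 0) →
      ∫ ω, centredForm μ a n (fun i => process T.toEquiv X (i + l))
        (fun j => process T.toEquiv Y (j + m)) ω ^ 2 ∂μ ≤ n * (C * (L + 1) + θ * n) := by
  set g : Ω → ℝ := fun ω => X ω * Y ω - ∫ ω', X ω' * Y ω' ∂μ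
  have hgb : MemLp g ⊤ μ := (hYb.mul hXb).sub (memLp_const _)
  have hgm : StronglyMeasurable[F₀] g :=
    (hX.measurable.mul hY.measurable).sub stronglyMeasurable_const
  have hg0 : ∫ ω, g ω ∂μ = 0 := by
    have hsub : ∫ ω, g ω ∂μ = ∫ ω, X ω * Y ω ∂μ - ∫ _, (∫ ω', X ω' * Y ω' ∂μ) ∂μ :=
      integral_sub (hX.memLp.integrable_mul hY.memLp) (integrable_const _)
    rw [hsub, integral_const, probReal_univ, one_smul, sub_self]
  obtain ⟨K₁, hK₁, hlower⟩ := hX.exists_integral_sq_strictLower_le hT hF₀ hmono hY hXb hYb l m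
  obtain ⟨K₂, hK₂, hupper⟩ := hY.exists_integral_sq_strictLower_le hT hF₀ hmono hX hYb hXb m l
  obtain ⟨K₃, hK₃, hdiag⟩ := exists_integral_sq_weighted_le hT hF₀ hmono htail hgm hgb hg0
    (θ := θ / 3) (by positivity)
  refine ⟨3 * (K₁ + K₂ + K₃), by positivity, fun n L a ha hband => ?_⟩
  have hX_top : ∀ i, MemLp (process T.toEquiv X i) ⊤ μ := memLp_process hT hXb
  have hY_top : ∀ j, MemLp (process T.toEquiv Y j) ⊤ μ := memLp_process hT hYb
  have hite : ∀ (P : Prop) [Decidable P] (k : ℤ), |if P then a k else 0| ≤ 1 := fun P _ k => by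
    split_ifs
    exacts [ha k, by simp]
  specialize hlower n L (fun i j => if (i : ℤ) + l < j + m then a ((j : ℤ) - i) else 0)
    (fun _ _ => hite _ _) (fun i j h => by rw [hband _ (by rwa [abs_sub_comm]), ite_self])
    (fun i j h => if_neg h.not_gt)
  specialize hupper n L (fun j i => if (j : ℤ) + m < i + l then a ((j : ℤ) - i) else 0)
    (fun _ _ => hite _ _) (fun j i h => by rw [hband _ h, ite_self]) (fun j i h => if_neg h.not_gt)
  specialize hdiag n m _ (fun j => abs_sum_diagonal_le_one ha (Finset.Icc 1 n) l m j)
  simp_rw [centredForm_process hT hF₀ hmono hX hY]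
  refine (integral_sq_add_add_le ?_ ?_ ?_).trans
    ((mul_le_mul_of_nonneg_left (add_le_add (add_le_add hlower hupper) hdiag) zero_le_three).trans
      ?_)
  · exact (memLp_finsetSum _ fun j _ => (hY_top _).mul
      (memLp_finsetSum _ fun i _ => (hX_top _).const_mul _)).mono_exponent le_top
  · exact (memLp_finsetSum _ fun i _ => (hX_top _).mul
      (memLp_finsetSum _ fun j _ => (hY_top _).const_mul _)).mono_exponent le_top
  · exact memLp_finsetSum _ fun j _ =>
      ((memLp_process hT hgb _).mono_exponent le_top).const_mul _
  · have hslack : 0 ≤ (n : ℝ) * (K₁ + K₂ + K₃ * L) := by positivity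
    linear_combination 3 * hslack

lemma exists_integral_sq_centredForm_sum_le [IsProbabilityMeasure μ]
    (hT : MeasurePreserving T μ μ) (hF₀ : F₀ ≤ mΩ) (hmono : F₀ ≤ F₀.comap T)
    (htail : ∀ s : Set Ω, MeasurableSet[⨅ i : ℤ, filt F₀ T.toEquiv i] s → μ s = 0 ∨ μ s = 1)
    {D : ℤ → Ω → ℝ} (hD : ∀ l, IsInnovation F₀ T.toEquiv μ (D l)) (hDb : ∀ l, MemLp (D l) ⊤ μ)
    (A : Finset ℤ) {θ : ℝ} (hθ : 0 < θ) :
    ∃ C : ℝ, 0 ≤ C ∧ ∀ (n L : ℕ) (a : ℤ → ℝ), (∀ k, |a k| ≤ 1) → (∀ k, (L : ℤ) ≤ |k| → a k = 0) →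
      ∫ ω, centredForm μ a n (fun i => ∑ l ∈ A, process T.toEquiv (D l) (i + l))
        (fun i => ∑ l ∈ A, process T.toEquiv (D l) (i + l)) ω ^ 2 ∂μ ≤
          n * (C * (L + 1) + θ * n) := by
  set N : ℝ := ((A ×ˢ A).card : ℝ)
  choose C hC0 hC using fun q : ℤ × ℤ => exists_integral_sq_centredForm_process_le hT hF₀ hmono
    htail (hD q.1) (hD q.2) (hDb q.1) (hDb q.2) q.1 q.2 (θ := θ / (N ^ 2 + 1)) (by positivity)
  refine ⟨N * ∑ q ∈ A ×ˢ A, C q, mul_nonneg (by positivity)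
    (Finset.sum_nonneg fun q _ => hC0 q), fun n L a ha hband => ?_⟩
  set U : ℤ → ℕ → Ω → ℝ := fun l i => process T.toEquiv (D l) (i + l)
  have hU_top : ∀ l i, MemLp (U l i) ⊤ μ := fun l i => memLp_process hT (hDb l) _
  have hsq : ∀ q : ℤ × ℤ, Integrable (fun ω => centredForm μ a n (U q.1) (U q.2) ω ^ 2) μ :=
    fun q => ((memLp_centredForm a n (hU_top q.1) (hU_top q.2)).mono_exponent le_top).integrable_sq
  calc ∫ ω, centredForm μ a n (fun i => ∑ l ∈ A, U l i) (fun i => ∑ l ∈ A, U l i) ω ^ 2 ∂μ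
      = ∫ ω, (∑ q ∈ A ×ˢ A, centredForm μ a n (U q.1) (U q.2) ω) ^ 2 ∂μ := by
        simp_rw [centredForm_sum A a n fun l i => (hU_top l i).mono_exponent le_top]
    _ ≤ ∫ ω, N * ∑ q ∈ A ×ˢ A, centredForm μ a n (U q.1) (U q.2) ω ^ 2 ∂μ :=
        integral_mono_of_nonneg (Eventually.of_forall fun _ => sq_nonneg _)
          ((integrable_finsetSum _ fun q _ => hsq q).const_mul _)
          (Eventually.of_forall fun _ => sq_sum_le_card_mul_sum_sq)
    _ = N * ∑ q ∈ A ×ˢ A, ∫ ω, centredForm μ a n (U q.1) (U q.2) ω ^ 2 ∂μ := by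
        rw [integral_const_mul, integral_finsetSum _ fun q _ => hsq q]
    _ ≤ N * ∑ q ∈ A ×ˢ A, n * (C q * (L + 1) + θ / (N ^ 2 + 1) * n) := by
        gcongr with q _
        exact hC q n L a ha hband
    _ = n * ((N * ∑ q ∈ A ×ˢ A, C q) * (L + 1) + N ^ 2 / (N ^ 2 + 1) * θ * n) := by
        rw [← Finset.mul_sum, Finset.sum_add_distrib, Finset.sum_const, ← Finset.sum_mul,
          nsmul_eq_mul]
        ring
    _ ≤ n * ((N * ∑ q ∈ A ×ˢ A, C q) * (L + 1) + θ * n) := by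
        gcongr
        refine mul_le_of_le_one_left hθ.le ?_
        rw [div_le_one (by positivity)]
        linarith

lemma eventually_integral_abs_quadForm_sub_le [IsProbabilityMeasure μ]
    (hT : MeasurePreserving T μ μ) (hF₀ : F₀ ≤ mΩ) (hmono : F₀ ≤ F₀.comap T)
    (htail : ∀ s : Set Ω, MeasurableSet[⨅ i : ℤ, filt F₀ T.toEquiv i] s → μ s = 0 ∨ μ s = 1)
    {D : ℤ → Ω → ℝ} (hD : ∀ l, IsInnovation F₀ T.toEquiv μ (D l)) (hDb : ∀ l, MemLp (D l) ⊤ μ)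
    (A : Finset ℤ) {c : ℕ → ℕ}
    (hc : Tendsto (fun n => (c n : ℝ) / n) atTop (𝓝 0)) {θ : ℝ} (hθ : 0 < θ) :
    ∀ᶠ n : ℕ in atTop, ∀ a : ℤ → ℝ, (∀ k, |a k| ≤ 1) → (∀ k, 2 * (c n : ℤ) ≤ |k| → a k = 0) →
      ∫ ω, |quadForm a n (fun i => process T.toEquiv (∑ l ∈ A, process T.toEquiv (D l) l) i ω) -
        meanForm a n (acov T.toEquiv μ (∑ l ∈ A, process T.toEquiv (D l) l))| ∂μ ≤ θ * n := by
  obtain ⟨C, hC0, hC⟩ := exists_integral_sq_centredForm_sum_le hT hF₀ hmono htail hD hDb A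
    (θ := θ ^ 2 / 2) (by positivity)
  have hlim : Tendsto (fun n : ℕ => C * (2 * ((c n : ℝ) / n) + 1 / n)) atTop (𝓝 0) := by
    simpa using ((hc.const_mul 2).add tendsto_one_div_atTop_nhds_zero_nat).const_mul C
  filter_upwards [hlim.eventually_le_const (show 0 < θ ^ 2 / 2 by positivity),
    eventually_gt_atTop 0] with n hn hn0 a ha hband
  have hZ : ∀ i : ℤ, process T.toEquiv (∑ l ∈ A, process T.toEquiv (D l) l) i =
      ∑ l ∈ A, process T.toEquiv (D l) (i + l) := by
    intro i
    simp_rw [add_comm i, ← process_process]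
    ext ω
    simp only [process, Finset.sum_apply]
  have hZ_top : ∀ i : ℕ, MemLp (∑ l ∈ A, process T.toEquiv (D l) (i + l)) ⊤ μ := fun i =>
    memLp_finsetSum' _ fun l _ => memLp_process hT (hDb l) _
  simp_rw [quadForm_sub_meanForm hT, hZ]
  refine integral_abs_le_of_integral_sq_le
    ((memLp_centredForm a n hZ_top hZ_top).mono_exponent le_top) (by positivity)
    ((hC n (2 * c n) a ha (by exact_mod_cast hband)).trans ?_)
  calc (n : ℝ) * (C * ((2 * c n : ℕ) + 1) + θ ^ 2 / 2 * n)
      = n ^ 2 * (C * (2 * ((c n : ℝ) / n) + 1 / n) + θ ^ 2 / 2) := by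
        push_cast
        field_simp
    _ ≤ n ^ 2 * (θ ^ 2 / 2 + θ ^ 2 / 2) := by gcongr
    _ = (θ * n) ^ 2 := by ring

end Concentration

/-! ### Approximation by bounded innovations -/

section MeanForm

lemma sum_Icc_abs_le_tsum {γ : ℤ → ℝ} (hγ : Summable fun k => |γ k|) (n i : ℕ) :
    ∑ j ∈ Finset.Icc 1 n, |γ ((j : ℤ) - i)| ≤ ∑' k, |γ k| := by
  have hinj : Set.InjOn (fun j : ℕ => (j : ℤ) - i) (Finset.Icc 1 n) := fun a _ b _ hab => by
    simpa using hab
  rw [← Finset.sum_image (f := fun k => |γ k|) hinj]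
  exact hγ.sum_le_tsum _ fun _ _ => abs_nonneg _

lemma meanForm_le {γ : ℤ → ℝ} (hγ : Summable fun k => |γ k|) {a : ℤ → ℝ} {M : ℝ}
    (ha : ∀ k, |a k| ≤ M) (n : ℕ) : meanForm a n γ ≤ M * n * ∑' k, |γ k| := by
  have hM : 0 ≤ M := (abs_nonneg _).trans (ha 0)
  calc meanForm a n γ ≤ ∑ i ∈ Finset.Icc 1 n, ∑ j ∈ Finset.Icc 1 n, M * |γ ((j : ℤ) - i)| := by
        refine Finset.sum_le_sum fun _ _ => Finset.sum_le_sum fun _ _ => (le_abs_self _).trans ?_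
        rw [abs_mul]
        exact mul_le_mul_of_nonneg_right (ha _) (abs_nonneg _)
    _ ≤ ∑ _i ∈ Finset.Icc 1 n, M * ∑' k, |γ k| := by
        simp_rw [← Finset.mul_sum]
        gcongr
        exact sum_Icc_abs_le_tsum hγ n _
    _ = M * n * ∑' k, |γ k| := by
        rw [Finset.sum_const, Nat.card_Icc, nsmul_eq_mul, Nat.add_sub_cancel]
        ring

variable {Ω : Type*} [mΩ : MeasurableSpace Ω] {μ : Measure Ω} {T : Ω ≃ᵐ Ω}

lemma integrable_quadForm {u : ℕ → Ω → ℝ} {n : ℕ} (hu : ∀ i ∈ Finset.Icc 1 n, MemLp (u i) 2 μ)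
    (a : ℤ → ℝ) : Integrable (fun ω => quadForm a n (fun i => u i ω)) μ :=
  integrable_finsetSum _ fun i hi => integrable_finsetSum _ fun j hj =>
    ((hu i hi).integrable_mul (hu j hj)).const_mul _

lemma integrable_quadForm_process (hT : MeasurePreserving T μ μ) {Z : Ω → ℝ} (hZ : MemLp Z 2 μ)
    (a : ℤ → ℝ) (n : ℕ) :
    Integrable (fun ω => quadForm a n (fun i => process T.toEquiv Z i ω)) μ :=
  integrable_quadForm (fun i _ => memLp_process hT hZ i) a

lemma integral_quadForm_process (hT : MeasurePreserving T μ μ) {Z : Ω → ℝ} (hZ : MemLp Z 2 μ)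
    (a : ℤ → ℝ) (n : ℕ) :
    ∫ ω, quadForm a n (fun i => process T.toEquiv Z i ω) ∂μ =
      meanForm a n (acov T.toEquiv μ Z) := by
  have hint : ∀ i j : ℕ, Integrable (fun ω => a ((j : ℤ) - i) * (process T.toEquiv Z i ω *
      process T.toEquiv Z j ω)) μ := fun i j =>
    ((memLp_process hT hZ i).integrable_mul (memLp_process hT hZ j)).const_mul _
  unfold quadForm meanForm
  rw [integral_finsetSum _ fun i _ => integrable_finsetSum _ fun j _ => hint i j]
  refine Finset.sum_congr rfl fun i _ => ?_
  rw [integral_finsetSum _ fun j _ => hint i j]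
  refine Finset.sum_congr rfl fun j _ => ?_
  rw [integral_const_mul, integral_process_mul_self hT]

lemma integral_quadForm_dominatingWindow_le (hT : MeasurePreserving T μ μ) {Z : Ω → ℝ}
    (hZ : MemLp Z 2 μ) (hγ : Summable fun k => |acov T.toEquiv μ Z k|) (c : ℕ) (t : ℝ) (n : ℕ) :
    ∫ ω, quadForm (dominatingWindow c t) n (fun i => process T.toEquiv Z i ω) ∂μ ≤
      3 * n * ∑' k, |acov T.toEquiv μ Z k| := by
  rw [integral_quadForm_process hT hZ]
  exact meanForm_le hγ (abs_dominatingWindow_le c t) n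

lemma integral_abs_quadForm_lagWindow_sub_le {u v : ℕ → Ω → ℝ} {n : ℕ}
    (hu : ∀ i ∈ Finset.Icc 1 n, MemLp (u i) 2 μ) (hv : ∀ i ∈ Finset.Icc 1 n, MemLp (v i) 2 μ)
    {c : ℕ} (hc : 0 < c) (t : ℝ) {η : ℝ} (hη : 0 < η) :
    ∫ ω, |quadForm (lagWindow c t) n (fun i => u i ω) -
      quadForm (lagWindow c t) n (fun i => v i ω)| ∂μ ≤
      (1 + 1 / η) * ∫ ω, quadForm (dominatingWindow c t) n (fun i => u i ω - v i ω) ∂μ +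
        η * ∫ ω, quadForm (dominatingWindow c t) n (fun i => v i ω) ∂μ := by
  have hsub : Integrable (fun ω => (1 + 1 / η) *
      quadForm (dominatingWindow c t) n (fun i => u i ω - v i ω)) μ :=
    (integrable_quadForm (fun i hi => (hu i hi).sub (hv i hi)) _).const_mul _
  have hright : Integrable (fun ω => η * quadForm (dominatingWindow c t) n (fun i => v i ω)) μ :=
    (integrable_quadForm hv _).const_mul _
  rw [← integral_const_mul, ← integral_const_mul, ← integral_add hsub hright]
  exact integral_mono_of_nonneg (Eventually.of_forall fun _ => abs_nonneg _) (hsub.add hright)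
    (Eventually.of_forall fun ω => abs_quadForm_lagWindow_sub_le hc n t _ _ hη)

end MeanForm

section Approximation

lemma integral_abs_sub_const_le {Ω : Type*} [MeasurableSpace Ω] {μ : Measure Ω}
    [IsProbabilityMeasure μ] {f g : Ω → ℝ} (hf : Integrable f μ) (hg : Integrable g μ) (b : ℝ) :
    ∫ ω, |f ω - b| ∂μ ≤
      2 * ∫ ω, |g ω - f ω| ∂μ + ∫ ω, |g ω - ∫ ω', g ω' ∂μ| ∂μ + |∫ ω, f ω ∂μ - b| := by
  have hgf : Integrable (fun ω => |g ω - f ω|) μ := (hg.sub hf).abs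
  have hgm : Integrable (fun ω => |g ω - ∫ ω', g ω' ∂μ|) μ := (hg.sub (integrable_const _)).abs
  have hmeans : |∫ ω, g ω ∂μ - ∫ ω, f ω ∂μ| ≤ ∫ ω, |g ω - f ω| ∂μ := by
    rw [← integral_sub hg hf]
    exact abs_integral_le_integral_abs
  have hpoint : ∀ ω, |f ω - b| ≤ |g ω - f ω| + |g ω - ∫ ω', g ω' ∂μ| +
      (|∫ ω, g ω ∂μ - ∫ ω, f ω ∂μ| + |∫ ω, f ω ∂μ - b|) := fun ω => by
    have h₁ := abs_sub_le (f ω) (g ω) b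
    have h₂ := abs_sub_le (g ω) (∫ ω', g ω' ∂μ) b
    have h₃ := abs_sub_le (∫ ω', g ω' ∂μ) (∫ ω', f ω' ∂μ) b
    rw [abs_sub_comm (f ω) (g ω)] at h₁
    linarith
  calc ∫ ω, |f ω - b| ∂μ
      ≤ ∫ ω, (|g ω - f ω| + |g ω - ∫ ω', g ω' ∂μ| +
          (|∫ ω, g ω ∂μ - ∫ ω, f ω ∂μ| + |∫ ω, f ω ∂μ - b|)) ∂μ :=
        integral_mono_of_nonneg (Eventually.of_forall fun _ => abs_nonneg _)
          ((hgf.add hgm).add (integrable_const _)) (Eventually.of_forall hpoint)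
    _ = ∫ ω, |g ω - f ω| ∂μ + ∫ ω, |g ω - ∫ ω', g ω' ∂μ| ∂μ +
          (|∫ ω, g ω ∂μ - ∫ ω, f ω ∂μ| + |∫ ω, f ω ∂μ - b|) := by
        have hsum : Integrable (fun ω => |g ω - f ω| + |g ω - ∫ ω', g ω' ∂μ|) μ := hgf.add hgm
        rw [integral_add hsum (integrable_const _), integral_add hgf hgm, integral_const,
          probReal_univ, one_smul]
    _ ≤ _ := by linarith

variable {Ω : Type*} {F₀ : MeasurableSpace Ω} [mΩ : MeasurableSpace Ω]
  {μ : Measure Ω} {T : Ω ≃ᵐ Ω}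

lemma isInnovation_zero : IsInnovation F₀ T.toEquiv μ 0 where
  measurable := stronglyMeasurable_zero
  memLp := MemLp.zero
  condExp := by rw [condExp_zero]

lemma eLpNorm_proj_le (F : ℤ → MeasurableSpace Ω) (j : ℤ) (Z : Ω → ℝ) :
    eLpNorm (proj F μ j Z) 2 μ ≤ eLpNorm Z 2 μ + eLpNorm Z 2 μ :=
  (eLpNorm_sub_le integrable_condExp.aestronglyMeasurable integrable_condExp.aestronglyMeasurable
    one_le_two).trans (add_le_add (eLpNorm_condExp_le_eLpNorm _ one_le_two)
      (eLpNorm_condExp_le_eLpNorm _ one_le_two))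

namespace IsInnovation

variable [IsFiniteMeasure μ] {D E : Ω → ℝ}

lemma sub (hD : IsInnovation F₀ T.toEquiv μ D) (hE : IsInnovation F₀ T.toEquiv μ E) :
    IsInnovation F₀ T.toEquiv μ (D - E) where
  measurable := hD.measurable.sub hE.measurable
  memLp := hD.memLp.sub hE.memLp
  condExp := by
    refine (condExp_sub (hD.memLp.integrable one_le_two) (hE.memLp.integrable one_le_two) _).trans
      ?_
    filter_upwards [hD.condExp, hE.condExp] with ω hDω hEω
    rw [Pi.sub_apply, hDω, hEω, sub_self, Pi.zero_apply]

lemma proj_ae_eq (hT : MeasurePreserving T μ μ) (hF₀ : F₀ ≤ mΩ)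
    (hD : IsInnovation F₀ T.toEquiv μ D) : proj (filt F₀ T.toEquiv) μ 0 D =ᵐ[μ] D := by
  have hpresent : μ[D | filt F₀ T.toEquiv 0] = D := by
    refine condExp_of_stronglyMeasurable (filt_le hT hF₀ 0) ?_ (hD.memLp.integrable one_le_two)
    rw [filt_zero]
    exact hD.measurable
  filter_upwards [hD.condExp] with ω hpast
  rw [proj, Pi.sub_apply, hpresent, zero_sub, hpast, Pi.zero_apply, sub_zero]

/-- Truncating `D` destroys the martingale difference property; projecting the truncation on the
innovations restores it, and stays close to `D`, which is its own projection. -/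
lemma exists_bounded (hT : MeasurePreserving T μ μ) (hF₀ : F₀ ≤ mΩ) (hmono : F₀ ≤ F₀.comap T)
    (hD : IsInnovation F₀ T.toEquiv μ D) {δ : ENNReal} (hδ : δ ≠ 0) :
    ∃ E, IsInnovation F₀ T.toEquiv μ E ∧ MemLp E ⊤ μ ∧ eLpNorm (E - D) 2 μ ≤ δ := by
  obtain ⟨g, hDg, hg, hg_top⟩ : ∃ g : Ω → ℝ, eLpNorm (D - g) 2 μ < δ / 2 ∧ MemLp g 2 μ ∧
      MemLp g ⊤ μ := by
    obtain ⟨s, hDs, hs⟩ := hD.memLp.exists_simpleFunc_eLpNorm_sub_lt ENNReal.ofNat_ne_top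
      (ENNReal.half_pos hδ).ne'
    exact ⟨s, hDs, hs, s.memLp_top μ⟩
  refine ⟨proj (filt F₀ T.toEquiv) μ 0 g, isInnovation_proj hT hF₀ hmono hg,
    (hg_top.condExp le_top).sub (hg_top.condExp le_top), ?_⟩
  have hproj : proj (filt F₀ T.toEquiv) μ 0 g - D =ᵐ[μ]
      proj (filt F₀ T.toEquiv) μ 0 (g - D) := by
    have hsub := fun i => condExp_sub (hg.integrable one_le_two) (hD.memLp.integrable one_le_two)
      (filt F₀ T.toEquiv i)
    filter_upwards [hsub 0, hsub (0 - 1), hD.proj_ae_eq hT hF₀] with ω h₀ h₁ hω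
    simp only [proj, Pi.sub_apply] at hω h₀ h₁ ⊢
    rw [h₀, h₁]
    linear_combination hω
  rw [eLpNorm_sub_comm] at hDg
  calc eLpNorm (proj (filt F₀ T.toEquiv) μ 0 g - D) 2 μ
      = eLpNorm (proj (filt F₀ T.toEquiv) μ 0 (g - D)) 2 μ := eLpNorm_congr_ae hproj
    _ ≤ eLpNorm (g - D) 2 μ + eLpNorm (g - D) 2 μ := eLpNorm_proj_le _ _ _
    _ ≤ δ / 2 + δ / 2 := add_le_add hDg.le hDg.le
    _ = δ := ENNReal.add_halves δ

end IsInnovation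

lemma exists_bounded_tsum_eLpNorm_sub_le [IsFiniteMeasure μ] (hT : MeasurePreserving T μ μ)
    (hF₀ : F₀ ≤ mΩ) (hmono : F₀ ≤ F₀.comap T) {D : ℤ → Ω → ℝ}
    (hD : ∀ l, IsInnovation F₀ T.toEquiv μ (D l))
    (hsum : Summable fun l => (eLpNorm (D l) 2 μ).toReal) {δ : ℝ} (hδ : 0 < δ) :
    ∃ (E : ℤ → Ω → ℝ) (A : Finset ℤ), (∀ l, IsInnovation F₀ T.toEquiv μ (E l)) ∧
      (∀ l, MemLp (E l) ⊤ μ) ∧ (∀ l ∉ A, E l = 0) ∧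
      ∑' l, (eLpNorm (E l - D l) 2 μ).toReal ≤ δ := by
  obtain ⟨A, hA⟩ := ((tendsto_tsum_compl_atTop_zero
    (fun l => (eLpNorm (D l) 2 μ).toReal)).eventually_lt_const (half_pos hδ)).exists
  have hr : 0 < δ / 2 / (A.card + 1) := by positivity
  choose E₀ hE₀ hE₀_top hE₀D using fun l => (hD l).exists_bounded hT hF₀ hmono
    (ENNReal.ofReal_pos.2 hr).ne'
  set E : ℤ → Ω → ℝ := fun l => if l ∈ A then E₀ l else 0
  have hE : ∀ l ∉ A, E l = 0 := fun l hl => if_neg hl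
  have hin : ∀ l ∈ A, (eLpNorm (E l - D l) 2 μ).toReal ≤ δ / 2 / (A.card + 1) := fun l hl =>
    ENNReal.toReal_le_of_le_ofReal hr.le (by simpa only [E, if_pos hl] using hE₀D l)
  have hout : ∀ l ∉ A, (eLpNorm (E l - D l) 2 μ).toReal = (eLpNorm (D l) 2 μ).toReal :=
    fun l hl => by rw [hE l hl, zero_sub, eLpNorm_neg]
  refine ⟨E, A, fun l => ?_, fun l => ?_, hE, ?_⟩
  · simp only [E]
    split_ifs
    exacts [hE₀ l, isInnovation_zero]
  · simp only [E]
    split_ifs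
    exacts [hE₀_top l, MemLp.zero]
  · have hsumE : Summable fun l => (eLpNorm (E l - D l) 2 μ).toReal :=
      A.summable_compl_iff.1 ((A.summable_compl_iff.2 hsum).congr fun l => (hout l l.2).symm)
    rw [← hsumE.sum_add_tsum_subtype_compl A, tsum_congr fun l : {l // l ∉ A} => hout l l.2,
      ← add_halves δ]
    refine add_le_add ((Finset.sum_le_card_nsmul _ _ _ hin).trans ?_) hA.le
    rw [nsmul_eq_mul, mul_div_assoc', div_le_iff₀ (by positivity)]
    linarith

lemma isMovingAverage_sum [IsFiniteMeasure μ] (hT : MeasurePreserving T μ μ) {D : ℤ → Ω → ℝ}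
    (hD : ∀ l, IsInnovation F₀ T.toEquiv μ (D l)) {A : Finset ℤ} (hA : ∀ l ∉ A, D l = 0) :
    IsMovingAverage F₀ hT D (∑ l ∈ A, process T.toEquiv (D l) l) where
  isInnovation := hD
  memLp := memLp_finsetSum' _ fun l _ => memLp_process hT (hD l).memLp l
  summable := summable_of_ne_finset_zero (s := A) fun l hl => by
    rw [hA l hl, eLpNorm_zero, ENNReal.toReal_zero]
  hasSum := by
    have hsum : (memLp_finsetSum' A fun l _ => memLp_process hT (hD l).memLp l).toLp
        (∑ l ∈ A, process T.toEquiv (D l) l) =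
          ∑ l ∈ A, koopman hT l ((hD l).memLp.toLp (D l)) := by
      have hterm : ∀ l ∈ A, ∀ᵐ ω ∂μ, koopman hT l ((hD l).memLp.toLp (D l)) ω =
          process T.toEquiv (D l) l ω := fun l _ => by
        rw [koopman_toLp]
        exact MemLp.coeFn_toLp _
      refine Lp.ext ((MemLp.coeFn_toLp _).trans (EventuallyEq.trans ?_
        (Lp.coeFn_finsetSum _ _).symm))
      filter_upwards [(Finset.eventually_all _).2 hterm] with ω hω
      rw [Finset.sum_apply, Finset.sum_apply]
      exact (Finset.sum_congr rfl hω).symm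
    rw [hsum]
    refine hasSum_sum_of_ne_finset_zero fun l hl => ?_
    have hzero : (hD l).memLp.toLp (D l) = 0 := by
      rw [← norm_eq_zero, Lp.norm_toLp, hA l hl, eLpNorm_zero, ENNReal.toReal_zero]
    rw [hzero, map_zero]

lemma IsMovingAverage.sub [IsFiniteMeasure μ] {hT : MeasurePreserving T μ μ} {D E : ℤ → Ω → ℝ}
    {Z W : Ω → ℝ} (hZ : IsMovingAverage F₀ hT D Z) (hW : IsMovingAverage F₀ hT E W) :
    IsMovingAverage F₀ hT (D - E) (Z - W) where
  isInnovation l := (hZ.isInnovation l).sub (hW.isInnovation l)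
  memLp := hZ.memLp.sub hW.memLp
  summable := by
    refine .of_nonneg_of_le (fun _ => ENNReal.toReal_nonneg) (fun l => ?_)
      (hZ.summable.add hW.summable)
    have hDl := (hZ.isInnovation l).memLp
    have hEl := (hW.isInnovation l).memLp
    rw [← ENNReal.toReal_add hDl.eLpNorm_ne_top hEl.eLpNorm_ne_top]
    exact ENNReal.toReal_mono (ENNReal.add_ne_top.2 ⟨hDl.eLpNorm_ne_top, hEl.eLpNorm_ne_top⟩)
      (eLpNorm_sub_le hDl.1 hEl.1 one_le_two)
  hasSum := by
    rw [MemLp.toLp_sub hZ.memLp hW.memLp]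
    refine (hZ.hasSum.sub hW.hasSum).congr_fun fun l => ?_
    rw [← map_sub]
    rfl

namespace IsMovingAverage

variable {hT : MeasurePreserving T μ μ} {D : ℤ → Ω → ℝ} {Z : Ω → ℝ}

lemma exists_bounded_approximation [IsFiniteMeasure μ] (h : IsMovingAverage F₀ hT D Z)
    (hF₀ : F₀ ≤ mΩ) (hmono : F₀ ≤ F₀.comap T) {θ : ℝ} (hθ : 0 < θ) :
    ∃ (E : ℤ → Ω → ℝ) (A : Finset ℤ), (∀ l, IsInnovation F₀ T.toEquiv μ (E l)) ∧
      (∀ l, MemLp (E l) ⊤ μ) ∧ ∀ (c n : ℕ) (t : ℝ), 0 < c →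
        ∫ ω, |quadForm (lagWindow c t) n
            (fun i => process T.toEquiv (∑ l ∈ A, process T.toEquiv (E l) l) i ω) -
          quadForm (lagWindow c t) n (fun i => process T.toEquiv Z i ω)| ∂μ ≤ θ * n := by
  set Γ := ∑' k, |acov T.toEquiv μ Z k|
  have hΓ : 0 ≤ Γ := tsum_nonneg fun _ => abs_nonneg _
  set η := θ / (6 * (Γ + 1))
  have hη : 0 < η := by positivity
  set δ := θ / (6 * (1 + 1 / η))
  obtain ⟨E, A, hE, hE_top, hEA, hED⟩ := exists_bounded_tsum_eLpNorm_sub_le hT hF₀ hmono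
    h.isInnovation h.summable (δ := √δ) (by positivity)
  refine ⟨E, A, hE, hE_top, fun c n t hc => ?_⟩
  have hW := isMovingAverage_sum hT hE hEA
  set W := ∑ l ∈ A, process T.toEquiv (E l) l
  have hWZ : ∑' k, |acov T.toEquiv μ (W - Z) k| ≤ δ := by
    calc ∑' k, |acov T.toEquiv μ (W - Z) k|
        ≤ (∑' l, (eLpNorm (E l - D l) 2 μ).toReal) ^ 2 := (hW.sub h).tsum_abs_acov_le hF₀ hmono
      _ ≤ √δ ^ 2 := by gcongr
      _ = δ := Real.sq_sqrt (by positivity)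
  have hηδ : (1 + 1 / η) * δ = θ / 6 := by
    simp only [δ]
    field_simp
  have hηΓ : η * Γ ≤ θ / 6 := by
    rw [div_mul_eq_mul_div, div_le_div_iff₀ (by positivity) (by positivity)]
    nlinarith only [hθ, hΓ]
  calc ∫ ω, |quadForm (lagWindow c t) n (fun i => process T.toEquiv W i ω) -
        quadForm (lagWindow c t) n (fun i => process T.toEquiv Z i ω)| ∂μ
      ≤ (1 + 1 / η) * ∫ ω, quadForm (dominatingWindow c t) n
            (fun i => process T.toEquiv (W - Z) i ω) ∂μ +
          η * ∫ ω, quadForm (dominatingWindow c t) n (fun i => process T.toEquiv Z i ω) ∂μ :=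
        integral_abs_quadForm_lagWindow_sub_le (fun i _ => memLp_process hT hW.memLp i)
          (fun i _ => memLp_process hT h.memLp i) hc t hη
    _ ≤ (1 + 1 / η) * (3 * n * δ) + η * (3 * n * Γ) := by
        gcongr
        · exact (integral_quadForm_dominatingWindow_le hT (hW.memLp.sub h.memLp)
            ((hW.sub h).summable_acov hF₀ hmono) c t n).trans (by gcongr)
        · exact integral_quadForm_dominatingWindow_le hT h.memLp (h.summable_acov hF₀ hmono) c t n
    _ = 3 * n * ((1 + 1 / η) * δ + η * Γ) := by ring
    _ ≤ 3 * n * (θ / 6 + θ / 6) := by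
        gcongr
        exact hηδ.le
    _ = θ * n := by ring

lemma eventually_integral_abs_quadForm_le [IsProbabilityMeasure μ]
    (h : IsMovingAverage F₀ hT D Z) (hF₀ : F₀ ≤ mΩ) (hmono : F₀ ≤ F₀.comap T)
    (htail : ∀ s : Set Ω, MeasurableSet[⨅ i : ℤ, filt F₀ T.toEquiv i] s → μ s = 0 ∨ μ s = 1)
    {c : ℕ → ℕ} (hc : Tendsto c atTop atTop)
    (hcn : Tendsto (fun n => (c n : ℝ) / n) atTop (𝓝 0)) {θ : ℝ} (hθ : 0 < θ) :
    ∀ᶠ n : ℕ in atTop, ∀ t : ℝ,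
      ∫ ω, |quadForm (lagWindow (c n) t) n (fun i => process T.toEquiv Z i ω) -
        2 * π * n * densityOf (acov T.toEquiv μ Z) t| ∂μ ≤ θ * n := by
  have hγ := h.summable_acov hF₀ hmono
  obtain ⟨E, A, hE, hE_top, happrox⟩ := h.exists_bounded_approximation hF₀ hmono
    (θ := θ / 4) (by positivity)
  have hW : MemLp (∑ l ∈ A, process T.toEquiv (E l) l) 2 μ :=
    memLp_finsetSum' _ fun l _ => memLp_process hT (hE l).memLp l
  filter_upwards [eventually_integral_abs_quadForm_sub_le hT hF₀ hmono htail hE hE_top A hcn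
      (θ := θ / 4) (by positivity),
    (tendsto_tsum_abs_damping_sub_one hγ hc).eventually_lt_const (show 0 < θ / 4 by positivity),
    eventually_gt_atTop 0, hc.eventually_gt_atTop 0] with n hconc hdamp hn hcpos t
  have hWconc := hconc (lagWindow (c n) t) (abs_lagWindow_le_one _ _)
    fun k hk => lagWindow_eq_zero hcpos t hk
  have hbias : |meanForm (lagWindow (c n) t) n (acov T.toEquiv μ Z) -
      2 * π * n * densityOf (acov T.toEquiv μ Z) t| ≤ θ / 4 * n :=
    (abs_meanForm_sub_le hγ hn (c n) t).trans (by rw [mul_comm]; gcongr)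
  rw [← integral_quadForm_process hT hW] at hWconc
  rw [← integral_quadForm_process hT h.memLp] at hbias
  refine (integral_abs_sub_const_le (integrable_quadForm_process hT h.memLp (lagWindow (c n) t) n)
    (integrable_quadForm_process hT hW (lagWindow (c n) t) n) _).trans ?_
  linarith [happrox (c n) n t hcpos]

end IsMovingAverage

end Approximation

/-! ### Residuals -/

section Projection

open Matrix

variable {ι : Type*} [Fintype ι] {M : Matrix ι ι ℝ}

lemma diag_nonneg_of_transpose_mul_self_eq (hM : Mᵀ * M = M) (k : ι) : 0 ≤ M k k := by
  rw [← hM, Matrix.mul_apply]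
  exact Finset.sum_nonneg fun a _ => mul_self_nonneg (M a k)

lemma abs_apply_le_of_transpose_mul_self_eq (hM : Mᵀ * M = M) (k l : ι) :
    |M k l| ≤ (M k k + M l l) / 2 := by
  have hentry : ∀ i j, M i j = ∑ a, M a i * M a j := fun i j => by
    conv_lhs => rw [← hM, Matrix.mul_apply]
    rfl
  rw [hentry k l, hentry k k, hentry l l, ← Finset.sum_add_distrib, Finset.sum_div]
  refine (Finset.abs_sum_le_sum_abs _ _).trans (Finset.sum_le_sum fun a _ => ?_)
  rw [abs_mul]
  linarith [two_mul_le_add_sq |M a k| |M a l|, sq_abs (M a k), sq_abs (M a l), sq (M a k),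
    sq (M a l)]

lemma sum_sq_mulVec_of_transpose_mul_self_eq (hM : Mᵀ * M = M) (e : ι → ℝ) :
    ∑ a, (M *ᵥ e) a ^ 2 = ∑ k, ∑ l, M k l * (e k * e l) := by
  calc ∑ a, (M *ᵥ e) a ^ 2 = (M *ᵥ e) ⬝ᵥ (M *ᵥ e) := Finset.sum_congr rfl fun _ _ => sq _
    _ = e ⬝ᵥ (M *ᵥ e) := by
        rw [dotProduct_mulVec, vecMul_mulVec, hM, ← dotProduct_mulVec]
    _ = ∑ k, ∑ l, M k l * (e k * e l) := by
        simp only [dotProduct, mulVec, Finset.mul_sum]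
        exact Finset.sum_congr rfl fun _ _ => Finset.sum_congr rfl fun _ _ => by ring

lemma sum_mul_le_trace_mul (hM : Mᵀ * M = M) {B : Matrix ι ι ℝ} (hB : Bᵀ = B) {Γ : ℝ}
    (hrow : ∀ k, ∑ l, |B k l| ≤ Γ) : ∑ k, ∑ l, M k l * B k l ≤ M.trace * Γ := by
  have hBsymm : ∀ k l, B l k = B k l := fun k l => congrFun₂ hB k l
  calc ∑ k, ∑ l, M k l * B k l
      ≤ ∑ k, ∑ l, (M k k / 2 * |B k l| + M l l / 2 * |B l k|) := by
        refine Finset.sum_le_sum fun k _ => Finset.sum_le_sum fun l _ => (le_abs_self _).trans ?_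
        rw [abs_mul, hBsymm, ← add_mul, ← add_div]
        exact mul_le_mul_of_nonneg_right (abs_apply_le_of_transpose_mul_self_eq hM k l)
          (abs_nonneg _)
    _ = ∑ k, M k k * ∑ l, |B k l| := by
        simp_rw [Finset.sum_add_distrib]
        rw [Finset.sum_comm (f := fun k l => M l l / 2 * |B l k|), ← Finset.sum_add_distrib]
        refine Finset.sum_congr rfl fun k _ => ?_
        rw [← Finset.mul_sum]
        ring
    _ ≤ ∑ k, M k k * Γ := Finset.sum_le_sum fun k _ =>
        mul_le_mul_of_nonneg_left (hrow k) (diag_nonneg_of_transpose_mul_self_eq hM k)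
    _ = M.trace * Γ := (Finset.sum_mul _ _ _).symm

lemma integral_sum_sq_mulVec_le {Ω : Type*} [MeasurableSpace Ω] {μ : Measure Ω}
    (hM : Mᵀ * M = M) {e : ι → Ω → ℝ} (he : ∀ k, MemLp (e k) 2 μ) {Γ : ℝ}
    (hrow : ∀ k, ∑ l, |∫ ω, e k ω * e l ω ∂μ| ≤ Γ) :
    ∫ ω, ∑ a, (M *ᵥ fun b => e b ω) a ^ 2 ∂μ ≤ M.trace * Γ := by
  have hint : ∀ k l, Integrable (fun ω => M k l * (e k ω * e l ω)) μ := fun k l =>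
    ((he k).integrable_mul (he l)).const_mul _
  have hsymm : (Matrix.of fun k l => ∫ ω, e k ω * e l ω ∂μ)ᵀ =
      Matrix.of fun k l => ∫ ω, e k ω * e l ω ∂μ := by
    ext k l
    simp only [Matrix.transpose_apply, Matrix.of_apply, mul_comm]
  simp_rw [sum_sq_mulVec_of_transpose_mul_self_eq hM]
  rw [integral_finsetSum _ fun k _ => integrable_finsetSum _ fun l _ => hint k l]
  simp_rw [integral_finsetSum _ fun l _ => hint _ l, integral_const_mul]
  exact sum_mul_le_trace_mul hM hsymm hrow

end Projection

section Residuals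

open Matrix

variable {p : ℕ} {x : ℕ → Fin p → ℝ}

lemma sum_Icc_one_eq_sum_fin {M : Type*} [AddCommMonoid M] (n : ℕ) (f : ℕ → M) :
    ∑ i ∈ Finset.Icc 1 n, f i = ∑ a : Fin n, f (a.val + 1) := by
  rw [← Finset.sum_range fun i => f (i + 1), Finset.range_eq_Ico, Finset.sum_Ico_add' f 0 n 1]
  rfl

lemma gram_apply (x : ℕ → Fin p → ℝ) (n : ℕ) (j l : Fin p) :
    ((designMatrix x n)ᵀ * designMatrix x n) j l = ∑ m ∈ Finset.Icc 1 n, x m j * x m l := by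
  rw [sum_Icc_one_eq_sum_fin, Matrix.mul_apply]
  rfl

lemma eventually_isUnit_det_gram {R : Matrix (Fin p) (Fin p) ℝ} (hR : R.PosDef)
    (hlim : ∀ j l, Tendsto
      (fun n : ℕ => ∑ m ∈ Finset.Icc 1 n, x m j * x m l / (colNorm x j n * colNorm x l n))
      atTop (𝓝 (R j l))) :
    ∀ᶠ n in atTop, IsUnit ((designMatrix x n)ᵀ * designMatrix x n).det := by
  set S : ℕ → Matrix (Fin p) (Fin p) ℝ := fun n => diagonal fun j => (colNorm x j n)⁻¹
  have hnormalized : Tendsto (fun n => S n * ((designMatrix x n)ᵀ * designMatrix x n) * S n)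
      atTop (𝓝 R) := by
    refine tendsto_pi_nhds.2 fun j => tendsto_pi_nhds.2 fun l => (hlim j l).congr fun n => ?_
    rw [mul_diagonal, diagonal_mul, gram_apply, ← Finset.sum_div, div_eq_mul_inv, mul_inv]
    ring
  have hdet := ((Continuous.matrix_det continuous_id).tendsto R).comp hnormalized
  filter_upwards [hdet.eventually_const_lt hR.det_pos] with n hn
  refine isUnit_iff_ne_zero.2 fun hsing => hn.ne' ?_
  rw [Function.comp_apply, id, det_mul, det_mul, hsing, mul_zero, zero_mul]

/-- The hat matrix `X (XᵗX)⁻¹ Xᵗ` of the regression on the first `n` observations. It is the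
orthogonal projection on the column space of `X` when `XᵗX` is invertible. -/
def hatMatrix (x : ℕ → Fin p → ℝ) (n : ℕ) : Matrix (Fin n) (Fin n) ℝ :=
  designMatrix x n * ((designMatrix x n)ᵀ * designMatrix x n)⁻¹ * (designMatrix x n)ᵀ

variable {n : ℕ} (hn : IsUnit ((designMatrix x n)ᵀ * designMatrix x n).det)
include hn

lemma hatMatrix_transpose_mul_self : (hatMatrix x n)ᵀ * hatMatrix x n = hatMatrix x n := by
  set X := designMatrix x n
  have hsymm : (hatMatrix x n)ᵀ = hatMatrix x n := by
    simp only [hatMatrix, transpose_mul, transpose_transpose, transpose_nonsing_inv,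
      Matrix.mul_assoc]
  calc (hatMatrix x n)ᵀ * hatMatrix x n
      = X * ((Xᵀ * X)⁻¹ * (Xᵀ * X)) * (Xᵀ * X)⁻¹ * Xᵀ := by
        rw [hsymm]
        simp only [hatMatrix, X, Matrix.mul_assoc]
    _ = hatMatrix x n := by
        rw [nonsing_inv_mul _ hn, Matrix.mul_one]
        rfl

lemma trace_hatMatrix : (hatMatrix x n).trace = p := by
  rw [hatMatrix, Matrix.mul_assoc, trace_mul_comm, Matrix.mul_assoc, nonsing_inv_mul _ hn,
    trace_one, Fintype.card_fin]

variable {Ω : Type*} (β : Fin p → ℝ)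

lemma leastSquares_response (ε : ℤ → Ω → ℝ) (ω : Ω) :
    leastSquares x (response x β ε) n ω =
      β + (((designMatrix x n)ᵀ * designMatrix x n)⁻¹ * (designMatrix x n)ᵀ) *ᵥ
        fun b : Fin n => ε (b.val + 1 : ℕ) ω := by
  set X := designMatrix x n
  have hresponse : (fun i : Fin n => response x β ε (i.val + 1) ω) =
      X *ᵥ β + fun b : Fin n => ε (b.val + 1 : ℕ) ω := rfl
  rw [leastSquares, hresponse, mulVec_add, mulVec_mulVec, Matrix.mul_assoc,
    nonsing_inv_mul _ hn, one_mulVec]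

lemma residual_eq (ε : ℤ → Ω → ℝ) (a : Fin n) (ω : Ω) :
    residual x (response x β ε) n (a.val + 1) ω =
      ε (a.val + 1 : ℕ) ω - (hatMatrix x n *ᵥ fun b : Fin n => ε (b.val + 1 : ℕ) ω) a := by
  have hrow : ∀ v : Fin p → ℝ, ∑ j, x (a.val + 1) j * v j = (designMatrix x n *ᵥ v) a :=
    fun _ => rfl
  rw [residual, response, hrow, hrow, leastSquares_response hn, mulVec_add, Pi.add_apply,
    mulVec_mulVec, hatMatrix, Matrix.mul_assoc]
  ring

lemma exists_residual_eq (ε : ℤ → Ω → ℝ) {i : ℕ} (hi : i ∈ Finset.Icc 1 n) :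
    ∃ w : Fin n → ℝ, ∀ ω,
      residual x (response x β ε) n i ω = ε i ω - ∑ b, w b * ε (b.val + 1 : ℕ) ω := by
  rw [Finset.mem_Icc] at hi
  obtain ⟨a, rfl⟩ : ∃ a : Fin n, i = a.val + 1 := ⟨⟨i - 1, by lia⟩, by simp only; lia⟩
  exact ⟨hatMatrix x n a, residual_eq hn β ε a⟩

lemma residual_eq_zero {ε : ℤ → Ω → ℝ} {ω : Ω} (hω : ∀ i, ε i ω = 0) {i : ℕ}
    (hi : i ∈ Finset.Icc 1 n) : residual x (response x β ε) n i ω = 0 := by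
  obtain ⟨w, hw⟩ := exists_residual_eq hn β ε hi
  simp only [hw, hω, mul_zero, Finset.sum_const_zero, sub_zero]

variable [MeasurableSpace Ω] {μ : Measure Ω} {ε : ℤ → Ω → ℝ} (hε : ∀ i, MemLp (ε i) 2 μ)
include hε

lemma memLp_residual {i : ℕ} (hi : i ∈ Finset.Icc 1 n) :
    MemLp (residual x (response x β ε) n i) 2 μ := by
  obtain ⟨w, hw⟩ := exists_residual_eq hn β ε hi
  rw [funext hw]
  exact (hε _).sub (memLp_finsetSum Finset.univ fun b _ => (hε _).const_mul (w b))

lemma integral_sum_sq_residual_sub_le {Γ : ℝ}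
    (hΓ : ∀ k : ℕ, ∑ l ∈ Finset.Icc 1 n, |∫ ω, ε k ω * ε l ω ∂μ| ≤ Γ) :
    ∫ ω, ∑ i ∈ Finset.Icc 1 n, (residual x (response x β ε) n i ω - ε i ω) ^ 2 ∂μ ≤ p * Γ := by
  have hsum : ∀ ω, ∑ i ∈ Finset.Icc 1 n, (residual x (response x β ε) n i ω - ε i ω) ^ 2 =
      ∑ a, (hatMatrix x n *ᵥ fun b : Fin n => ε (b.val + 1 : ℕ) ω) a ^ 2 := fun ω => by
    rw [sum_Icc_one_eq_sum_fin]
    refine Finset.sum_congr rfl fun a _ => ?_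
    rw [residual_eq hn β]
    ring
  simp_rw [hsum]
  rw [← trace_hatMatrix hn]
  refine integral_sum_sq_mulVec_le (hatMatrix_transpose_mul_self hn) (fun _ => hε _) fun k => ?_
  rw [← sum_Icc_one_eq_sum_fin n fun l => |∫ ω, ε (k.val + 1 : ℕ) ω * ε l ω ∂μ|]
  exact hΓ _

lemma integral_abs_quadForm_residual_sub_le {Γ : ℝ}
    (hΓ : ∀ k : ℕ, ∑ l ∈ Finset.Icc 1 n, |∫ ω, ε k ω * ε l ω ∂μ| ≤ Γ)
    {c : ℕ} (hc : 0 < c) (t : ℝ) {η : ℝ} (hη : 0 < η) :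
    ∫ ω, |quadForm (lagWindow c t) n (fun i => residual x (response x β ε) n i ω) -
        quadForm (lagWindow c t) n (fun i => ε i ω)| ∂μ ≤
      (1 + 1 / η) * (12 * c * (p * Γ)) +
        η * ∫ ω, quadForm (dominatingWindow c t) n (fun i => ε i ω) ∂μ := by
  have hres := fun i (hi : i ∈ Finset.Icc 1 n) => memLp_residual hn β hε hi
  refine (integral_abs_quadForm_lagWindow_sub_le hres (fun i _ => hε i) hc t hη).trans ?_
  gcongr
  calc ∫ ω, quadForm (dominatingWindow c t) n
        (fun i => residual x (response x β ε) n i ω - ε i ω) ∂μ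
      ≤ ∫ ω, 12 * c * ∑ i ∈ Finset.Icc 1 n,
          (residual x (response x β ε) n i ω - ε i ω) ^ 2 ∂μ :=
        integral_mono (integrable_quadForm (fun i hi => (hres i hi).sub (hε i)) _)
          ((integrable_finsetSum _ fun i hi => ((hres i hi).sub (hε i)).integrable_sq).const_mul _)
          fun ω => quadForm_dominatingWindow_le hc t n _
    _ ≤ 12 * c * (p * Γ) := by
        rw [integral_const_mul]
        gcongr
        exact integral_sum_sq_residual_sub_le hn β hε hΓ

end Residuals

lemma eventually_integral_abs_quadForm_residual_sub_le {Ω : Type*} [MeasurableSpace Ω]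
    {μ : Measure Ω} {T : Ω ≃ᵐ Ω} (hT : MeasurePreserving T μ μ) {Z : Ω → ℝ} (hZ : MemLp Z 2 μ)
    (hγ : Summable fun k => |acov T.toEquiv μ Z k|) {p : ℕ} {x : ℕ → Fin p → ℝ} (β : Fin p → ℝ)
    (hdet : ∀ᶠ n in atTop, IsUnit ((designMatrix x n).transpose * designMatrix x n).det)
    {c : ℕ → ℕ} (hc : Tendsto c atTop atTop)
    (hcn : Tendsto (fun n => (c n : ℝ) / n) atTop (𝓝 0)) {θ : ℝ} (hθ : 0 < θ) :
    ∀ᶠ n : ℕ in atTop, ∀ t : ℝ,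
      ∫ ω, |quadForm (lagWindow (c n) t) n
          (fun i => residual x (response x β (process T.toEquiv Z)) n i ω) -
        quadForm (lagWindow (c n) t) n (fun i => process T.toEquiv Z i ω)| ∂μ ≤ θ * n := by
  set Γ := ∑' k, |acov T.toEquiv μ Z k|
  have hΓ : 0 ≤ Γ := tsum_nonneg fun _ => abs_nonneg _
  set η := θ / (6 * (Γ + 1))
  have hη : 0 < η := by positivity
  have hηΓ : η * Γ ≤ θ / 6 := by
    rw [div_mul_eq_mul_div, div_le_div_iff₀ (by positivity) (by positivity)]
    nlinarith only [hθ, hΓ]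
  have hlim : Tendsto (fun n => (1 + 1 / η) * (12 * (p * Γ)) * ((c n : ℝ) / n)) atTop (𝓝 0) := by
    simpa only [mul_zero] using hcn.const_mul ((1 + 1 / η) * (12 * (p * Γ)))
  have hrow : ∀ n k : ℕ, ∑ l ∈ Finset.Icc 1 n,
      |∫ ω, process T.toEquiv Z k ω * process T.toEquiv Z l ω ∂μ| ≤ Γ := fun n k => by
    simp_rw [integral_process_mul_self hT]
    exact sum_Icc_abs_le_tsum hγ n k
  filter_upwards [hdet, hlim.eventually_lt_const (show 0 < θ / 2 by positivity),
    hc.eventually_gt_atTop 0, eventually_ne_atTop 0] with n hn hsmall hcpos hnzero t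
  refine (integral_abs_quadForm_residual_sub_le hn β (memLp_process hT hZ) (hrow n) hcpos t
    hη).trans ?_
  calc (1 + 1 / η) * (12 * c n * (p * Γ)) +
        η * ∫ ω, quadForm (dominatingWindow (c n) t) n (fun i => process T.toEquiv Z i ω) ∂μ
      ≤ (1 + 1 / η) * (12 * c n * (p * Γ)) + η * (3 * n * Γ) := by
        gcongr
        exact integral_quadForm_dominatingWindow_le hT hZ hγ (c n) t n
    _ = (1 + 1 / η) * (12 * (p * Γ)) * (c n / n) * n + 3 * (η * Γ) * n := by field_simp
    _ ≤ θ / 2 * n + 3 * (θ / 6) * n := by gcongr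
    _ = θ * n := by ring

/-! ### Consistency -/

section Bandwidth

variable {Ω : Type*} [MeasurableSpace Ω] {μ : Measure Ω} {Z : Ω → ℝ}

lemma integrable_sq_mul_min (hZ : MemLp Z 2 μ) {b : ℝ} (hb : 0 ≤ b) :
    Integrable (fun ω => |Z ω| ^ 2 * min 1 (b * |Z ω| ^ 2)) μ := by
  have hsq : AEStronglyMeasurable (fun ω => |Z ω| ^ 2) μ := hZ.aestronglyMeasurable.norm.pow 2
  refine hZ.integrable_sq.mono (hsq.mul (aestronglyMeasurable_const.inf (hsq.const_mul b)))
    (Eventually.of_forall fun ω => ?_)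
  have hmin : 0 ≤ min 1 (b * |Z ω| ^ 2) := le_min zero_le_one (by positivity)
  rw [norm_mul, Real.norm_of_nonneg hmin, ← sq_abs (Z ω)]
  exact mul_le_of_le_one_right (norm_nonneg _) (min_le_left _ _)

lemma integral_sq_mul_min_pos (hZ : MemLp Z 2 μ) (hZ0 : ¬ Z =ᵐ[μ] 0) {b : ℝ} (hb : 0 < b) :
    0 < ∫ ω, |Z ω| ^ 2 * min 1 (b * |Z ω| ^ 2) ∂μ := by
  have hnonneg : ∀ ω, 0 ≤ |Z ω| ^ 2 * min 1 (b * |Z ω| ^ 2) := fun ω =>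
    mul_nonneg (sq_nonneg _) (le_min zero_le_one (by positivity))
  refine (integral_nonneg hnonneg).lt_of_ne fun hzero => hZ0 ?_
  filter_upwards [(integral_eq_zero_iff_of_nonneg hnonneg (integrable_sq_mul_min hZ hb.le)).1
    hzero.symm] with ω hω
  by_contra hne
  have hZω : 0 < |Z ω| := abs_pos.2 hne
  have hpos : 0 < |Z ω| ^ 2 * min 1 (b * |Z ω| ^ 2) :=
    mul_pos (by positivity) (lt_min one_pos (by positivity))
  exact hpos.ne' hω

lemma tendsto_bandwidth_div (hZ : MemLp Z 2 μ) (hZ0 : ¬ Z =ᵐ[μ] 0) {c : ℕ → ℕ}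
    (hc : Tendsto c atTop atTop)
    (hmoment : Tendsto
      (fun n : ℕ => (c n : ℝ) * ∫ ω, |Z ω| ^ 2 * min 1 ((c n : ℝ) / (n : ℝ) * |Z ω| ^ 2) ∂μ)
      atTop (𝓝 0)) :
    Tendsto (fun n => (c n : ℝ) / n) atTop (𝓝 0) := by
  refine tendsto_order.2 ⟨fun b hb => Eventually.of_forall fun n => hb.trans_le (by positivity),
    fun δ hδ => ?_⟩
  have hpos := integral_sq_mul_min_pos hZ hZ0 hδ
  filter_upwards [hmoment.eventually_lt_const hpos, hc.eventually_ge_atTop 1] with n hlt hcn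
  by_contra! hδn
  have hmono : ∫ ω, |Z ω| ^ 2 * min 1 (δ * |Z ω| ^ 2) ∂μ ≤
      ∫ ω, |Z ω| ^ 2 * min 1 ((c n : ℝ) / n * |Z ω| ^ 2) ∂μ :=
    integral_mono (integrable_sq_mul_min hZ hδ.le) (integrable_sq_mul_min hZ (by positivity))
      fun ω => by dsimp only; gcongr
  have hcn' : (1 : ℝ) ≤ c n := Nat.one_le_cast.2 hcn
  exact hlt.not_ge (hmono.trans (le_mul_of_one_le_left (hpos.le.trans hmono) hcn'))

end Bandwidth

section SpectralDensity

variable {Ω : Type*} [MeasurableSpace Ω] {μ : Measure Ω} {T : Ω ≃ᵐ Ω} {Z : Ω → ℝ}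

lemma covariance_process [IsProbabilityMeasure μ] (hT : MeasurePreserving T μ μ)
    (hZ : MemLp Z 2 μ) (hmean : ∫ ω, Z ω ∂μ = 0) (m k : ℤ) :
    covariance (process T.toEquiv Z m) (process T.toEquiv Z (m + k)) μ = acov T.toEquiv μ Z k := by
  rw [covariance_eq_sub (memLp_process hT hZ _) (memLp_process hT hZ _), integral_process hT,
    hmean, zero_mul, sub_zero]
  exact (integral_process_mul_self hT Z m (m + k)).trans (by rw [add_sub_cancel_left])

lemma sum_mul_acov_nonneg (hT : MeasurePreserving T μ μ) (hZ : MemLp Z 2 μ) (n : ℕ) (b : ℕ → ℝ) :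
    0 ≤ ∑ i ∈ Finset.Icc 1 n, ∑ j ∈ Finset.Icc 1 n,
      b i * b j * acov T.toEquiv μ Z ((j : ℤ) - i) := by
  have hcov : ∀ i j : ℕ, ∫ ω, b i * process T.toEquiv Z i ω * (b j * process T.toEquiv Z j ω) ∂μ =
      b i * b j * acov T.toEquiv μ Z ((j : ℤ) - i) := fun i j => by
    simp_rw [← integral_process_mul_self hT, ← integral_const_mul, mul_mul_mul_comm]
  simp_rw [← hcov]
  rw [← integral_sq_sum _ fun i _ => (memLp_process hT hZ (i : ℕ)).const_mul (b i)]
  exact integral_nonneg fun ω => sq_nonneg _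

lemma isSpectralDensity_densityOf [IsProbabilityMeasure μ] (hT : MeasurePreserving T μ μ)
    (hZ : MemLp Z 2 μ) (hmean : ∫ ω, Z ω ∂μ = 0)
    (hγ : Summable fun k => |acov T.toEquiv μ Z k|) :
    IsSpectralDensity μ (process T.toEquiv Z) (densityOf (acov T.toEquiv μ Z)) where
  nonneg _ _ := densityOf_nonneg hγ (sum_mul_acov_nonneg hT hZ) _
  integrable := (continuous_densityOf hγ).continuousOn.integrableOn_Icc
  fourier m k := by
    rw [covariance_process hT hZ hmean, integral_exp_mul_densityOf hγ (acov_neg hT Z)]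

lemma IsSpectralDensity.eqOn {ε : ℤ → Ω → ℝ} {f g : ℝ → ℝ} (hf : IsSpectralDensity μ ε f)
    (hg : IsSpectralDensity μ ε g) (hfc : ContinuousOn f (Set.Icc (-π) π))
    (hgc : ContinuousOn g (Set.Icc (-π) π)) : Set.EqOn f g (Set.Icc (-π) π) := fun _ ht =>
  Complex.ofReal_inj.1 <| eqOn_of_integral_exp_mul_eq
    (Complex.continuous_ofReal.comp_continuousOn hfc)
    (Complex.continuous_ofReal.comp_continuousOn hgc)
    (fun k => (hf.fourier 0 k).symm.trans (hg.fourier 0 k)) ht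

end SpectralDensity

section Consistency

variable {Ω : Type*} {F₀ : MeasurableSpace Ω} [mΩ : MeasurableSpace Ω]
  {μ : Measure Ω} {T : Ω ≃ᵐ Ω} {p : ℕ} {x : ℕ → Fin p → ℝ}

lemma integral_abs_quadForm_residual_sub_density_eq_zero (hT : MeasurePreserving T μ μ)
    {Z : Ω → ℝ} (hZ : Z =ᵐ[μ] 0) (β : Fin p → ℝ) {n : ℕ}
    (hn : IsUnit ((designMatrix x n).transpose * designMatrix x n).det) (a : ℤ → ℝ) (t : ℝ) :
    ∫ ω, |quadForm a n (fun i => residual x (response x β (process T.toEquiv Z)) n i ω) -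
      2 * π * n * densityOf (acov T.toEquiv μ Z) t| ∂μ = 0 := by
  have hprocess : ∀ᵐ ω ∂μ, ∀ i : ℤ, process T.toEquiv Z i ω = 0 :=
    ae_all_iff.2 fun i => ae_process hT (P := (· = 0)) hZ i
  have hacov : acov T.toEquiv μ Z = 0 := funext fun k => integral_eq_zero_of_ae <| by
    filter_upwards [hprocess] with ω hω
    rw [hω k, mul_zero, Pi.zero_apply]
  refine integral_eq_zero_of_ae ?_
  filter_upwards [hprocess] with ω hω
  have hform : quadForm a n
      (fun i => residual x (response x β (process T.toEquiv Z)) n i ω) = 0 :=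
    Finset.sum_eq_zero fun i hi => Finset.sum_eq_zero fun j _ => by
      beta_reduce
      rw [residual_eq_zero hn β hω hi, zero_mul, mul_zero]
  simp [hform, hacov, densityOf]

lemma IsMovingAverage.eventually_integral_abs_quadForm_residual_le [IsProbabilityMeasure μ]
    {hT : MeasurePreserving T μ μ} {D : ℤ → Ω → ℝ} {Z : Ω → ℝ}
    (h : IsMovingAverage F₀ hT D Z) (hF₀ : F₀ ≤ mΩ) (hmono : F₀ ≤ F₀.comap T)
    (htail : ∀ s : Set Ω, MeasurableSet[⨅ i : ℤ, filt F₀ T.toEquiv i] s → μ s = 0 ∨ μ s = 1)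
    (β : Fin p → ℝ)
    (hdet : ∀ᶠ n in atTop, IsUnit ((designMatrix x n).transpose * designMatrix x n).det)
    {c : ℕ → ℕ} (hc : Tendsto c atTop atTop)
    (hcn : Tendsto (fun n => (c n : ℝ) / n) atTop (𝓝 0)) {θ : ℝ} (hθ : 0 < θ) :
    ∀ᶠ n : ℕ in atTop, ∀ t : ℝ,
      ∫ ω, |quadForm (lagWindow (c n) t) n
          (fun i => residual x (response x β (process T.toEquiv Z)) n i ω) -
        2 * π * n * densityOf (acov T.toEquiv μ Z) t| ∂μ ≤ θ * n := by
  filter_upwards [hdet,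
    eventually_integral_abs_quadForm_residual_sub_le hT h.memLp (h.summable_acov hF₀ hmono) β
      hdet hc hcn (half_pos hθ),
    h.eventually_integral_abs_quadForm_le hF₀ hmono htail hc hcn (half_pos hθ)]
    with n hn hresidual herror t
  have hu := integrable_quadForm
    (fun i hi => memLp_residual hn β (memLp_process hT h.memLp) hi) (lagWindow (c n) t)
  have hv := integrable_quadForm_process hT h.memLp (lagWindow (c n) t) n
  have huv := (hu.sub hv).abs
  have hvf := (hv.sub (integrable_const (2 * π * n * densityOf (acov T.toEquiv μ Z) t))).abs
  refine (integral_mono_of_nonneg (Eventually.of_forall fun _ => abs_nonneg _) (huv.add hvf)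
    (Eventually.of_forall fun _ => abs_sub_le _ _ _)).trans ?_
  refine (integral_add huv hvf).trans_le ?_
  exact (add_le_add (hresidual t) (herror t)).trans_eq (by ring)

lemma eLpNorm_spectralEstimator_sub_le [IsFiniteMeasure μ] {ε : ℤ → Ω → ℝ}
    (hε : ∀ i, MemLp (ε i) 2 μ) (β : Fin p → ℝ) {n : ℕ} (hn : 0 < n)
    (hdet : IsUnit ((designMatrix x n).transpose * designMatrix x n).det) {c : ℕ} {t b θ : ℝ}
    (h : ∫ ω, |quadForm (lagWindow c t) n (fun i => residual x (response x β ε) n i ω) -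
      2 * π * n * b| ∂μ ≤ θ * n) :
    eLpNorm (fun ω => spectralEstimator x (response x β ε) c n t ω - (b : ℂ)) 1 μ ≤
      ENNReal.ofReal θ := by
  set q : Ω → ℝ := fun ω =>
    quadForm (lagWindow c t) n (fun i => residual x (response x β ε) n i ω) - 2 * π * n * b
  have hq : Integrable q μ := (integrable_quadForm
    (fun i hi => memLp_residual hdet β hε hi) _).sub (integrable_const _)
  have hscale : 0 < 1 / (2 * π * n) := by positivity
  have hestimator : ∀ ω, spectralEstimator x (response x β ε) c n t ω - (b : ℂ) =
      ((1 / (2 * π * n) * q ω : ℝ) : ℂ) := fun ω => by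
    rw [spectralEstimator_eq, ← Complex.ofReal_sub, mul_sub]
    congr 2
    field_simp
  simp_rw [hestimator]
  rw [eLpNorm_one_eq_lintegral_enorm,
    ← ofReal_integral_norm_eq_lintegral_enorm (hq.const_mul _).ofReal]
  refine ENNReal.ofReal_le_ofReal ?_
  simp_rw [Complex.norm_real, norm_mul, Real.norm_eq_abs, abs_of_pos hscale]
  have hθ : 0 ≤ θ := nonneg_of_mul_nonneg_left
    ((integral_nonneg fun _ => abs_nonneg _).trans h) (Nat.cast_pos.2 hn)
  calc ∫ ω, 1 / (2 * π * n) * |q ω| ∂μ = 1 / (2 * π * n) * ∫ ω, |q ω| ∂μ := integral_const_mul _ _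
    _ ≤ 1 / (2 * π * n) * (θ * n) := by gcongr
    _ = θ / (2 * π) := by field_simp
    _ ≤ θ := div_le_self hθ (by linarith [Real.pi_gt_three])

lemma tendsto_iSup_eLpNorm_spectralEstimator_sub [IsFiniteMeasure μ] {ε : ℤ → Ω → ℝ}
    (hε : ∀ i, MemLp (ε i) 2 μ) (β : Fin p → ℝ)
    (hdet : ∀ᶠ n in atTop, IsUnit ((designMatrix x n).transpose * designMatrix x n).det)
    {c : ℕ → ℕ} {f : ℝ → ℝ} {I : Set ℝ}
    (h : ∀ θ > 0, ∀ᶠ n : ℕ in atTop, ∀ t ∈ I,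
      ∫ ω, |quadForm (lagWindow (c n) t) n (fun i => residual x (response x β ε) n i ω) -
        2 * π * n * f t| ∂μ ≤ θ * n) :
    Tendsto (fun n : ℕ => ⨆ t ∈ I,
      eLpNorm (fun ω => spectralEstimator x (response x β ε) (c n) n t ω - (f t : ℂ)) 1 μ)
      atTop (𝓝 0) := by
  refine ENNReal.tendsto_nhds_zero.2 fun e he => ?_
  obtain ⟨θ, hθ, hθe⟩ := ENNReal.lt_iff_exists_nnreal_btwn.1 he
  filter_upwards [hdet, eventually_gt_atTop 0, h θ (NNReal.coe_pos.2 (by exact_mod_cast hθ))]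
    with n hndet hn hθn
  refine iSup₂_le fun t ht => (eLpNorm_spectralEstimator_sub_le hε β hn hndet (hθn t ht)).trans ?_
  exact ENNReal.ofReal_coe_nnreal.trans_le hθe.le

end Consistency

end HannanRegression

end

open HannanRegression in
theorem theorem3p1_general {Ω : Type*} (F₀ : MeasurableSpace Ω) [mΩ : MeasurableSpace Ω]
    (μ : Measure Ω) [IsProbabilityMeasure μ] (T : Ω ≃ᵐ Ω) (hT : MeasurePreserving T μ μ)
    (ε₀ : Ω → ℝ) (hL2 : MemLp ε₀ 2 μ) (hmean : ∫ ω, ε₀ ω ∂μ = 0)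
    (hF₀ : F₀ ≤ mΩ) (hmono : F₀ ≤ F₀.comap T)
    (htail : ∀ s : Set Ω, MeasurableSet[⨅ i : ℤ, filt F₀ T.toEquiv i] s → μ s = 0 ∨ μ s = 1)
    (hmeas : Measurable[⨆ i : ℤ, filt F₀ T.toEquiv i] ε₀)
    (hC1 : ∑' i : ℤ, eLpNorm (proj (filt F₀ T.toEquiv) μ 0 (process T.toEquiv ε₀ i)) 2 μ < ⊤)
    {p : ℕ} (x : ℕ → Fin p → ℝ) (β : Fin p → ℝ)
    (hdet : ∀ᶠ n in atTop, IsUnit ((designMatrix x n).transpose * designMatrix x n).det)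
    (c : ℕ → ℕ) (hc : Tendsto c atTop atTop)
    (hcn : ¬ ε₀ =ᵐ[μ] 0 → Tendsto (fun n => (c n : ℝ) / n) atTop (𝓝 0)) :
    (∃ f : ℝ → ℝ, ContinuousOn f (Set.Icc (-Real.pi) Real.pi) ∧
      IsSpectralDensity μ (process T.toEquiv ε₀) f) ∧
    ∀ f : ℝ → ℝ, ContinuousOn f (Set.Icc (-Real.pi) Real.pi) →
      IsSpectralDensity μ (process T.toEquiv ε₀) f →
      Tendsto
        (fun n : ℕ => ⨆ t ∈ Set.Icc (-Real.pi) Real.pi,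
          eLpNorm (fun ω => spectralEstimator x (response x β (process T.toEquiv ε₀))
            (c n) n t ω - (f t : ℂ)) 1 μ)
        atTop (𝓝 0) := by
  have hε₀ := isMovingAverage_proj hT hF₀ hmono htail hL2 hmean hmeas hC1
  have hγ := hε₀.summable_acov hF₀ hmono
  have hdensity := isSpectralDensity_densityOf hT hL2 hmean hγ
  have hcont := (continuous_densityOf hγ).continuousOn (s := Set.Icc (-Real.pi) Real.pi)
  refine ⟨⟨_, hcont, hdensity⟩, fun f hf hfdensity => ?_⟩
  refine tendsto_iSup_eLpNorm_spectralEstimator_sub (memLp_process hT hL2) β hdet fun θ hθ => ?_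
  have heq := hfdensity.eqOn hdensity hf hcont
  by_cases hzero : ε₀ =ᵐ[μ] 0
  · filter_upwards [hdet] with n hn t ht
    rw [heq ht, integral_abs_quadForm_residual_sub_density_eq_zero hT hzero β hn]
    positivity
  · filter_upwards [hε₀.eventually_integral_abs_quadForm_residual_le hF₀ hmono htail β hdet hc
      (hcn hzero) hθ] with n hn t ht
    rw [heq ht]
    exact hn t

theorem theorem3p1 {Ω : Type*} (F₀ : MeasurableSpace Ω) [mΩ : MeasurableSpace Ω]
    (μ : Measure Ω) [IsProbabilityMeasure μ]
    -- the error process and the filtration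
    (T : Ω ≃ᵐ Ω) (hT : MeasurePreserving T μ μ)
    (ε₀ : Ω → ℝ) (hL2 : MemLp ε₀ 2 μ) (hmean : ∫ ω, ε₀ ω ∂μ = 0)
    (hF₀ : F₀ ≤ mΩ) (hmono : F₀ ≤ F₀.comap T)
    (htail : ∀ s : Set Ω,
      MeasurableSet[⨅ i : ℤ, HannanRegression.filt F₀ T.toEquiv i] s → μ s = 0 ∨ μ s = 1)
    (hmeas : Measurable[⨆ i : ℤ, HannanRegression.filt F₀ T.toEquiv i] ε₀)
    -- (C1)
    (hC1 : ∑' i : ℤ, eLpNorm (HannanRegression.proj (HannanRegression.filt F₀ T.toEquiv) μ 0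
      (HannanRegression.process T.toEquiv ε₀ i)) 2 μ < ⊤)
    -- the design
    {p : ℕ} (x : ℕ → Fin p → ℝ) (β : Fin p → ℝ)
    -- (C2)
    (hC2 : ∀ j, Tendsto (fun n => HannanRegression.colNorm x j n) atTop atTop)
    -- (C3)
    (hC3 : ∀ j, Tendsto
      (fun n : ℕ => (⨆ i : Fin n, |x (i.val + 1) j|) / HannanRegression.colNorm x j n)
      atTop (𝓝 0))
    -- (C4)
    (ρ : Fin p → Fin p → ℕ → ℝ)
    (hC4 : ∀ j l k, Tendsto
      (fun n : ℕ => ∑ m ∈ Finset.Icc 1 (n - k), x m j * x (m + k) l /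
        (HannanRegression.colNorm x j n * HannanRegression.colNorm x l n))
      atTop (𝓝 (ρ j l k)))
    -- (C5)
    (hC5 : (Matrix.of fun j l => ρ j l 0).PosDef)
    -- the bandwidth
    (c : ℕ → ℕ) (hcpos : ∀ n, 0 < c n) (hc : Tendsto c atTop atTop)
    (hmoment : Tendsto
      (fun n : ℕ => (c n : ℝ) *
        ∫ ω, |ε₀ ω| ^ 2 * min 1 ((c n : ℝ) / (n : ℝ) * |ε₀ ω| ^ 2) ∂μ)
      atTop (𝓝 0)) :
    -- a continuous version of the spectral density exists, and for it (it is unique on `[-π, π]`)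
    -- the estimator is consistent
    (∃ f : ℝ → ℝ, ContinuousOn f (Set.Icc (-Real.pi) Real.pi) ∧
      HannanRegression.IsSpectralDensity μ (HannanRegression.process T.toEquiv ε₀) f) ∧
    ∀ f : ℝ → ℝ, ContinuousOn f (Set.Icc (-Real.pi) Real.pi) →
      HannanRegression.IsSpectralDensity μ (HannanRegression.process T.toEquiv ε₀) f →
      Tendsto
        (fun n : ℕ => ⨆ t ∈ Set.Icc (-Real.pi) Real.pi,
          eLpNorm (fun ω => HannanRegression.spectralEstimator x
            (HannanRegression.response x β (HannanRegression.process T.toEquiv ε₀))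
            (c n) n t ω - (f t : ℂ)) 1 μ)
        atTop (𝓝 0) := by
  exact theorem3p1_general F₀ μ T hT ε₀ hL2 hmean hF₀ hmono htail hmeas hC1 x β
    (HannanRegression.eventually_isUnit_det_gram hC5 fun j l => hC4 j l 0) c hc
    fun hε₀ => HannanRegression.tendsto_bandwidth_div hL2 hε₀ hc hmoment
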